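/- Let $D\subset\mathbb R^n$ be a bounded open set, $H=L^2(D)$, $V=H^1_0(D)$, $V'=H^{-1}(D)$, and let $(\Omega,\mathcal F,\mathbb P)$ be a probability space. For a Banach space $X$ write $X_{\mathbb P}=L^2_{\mathbb P}(\Omega;X)$, and for an interval $(s_1,s_2)$ let $$W(s_1,s_2)=\{v\in L^2((s_1,s_2);V):\partial_t v\in L^2((s_1,s_2);V')\},\qquad W_{\mathbb P}(s_1,s_2)=\{v\in L^2((s_1,s_2);V_{\mathbb P}):\partial_t v\in L^2((s_1,s_2);V'_{\mathbb P})\},$$ with norms $\|v\|_{W}^2=\|v\|^2_{L^2(V)}+\|\partial_tv\|^2_{L^2(V')}$ and $\|v\|_{W_{\mathbb P}}^2=\|v\|^2_{L^2(V_{\mathbb P})}+\|\partial_tv\|^2_{L^2(V'_{\mathbb P})}$; $W_{\mathbb P}(s_1,s_2)$ is identified with $L^2_{\mathbb P}(\Omega;W(s_1,s_2))$. Let $\nu_{\min},\nu_{\max}$ be random variables with $\nu_{\max},\,1/\nu_{\min}\in L^p_{\mathbb P}(\Omega)$ for all $p\in[1,\infty)$, let $a\in L^\infty((0,\infty)\times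 D)$, and let $T>0$. Then there are constants $c_3,c_4>0$, depending only on $T$, $a$, $D$ and on $(\Omega,\mathbb P,\nu_{\min},\nu_{\max})$, such that the following holds. Let $\nu:\Omega\times D\to\mathbb R$ be a (jointly measurable) random field with $$0<\nu_{\min}(\omega)\le\nu(\omega,x)\le\nu_{\max}(\omega)<\infty\quad\text{for a.e. }x\in D,\ \text{for almost every }\omega\in\Omega.$$ For all $t_0>0$, $y_0\in H$ and $f\in L^2((t_0,t_0+T);H)$ there is a unique $y\in W_{\mathbb P}(t_0,t_0+T)$ such that, for almost every $\omega$, $y(\omega)\in W(t_0,t_0+T)$ is a weak solution of $$\partial_t y-\nabla\cdot(\nu(\omega,x)\nabla y)+a(t,x)y=f\ \text{ in }(t_0,t_0+T)\times D,\qquad y=0\ \text{ on }(t_0,t_0+T)\times\partial D,\qquad y(t_0)=y_0,$$ that is, $\int_{t_0}^{t_0+T}\big(\langle\partial_ty(\omega,t),\varphi(t)\rangle_{V',V}+\int_D\nu(\omega,x)\nabla y\cdot\nabla\varphi\,dx+\int_D a\,y\,\varphi\,dx\big)dt=\int_{t_0}^{t_0+T}(f(t),\varphi(t))_H\,dt$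 for all $\varphi\in L^2((t_0,t_0+T);V)$, and the representative of $y(\omega)$ in $C([t_0,t_0+T];H)$ takes the value $y_0$ at $t_0$. This $y$ has a representative in $C([t_0,t_0+T];H_{\mathbb P})$, which equals $y_0$ (as a constant random variable) at $t_0$, and $$\|y\|^2_{C([t_0,t_0+T];H_{\mathbb P})}+\|y\|^2_{W_{\mathbb P}(t_0,t_0+T)}\le c_3\left(\|y_0\|_H^2+\|f\|^2_{L^2((t_0,t_0+T);H)}\right),$$ $$\|y_0\|_H^2\le c_4\,\|y\|^2_{L^2((t_0,t_0+T);V_{\mathbb P})}+\|f\|^2_{L^2((t_0,t_0+T);H)}.$$ -/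

import Mathlib

open MeasureTheory Set Filter
open scoped ENNReal NNReal

noncomputable section

namespace RandomParabolic

/-! ## Spaces in the space variable -/

/-- `ℝⁿ` with the Euclidean norm. -/
abbrev E (n : ℕ) : Type := EuclideanSpace ℝ (Fin n)

/-- `H = L²(D; ℝ)`. -/
abbrev L2 {n : ℕ} (D : Set (E n)) : Type :=
  Lp ℝ 2 ((volume : Measure (E n)).restrict D)

/-- `L²(D; ℝⁿ)`. -/
abbrev L2Vec {n : ℕ} (D : Set (E n)) : Type :=
  Lp (E n) 2 ((volume : Measure (E n)).restrict D)

/-- `φ ∈ C_c^∞(D)`. -/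
def IsTestFunction {F : Type*} [NormedAddCommGroup F] [NormedSpace ℝ F] (D : Set F)
    (φ : F → ℝ) : Prop :=
  ContDiff ℝ ((⊤ : ℕ∞) : WithTop ℕ∞) φ ∧ HasCompactSupport φ ∧ tsupport φ ⊆ D

section TestFunction

variable {F : Type*} [NormedAddCommGroup F] [NormedSpace ℝ F] {D : Set F}

theorem IsTestFunction.zero : IsTestFunction D (0 : F → ℝ) :=
  ⟨contDiff_const, HasCompactSupport.zero, by simp [tsupport]⟩

theorem IsTestFunction.add {φ ψ : F → ℝ} (hφ : IsTestFunction D φ) (hψ : IsTestFunction D ψ) :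
    IsTestFunction D (φ + ψ) :=
  ⟨hφ.1.add hψ.1, hφ.2.1.add hψ.2.1,
    (tsupport_add φ ψ).trans (union_subset hφ.2.2 hψ.2.2)⟩

theorem IsTestFunction.const_smul {φ : F → ℝ} (c : ℝ) (hφ : IsTestFunction D φ) :
    IsTestFunction D (c • φ) :=
  ⟨hφ.1.const_smul c, hφ.2.1.smul_left (f := fun _ => c),
    (tsupport_smul_subset_right (fun _ => c) φ).trans hφ.2.2⟩

end TestFunction

/-- The graph `{(φ, ∇φ) : φ ∈ C_c^∞(D)}` inside `L²(D; ℝ) × L²(D; ℝⁿ)`, the latter with its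
Hilbert norm `(‖u‖² + ‖g‖²)^{1/2}`. -/
def testGraph {n : ℕ} (D : Set (E n)) : Submodule ℝ (WithLp 2 (L2 D × L2Vec D)) where
  carrier := {p | ∃ φ : E n → ℝ, IsTestFunction D φ ∧
    (p.fst : E n → ℝ) =ᵐ[volume.restrict D] φ ∧
    (p.snd : E n → E n) =ᵐ[volume.restrict D] gradient φ}
  zero_mem' := by
    refine ⟨0, IsTestFunction.zero, Lp.coeFn_zero _ _ _, ?_⟩
    have h : gradient (0 : E n → ℝ) = 0 := by
      funext x
      simp [gradient]
    rw [h]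
    exact Lp.coeFn_zero _ _ _
  add_mem' := by
    rintro p q ⟨φ, hφ, hp1, hp2⟩ ⟨ψ, hψ, hq1, hq2⟩
    refine ⟨φ + ψ, hφ.add hψ, (Lp.coeFn_add p.fst q.fst).trans (hp1.add hq1), ?_⟩
    have h : gradient (φ + ψ) = gradient φ + gradient ψ := by
      funext x
      have h1 : DifferentiableAt ℝ φ x := hφ.1.differentiable (by simp) x
      have h2 : DifferentiableAt ℝ ψ x := hψ.1.differentiable (by simp) x
      simp [gradient, fderiv_add h1 h2]
    rw [h]
    exact (Lp.coeFn_add p.snd q.snd).trans (hp2.add hq2)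
  smul_mem' := by
    rintro c p ⟨φ, hφ, hp1, hp2⟩
    refine ⟨c • φ, hφ.const_smul c, (Lp.coeFn_smul c p.fst).trans (hp1.const_smul c), ?_⟩
    have h : gradient (c • φ) = c • gradient φ := by
      funext x
      have h1 : DifferentiableAt ℝ φ x := hφ.1.differentiable (by simp) x
      simp [gradient, fderiv_const_smul h1 c]
    rw [h]
    exact (Lp.coeFn_smul c p.snd).trans (hp2.const_smul c)

/-- `V = H¹₀(D; ℝ)`, the closure of `C_c^∞(D)` in the `H¹`-norm. An element is the pair
`(u, ∇u)` of a function and its weak gradient; the norm is `(‖u‖² + ‖∇u‖²)^{1/2}`. -/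
def H10 {n : ℕ} (D : Set (E n)) : Type := ↥(testGraph D).topologicalClosure

instance {n : ℕ} (D : Set (E n)) : NormedAddCommGroup (H10 D) :=
  inferInstanceAs (NormedAddCommGroup ↥(testGraph D).topologicalClosure)

instance {n : ℕ} (D : Set (E n)) : InnerProductSpace ℝ (H10 D) :=
  inferInstanceAs (InnerProductSpace ℝ ↥(testGraph D).topologicalClosure)

instance {n : ℕ} (D : Set (E n)) : CompleteSpace (H10 D) :=
  inferInstanceAs (CompleteSpace ↥(testGraph D).topologicalClosure)

/-- The pair `(u, ∇u)` of `u ∈ V`. -/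
def H10.pair {n : ℕ} (D : Set (E n)) : H10 D →L[ℝ] WithLp 2 (L2 D × L2Vec D) :=
  (testGraph D).topologicalClosure.subtypeL

/-- `V' = H⁻¹(D; ℝ)`, the dual of `H¹₀(D; ℝ)` with the operator norm. -/
abbrev Hm1 {n : ℕ} (D : Set (E n)) : Type := StrongDual ℝ (H10 D)

/-- The inclusion `V ↪ H`. -/
def toL2 {n : ℕ} (D : Set (E n)) : H10 D →L[ℝ] L2 D :=
  (WithLp.fstL 2 ℝ (L2 D) (L2Vec D)).comp (H10.pair D)

/-- The weak gradient on `V`. -/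
def grad {n : ℕ} (D : Set (E n)) : H10 D →L[ℝ] L2Vec D :=
  (WithLp.sndL 2 ℝ (L2 D) (L2Vec D)).comp (H10.pair D)

/-- The inclusion `V ↪ V'` of the Gelfand triple `V ↪ H ≅ H' ↪ V'`, that is
`⟨u, v⟩_{V',V} = (u, v)_H`. -/
def toDual {n : ℕ} (D : Set (E n)) : H10 D →L[ℝ] Hm1 D :=
  (innerSL ℝ (E := L2 D)).bilinearComp (toL2 D) (toL2 D)

/-! ## Spaces in the time variable -/

/-- `L²((s₁, s₂); X)`. -/
abbrev L2Time (X : Type*) [NormedAddCommGroup X] (s₁ s₂ : ℝ) : Type _ :=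
  Lp X 2 ((volume : Measure ℝ).restrict (Ioo s₁ s₂))

section Time

variable {X Z : Type*} [NormedAddCommGroup X] [NormedSpace ℝ X]
  [NormedAddCommGroup Z] [NormedSpace ℝ Z]

/-- `w = ∂ₜ v` in the sense of `Z`-valued distributions on `(s₁, s₂)`, where `X` is regarded as
a subspace of `Z` through `ι`. -/
def IsTimeDeriv (ι : X →L[ℝ] Z) (s₁ s₂ : ℝ) (v : L2Time X s₁ s₂) (w : L2Time Z s₁ s₂) : Prop :=
  ∀ θ : ℝ → ℝ, IsTestFunction (Ioo s₁ s₂) θ →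
    ∫ t in Ioo s₁ s₂, deriv θ t • ι (v t) = - ∫ t in Ioo s₁ s₂, θ t • w t

theorem integrable_smul_of_continuous {s₁ s₂ : ℝ} {θ : ℝ → ℝ} (hθ : Continuous θ)
    (hc : HasCompactSupport θ) (w : L2Time Z s₁ s₂) :
    Integrable (fun t => θ t • w t) (volume.restrict (Ioo s₁ s₂)) := by
  obtain ⟨C, hC⟩ := hθ.bounded_above_of_compact_support hc
  exact ((Lp.memLp w).integrable one_le_two).bdd_smul C hθ.aestronglyMeasurable
    (Eventually.of_forall hC)

/-- `{v ∈ L²((s₁, s₂); X) : ∂ₜ v ∈ L²((s₁, s₂); Z)}`. An element is the pair `(v, ∂ₜ v)`, and the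
norm is `(‖v‖² + ‖∂ₜ v‖²)^{1/2}`. -/
def timeSobolev (ι : X →L[ℝ] Z) (s₁ s₂ : ℝ) :
    Submodule ℝ (WithLp 2 (L2Time X s₁ s₂ × L2Time Z s₁ s₂)) where
  carrier := {p | IsTimeDeriv ι s₁ s₂ p.fst p.snd}
  zero_mem' := by
    intro θ _
    have h1 : ∫ t in Ioo s₁ s₂, deriv θ t • ι ((0 : L2Time X s₁ s₂) t) = 0 := by
      refine integral_eq_zero_of_ae ?_
      filter_upwards [Lp.coeFn_zero X 2 (volume.restrict (Ioo s₁ s₂))] with t ht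
      rw [ht]; simp
    have h2 : ∫ t in Ioo s₁ s₂, θ t • (0 : L2Time Z s₁ s₂) t = 0 := by
      refine integral_eq_zero_of_ae ?_
      filter_upwards [Lp.coeFn_zero Z 2 (volume.restrict (Ioo s₁ s₂))] with t ht
      rw [ht]; simp
    exact h1.trans (by rw [← neg_zero]; exact congrArg _ h2.symm)
  add_mem' := by
    rintro p q hp hq θ hθ
    have hd : Continuous (deriv θ) := hθ.1.continuous_deriv (by simp)
    have hi : ∀ v : L2Time X s₁ s₂, Integrable (fun t => deriv θ t • ι (v t))
        (volume.restrict (Ioo s₁ s₂)) := fun v => by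
      simpa using ι.integrable_comp (integrable_smul_of_continuous hd hθ.2.1.deriv v)
    have h1 : ∫ t in Ioo s₁ s₂, deriv θ t • ι ((p.fst + q.fst) t) =
        (∫ t in Ioo s₁ s₂, deriv θ t • ι (p.fst t)) +
          ∫ t in Ioo s₁ s₂, deriv θ t • ι (q.fst t) := by
      rw [← integral_add (hi _) (hi _)]
      refine integral_congr_ae ?_
      filter_upwards [Lp.coeFn_add p.fst q.fst] with t ht
      rw [ht, Pi.add_apply]; simp
    have h2 : ∫ t in Ioo s₁ s₂, θ t • (p.snd + q.snd) t =
        (∫ t in Ioo s₁ s₂, θ t • p.snd t) + ∫ t in Ioo s₁ s₂, θ t • q.snd t := by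
      rw [← integral_add (integrable_smul_of_continuous hθ.1.continuous hθ.2.1 _)
        (integrable_smul_of_continuous hθ.1.continuous hθ.2.1 _)]
      refine integral_congr_ae ?_
      filter_upwards [Lp.coeFn_add p.snd q.snd] with t ht
      rw [ht, Pi.add_apply]; simp
    refine h1.trans ?_
    rw [hp θ hθ, hq θ hθ, ← neg_add]
    exact congrArg _ h2.symm
  smul_mem' := by
    rintro c p hp θ hθ
    have h1 : ∫ t in Ioo s₁ s₂, deriv θ t • ι ((c • p.fst) t) =
        c • ∫ t in Ioo s₁ s₂, deriv θ t • ι (p.fst t) := by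
      rw [← integral_smul]
      refine integral_congr_ae ?_
      filter_upwards [Lp.coeFn_smul c p.fst] with t ht
      rw [ht, Pi.smul_apply]; simp [smul_comm c]
    have h2 : ∫ t in Ioo s₁ s₂, θ t • (c • p.snd) t = c • ∫ t in Ioo s₁ s₂, θ t • p.snd t := by
      rw [← integral_smul]
      refine integral_congr_ae ?_
      filter_upwards [Lp.coeFn_smul c p.snd] with t ht
      rw [ht, Pi.smul_apply]; simp [smul_comm c]
    refine h1.trans ?_
    rw [hp θ hθ, smul_neg]
    exact congrArg _ h2.symm

/-- The normed space `{v ∈ L²((s₁, s₂); X) : ∂ₜ v ∈ L²((s₁, s₂); Z)}`. -/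
def TimeSobolev (ι : X →L[ℝ] Z) (s₁ s₂ : ℝ) : Type _ := ↥(timeSobolev ι s₁ s₂)

instance (ι : X →L[ℝ] Z) (s₁ s₂ : ℝ) : NormedAddCommGroup (TimeSobolev ι s₁ s₂) :=
  inferInstanceAs (NormedAddCommGroup ↥(timeSobolev ι s₁ s₂))

instance (ι : X →L[ℝ] Z) (s₁ s₂ : ℝ) : NormedSpace ℝ (TimeSobolev ι s₁ s₂) :=
  inferInstanceAs (NormedSpace ℝ ↥(timeSobolev ι s₁ s₂))

/-- The element `v ∈ L²((s₁, s₂); X)` itself. -/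
def TimeSobolev.val {ι : X →L[ℝ] Z} {s₁ s₂ : ℝ} (y : TimeSobolev ι s₁ s₂) : L2Time X s₁ s₂ :=
  (Subtype.val (p := (· ∈ timeSobolev ι s₁ s₂)) y).fst

/-- The time derivative `∂ₜ v ∈ L²((s₁, s₂); Z)`. -/
def TimeSobolev.dt {ι : X →L[ℝ] Z} {s₁ s₂ : ℝ} (y : TimeSobolev ι s₁ s₂) : L2Time Z s₁ s₂ :=
  (Subtype.val (p := (· ∈ timeSobolev ι s₁ s₂)) y).snd

theorem TimeSobolev.norm_sq {ι : X →L[ℝ] Z} {s₁ s₂ : ℝ} (y : TimeSobolev ι s₁ s₂) :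
    ‖y‖ ^ 2 = ‖y.val‖ ^ 2 + ‖y.dt‖ ^ 2 :=
  WithLp.prod_norm_sq_eq_of_L2 _

theorem TimeSobolev.isTimeDeriv {ι : X →L[ℝ] Z} {s₁ s₂ : ℝ} (y : TimeSobolev ι s₁ s₂) :
    IsTimeDeriv ι s₁ s₂ y.val y.dt :=
  Subtype.prop (p := (· ∈ timeSobolev ι s₁ s₂)) y

/-- `Y ∈ C([s₁, s₂]; X)` is the continuous representative of the function `v` on `(s₁, s₂)`. -/
def IsContRep {s₁ s₂ : ℝ} (Y : C(Icc s₁ s₂, X)) (v : ℝ → X) : Prop :=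
  ∀ᵐ t ∂(volume.restrict (Ioo s₁ s₂)), ∀ ht : t ∈ Icc s₁ s₂, v t = Y ⟨t, ht⟩

end Time

/-- `W(s₁, s₂) = {v ∈ L²((s₁, s₂); V) : ∂ₜ v ∈ L²((s₁, s₂); V')}`. -/
abbrev W {n : ℕ} (D : Set (E n)) (s₁ s₂ : ℝ) : Type := TimeSobolev (toDual D) s₁ s₂

/-! ## Spaces of random functions -/

section Random

variable {n : ℕ} (D : Set (E n)) {Ω : Type*} [MeasurableSpace Ω] (P : Measure Ω)

/-- `V_P = L²_P(Ω; V)`. -/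
abbrev VP : Type _ := Lp (H10 D) 2 P

/-- `V'_P = L²_P(Ω; V')`. -/
abbrev VP' : Type _ := Lp (Hm1 D) 2 P

/-- `H_P = L²_P(Ω; H)`. -/
abbrev HP : Type _ := Lp (L2 D) 2 P

/-- The inclusion `V_P ↪ H_P`. -/
def toHP : VP D P →L[ℝ] HP D P := (toL2 D).compLpL 2 P

/-- The inclusion `V_P ↪ V'_P`. -/
def toDualP : VP D P →L[ℝ] VP' D P := (toDual D).compLpL 2 P

/-- `W_P(s₁, s₂) = {v ∈ L²((s₁, s₂); V_P) : ∂ₜ v ∈ L²((s₁, s₂); V'_P)}`. -/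
abbrev WP (s₁ s₂ : ℝ) : Type _ := TimeSobolev (toDualP D P) s₁ s₂

variable {D P}

/-- The identification of `W_P(s₁, s₂)` with `L²_P(Ω; W(s₁, s₂))`: `y` and `Y` correspond to each
other if they have a common jointly measurable version `z : Ω × (s₁, s₂) → V`. -/
def Corresponds {s₁ s₂ : ℝ} (y : WP D P s₁ s₂) (Y : Lp (W D s₁ s₂) 2 P) : Prop :=
  ∃ z : Ω → ℝ → H10 D,
    AEStronglyMeasurable (Function.uncurry z) (P.prod (volume.restrict (Ioo s₁ s₂))) ∧
    (∀ᵐ t ∂(volume.restrict (Ioo s₁ s₂)),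
      (y.val t : Ω → H10 D) =ᵐ[P] fun ω => z ω t) ∧
    (∀ᵐ ω ∂P, ((Y ω).val : ℝ → H10 D) =ᵐ[volume.restrict (Ioo s₁ s₂)] z ω)

end Random

/-! ## The equation -/

/-- For fixed `κ = ν(ω, ·)`, the function `w ∈ W(t₀, t₀ + T)` is a weak solution of
`∂ₜ w - ∇ · (κ ∇w) + a w = f` in `(t₀, t₀ + T) × D`, `w = 0` on `∂D`, `w(t₀) = y₀`. -/
def IsWeakSolution {n : ℕ} (D : Set (E n)) (κ : E n → ℝ) (a : ℝ → E n → ℝ) (t₀ T : ℝ)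
    (y₀ : L2 D) (f : L2Time (L2 D) t₀ (t₀ + T)) (w : W D t₀ (t₀ + T)) : Prop :=
  (∀ φ : L2Time (H10 D) t₀ (t₀ + T),
    (∫ t in Ioo t₀ (t₀ + T), (w.dt t) (φ t))
      + (∫ t in Ioo t₀ (t₀ + T), ∫ x in D, κ x * inner ℝ (grad D (w.val t) x) (grad D (φ t) x))
      + (∫ t in Ioo t₀ (t₀ + T), ∫ x in D, a t x * toL2 D (w.val t) x * toL2 D (φ t) x)
      = ∫ t in Ioo t₀ (t₀ + T), inner ℝ (f t) (toL2 D (φ t))) ∧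
  ∃ Y : C(Icc t₀ (t₀ + T), L2 D), IsContRep Y (fun t => toL2 D (w.val t)) ∧
    ∀ ht : t₀ ∈ Icc t₀ (t₀ + T), Y ⟨t₀, ht⟩ = y₀

/-- `y ∈ W_P(t₀, t₀ + T)` solves the random equation with diffusion `ν`: its realization
`y(ω) ∈ W(t₀, t₀ + T)` is a weak solution of the equation with diffusion `ν(ω, ·)`, almost
surely. -/
def IsRandomSolution {n : ℕ} {D : Set (E n)} {Ω : Type*} [MeasurableSpace Ω] {P : Measure Ω}
    (ν : Ω → E n → ℝ) (a : ℝ → E n → ℝ) (t₀ T : ℝ)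
    (y₀ : L2 D) (f : L2Time (L2 D) t₀ (t₀ + T)) (y : WP D P t₀ (t₀ + T)) : Prop :=
  ∃ Y : Lp (W D t₀ (t₀ + T)) 2 P, Corresponds y Y ∧
    ∀ᵐ ω ∂P, IsWeakSolution D (ν ω) a t₀ T y₀ f (Y ω)

end RandomParabolic

end

open RandomParabolic

/-!
The dual space `V'` is identified with `V` by the Riesz isomorphism, so that the embedding
`V → V'` becomes `j†j`, where `j : V → H` is the inclusion. Since `j†` is injective (`V` is dense
in `H`), a weak solution is the same as a solution of the equation integrated in time,
`j†j u(t) + ∫_{t₀}^t B(ω, r) u dr = j†y₀ + ∫_{t₀}^t j†f dr`; see `isWeakSolution_iff`.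

*Existence and measurability in `ω`.* For fixed `ω` the integrated equation is a linear equation
`N(ω) u = g` in `L²((t₀, t₁); V)`. By Gårding's inequality, `N(ω)` is coercive against the test
functions `e^{2λ(t - t₀)} ∫_t^{t₁} ψ` (`le_inner_evolution`), and Lions' projection lemma
(`exists_apply_eq_of_coercive`) solves the equation. The lemma is applied not for each `ω` but once
in `L²(Ω; L²((t₀, t₁); V))`, after dividing by the `ω`-dependent bounds of `N(ω)`
(`exists_random_solution`); this makes the pathwise solutions measurable in `ω`.

*Bounds.* The energy identity `‖j u(t)‖² = ‖y₀‖² + 2 ∫ ⟨(j†j u)', u⟩` and the continuous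
representative follow from `integral_deriv_mul_norm_sq` (`exists_isContRep`,
`IsContRep.norm_sq_eq`). With Gronwall's inequality it gives uniqueness for each `ω` and the
estimates of `IsIntegratedSolution.bounds`. The estimate of the `H`-norm does not depend on `ω`.
The one of the `W`-norm has a factor of order `(1 + 1 / νmin)(1 + (νmax + ‖a‖)²)`, which has a
finite expectation because all moments of `1 / νmin` and `νmax` are finite; this is where `c₃` comes
from. Integrating the energy identity against a function of time decreasing from `1` to `0`, one
gets `‖y₀‖² ≤ g(ω) ‖u(ω)‖² + ‖f‖²` with `g` affine in `νmax`; division by `g` and expectation give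
`c₄ = 1 / 𝔼[1 / g]`.

*From paths to `W_P`.* Functions in `L²(Ω; L²((t₀, t₁); X))` and in `L²((t₀, t₁); L²(Ω; X))` are
matched through jointly measurable versions (`curryEquiv`, `IsSwap`), and Bochner integrals in time
of the latter can be computed for each `ω` (`integral_ae_eq_integral_section`). Hence the integrated
equation also holds in `L²(Ω; V)` (`IsSwap.integrated_eq`). It yields the time derivative in
`L²((t₀, t₁); V'_P)`, and `exists_isContRep`, applied to the inclusion `V_P → H_P`, yields the
representative in `C([t₀, t₁]; H_P)`.
-/

noncomputable section

namespace RandomParabolic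

set_option linter.unusedSectionVars false

open scoped Topology InnerProductSpace

/-! ### Curried square-integrable functions -/

section Curry

variable {α β X Z : Type*} [MeasurableSpace α] [MeasurableSpace β]
  [NormedAddCommGroup X] [NormedSpace ℝ X] [NormedAddCommGroup Z] [NormedSpace ℝ Z]
  {μ : Measure α} {ν : Measure β} [IsFiniteMeasure μ] [IsFiniteMeasure ν]

/-- The sections `a ↦ 1_S(a, ·) ∈ L²(ν)` of a measurable set depend strongly measurably on `a`: this
holds for rectangles and is stable under complements and countable disjoint unions. -/
theorem stronglyMeasurable_indicator_section {S : Set (α × β)} (hS : MeasurableSet S) :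
    ∃ U : α → Lp ℝ 2 ν, StronglyMeasurable U ∧
      ∀ a, U a =ᵐ[ν] (Prod.mk a ⁻¹' S).indicator fun _ => (1 : ℝ) := by
  induction S, hS using MeasurableSpace.induction_on_inter generateFrom_prod.symm
    isPiSystem_prod with
  | empty =>
    refine ⟨0, stronglyMeasurable_zero, fun a => ?_⟩
    simp only [Pi.zero_apply, preimage_empty, indicator_empty]
    exact Lp.coeFn_zero ℝ 2 ν
  | basic t ht =>
    obtain ⟨s, hs, r, hr, rfl⟩ := ht
    refine ⟨s.indicator fun _ => indicatorConstLp 2 hr (measure_ne_top ν r) 1,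
      stronglyMeasurable_const.indicator hs, fun a => ?_⟩
    by_cases ha : a ∈ s
    · simpa [ha, Set.mk_preimage_prod_right] using indicatorConstLp_coeFn
    · simp only [ha, not_false_eq_true, indicator_of_notMem, mk_preimage_prod_right_eq_empty,
        indicator_empty]
      exact Lp.coeFn_zero ℝ 2 ν
  | compl t ht h =>
    obtain ⟨U, hU, hUt⟩ := h
    refine ⟨fun a => indicatorConstLp 2 MeasurableSet.univ (measure_ne_top ν _) 1 - U a,
      stronglyMeasurable_const.sub hU, fun a => ?_⟩
    filter_upwards [Lp.coeFn_sub (indicatorConstLp 2 MeasurableSet.univ (measure_ne_top ν _) 1)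
      (U a), hUt a, indicatorConstLp_coeFn (p := 2) (hs := MeasurableSet.univ)
        (hμs := measure_ne_top ν _) (c := (1 : ℝ))] with b h1 h2 h3
    rw [h1, Pi.sub_apply, h2, h3]
    by_cases hb : (a, b) ∈ t <;> simp [hb]
  | iUnion f hd hf h =>
    choose U hU hUf using h
    have hm : ∀ a i, MeasurableSet (Prod.mk a ⁻¹' f i) := fun a i => measurable_prodMk_left (hf i)
    refine ⟨fun a => indicatorConstLp 2 (MeasurableSet.iUnion (hm a)) (measure_ne_top ν _) 1,
      ?_, fun a => ?_⟩
    · refine stronglyMeasurable_of_tendsto (u := atTop)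
        (f := fun (n : ℕ) a => ∑ i ∈ Finset.range n, U i a) ?_ ?_
      · intro n
        exact Finset.stronglyMeasurable_fun_sum _ fun i _ => hU i
      · rw [tendsto_pi_nhds]
        intro a
        have key : ∀ n : ℕ, ∑ i ∈ Finset.range n, U i a =
            indicatorConstLp 2 (Finset.measurableSet_biUnion (Finset.range n) fun i _ => hm a i)
              (measure_ne_top ν _) 1 := by
          intro n
          ext1
          have h1 : ∀ᵐ b ∂ν, ∀ i, U i a b = (Prod.mk a ⁻¹' f i).indicator (fun _ => (1 : ℝ)) b :=
            ae_all_iff.2 fun i => hUf i a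
          filter_upwards [h1, Lp.coeFn_finsetSum (Finset.range n) fun i => U i a,
            indicatorConstLp_coeFn (p := 2) (c := (1 : ℝ)) (μ := ν)
              (hs := Finset.measurableSet_biUnion (Finset.range n) fun i _ => hm a i)
              (hμs := measure_ne_top ν _)] with b hb1 hb2 hb3
          rw [hb2, hb3, Finset.sum_apply, Finset.indicator_biUnion]
          · exact Finset.sum_congr rfl fun i _ => hb1 i
          · intro i _ j _ hij
            exact (hd hij).preimage _
        simp only [key]
        refine tendsto_indicatorConstLp_set (by simp) ?_
        have hle : ∀ n : ℕ, (⋃ i ∈ Finset.range n, Prod.mk a ⁻¹' f i) ⊆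
            ⋃ i, Prod.mk a ⁻¹' f i := fun n => iUnion₂_subset fun i _ =>
              subset_iUnion (fun i => Prod.mk a ⁻¹' f i) i
        have hT : Tendsto (fun n : ℕ => ν ((⋃ i, Prod.mk a ⁻¹' f i) \
            ⋃ i ∈ Finset.range n, Prod.mk a ⁻¹' f i)) atTop (𝓝 0) := by
          have := tendsto_measure_iInter_atTop (μ := ν)
            (s := fun n : ℕ => (⋃ i, Prod.mk a ⁻¹' f i) \
              ⋃ i ∈ Finset.range n, Prod.mk a ⁻¹' f i)
            (fun n => ((MeasurableSet.iUnion (hm a)).diff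
              (Finset.measurableSet_biUnion _ fun i _ => hm a i)).nullMeasurableSet)
            (fun n m hnm => sdiff_subset_sdiff_right
              (biUnion_subset_biUnion_left fun i hi =>
                Finset.mem_range.2 ((Finset.mem_range.1 hi).trans_le hnm)))
            ⟨0, measure_ne_top ν _⟩
          have h0 : (⋂ n : ℕ, (⋃ i, Prod.mk a ⁻¹' f i) \
              ⋃ i ∈ Finset.range n, Prod.mk a ⁻¹' f i) = ∅ := by
            ext b
            simp only [mem_iInter, Set.mem_sdiff, mem_iUnion, Finset.mem_range, mem_empty_iff_false,
              iff_false, not_forall]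
            by_cases hb : ∃ i, b ∈ Prod.mk a ⁻¹' f i
            · obtain ⟨i, hi⟩ := hb
              exact ⟨i + 1, fun h => h.2 ⟨i, by simp, hi⟩⟩
            · exact ⟨0, fun h => hb h.1⟩
          rwa [h0, measure_empty] at this
        refine hT.congr fun n => ?_
        rw [symmDiff_of_le (hle n)]
    · have : Prod.mk a ⁻¹' (⋃ i, f i) = ⋃ i, Prod.mk a ⁻¹' f i := preimage_iUnion
      rw [this]
      exact indicatorConstLp_coeFn

theorem stronglyMeasurable_simpleFunc_section (f : SimpleFunc (α × β) X) :
    ∃ U : α → Lp X 2 ν, StronglyMeasurable U ∧ ∀ a, U a =ᵐ[ν] fun b => f (a, b) := by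
  induction f using SimpleFunc.induction with
  | const c hS =>
    obtain ⟨U, hU, hUS⟩ := stronglyMeasurable_indicator_section (ν := ν) hS
    let L : ℝ →L[ℝ] X := ContinuousLinearMap.toSpanSingleton ℝ c
    refine ⟨fun a => L.compLpL 2 ν (U a),
      (L.compLpL 2 ν).continuous.comp_stronglyMeasurable hU, fun a => ?_⟩
    filter_upwards [L.coeFn_compLpL (U a), hUS a] with b h1 h2
    rw [h1, h2]
    classical
    simp only [SimpleFunc.coe_piecewise, SimpleFunc.coe_const, L,
      ContinuousLinearMap.toSpanSingleton_apply, Set.indicator_apply, mem_preimage,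
      Set.piecewise, Function.const_apply]
    split_ifs <;> simp
  | add _ hf hg =>
    obtain ⟨U, hU, hUf⟩ := hf
    obtain ⟨V, hV, hVg⟩ := hg
    refine ⟨fun a => U a + V a, hU.add hV, fun a => ?_⟩
    filter_upwards [Lp.coeFn_add (U a) (V a), hUf a, hVg a] with b h1 h2 h3
    rw [h1, Pi.add_apply, h2, h3, SimpleFunc.coe_add, Pi.add_apply]

/-- A curried function `a ↦ z(a, ·) ∈ L²(ν; X)` is strongly measurable if `z` is jointly
measurable. No countability of `α` or `β` is needed. -/
theorem aestronglyMeasurable_of_ae_eq_section {z : α × β → X}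
    (hz : AEStronglyMeasurable z (μ.prod ν)) {U : α → Lp X 2 ν}
    (hU : ∀ᵐ a ∂μ, U a =ᵐ[ν] fun b => z (a, b)) : AEStronglyMeasurable U μ := by
  obtain ⟨z', hz', hzz'⟩ := hz
  have hU' : ∀ᵐ a ∂μ, U a =ᵐ[ν] fun b => z' (a, b) := by
    filter_upwards [hU, Measure.ae_ae_of_ae_prod hzz'] with a h1 h2
    exact h1.trans h2
  borelize X
  have hm : Measurable z' := hz'.measurable
  have : TopologicalSpace.SeparableSpace (range z' ∪ {0} : Set X) :=
    hz'.separableSpace_range_union_singleton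
  let g : ℕ → SimpleFunc (α × β) X := fun n =>
    SimpleFunc.approxOn z' hm (range z' ∪ {0}) 0 (by simp) n
  choose V hV hVg using fun n => stronglyMeasurable_simpleFunc_section (ν := ν) (g n)
  refine aestronglyMeasurable_of_tendsto_ae atTop (f := V)
    (fun n => (hV n).aestronglyMeasurable) ?_
  filter_upwards [hU'] with a ha
  have hmem : MemLp (fun b => z' (a, b)) 2 ν := (memLp_congr_ae ha).1 (Lp.memLp (U a))
  rw [Lp.tendsto_Lp_iff_tendsto_eLpNorm']
  have hma : Measurable (fun b => z' (a, b)) := hm.comp measurable_prodMk_left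
  have h := SimpleFunc.tendsto_approxOn_Lp_eLpNorm (p := 2) (μ := ν) hma
    (s := range z' ∪ {0}) (y₀ := 0) (by simp) (by simp)
    (Eventually.of_forall fun b => subset_closure (by simp)) (by simpa using hmem.2)
  refine h.congr fun n => eLpNorm_congr_ae ?_
  filter_upwards [ha, hVg n a] with b h1 h2
  simp only [Pi.sub_apply, h1, h2]
  rfl

theorem eLpNorm_of_ae_eq_section {z : α × β → X} (hz : AEStronglyMeasurable z (μ.prod ν))
    {U : α → Lp X 2 ν} (hU : ∀ᵐ a ∂μ, U a =ᵐ[ν] fun b => z (a, b)) :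
    eLpNorm U 2 μ = eLpNorm z 2 (μ.prod ν) := by
  have h2 : (2 : ℝ≥0∞) ≠ 0 := two_ne_zero
  have h2' : (2 : ℝ≥0∞) ≠ ∞ := by simp
  rw [eLpNorm_eq_lintegral_rpow_enorm_toReal h2 h2', eLpNorm_eq_lintegral_rpow_enorm_toReal h2 h2']
  congr 1
  rw [lintegral_prod _ (hz.enorm.pow_const _)]
  refine lintegral_congr_ae ?_
  filter_upwards [hU] with a ha
  rw [Lp.enorm_def, eLpNorm_congr_ae ha, eLpNorm_eq_lintegral_rpow_enorm_toReal h2 h2',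
    ← ENNReal.rpow_mul]
  simp

theorem ae_memLp_section {z : α × β → X} (hz : MemLp z 2 (μ.prod ν)) :
    ∀ᵐ a ∂μ, MemLp (fun b => z (a, b)) 2 ν := by
  have h2 : (2 : ℝ≥0∞) ≠ 0 := two_ne_zero
  have h2' : (2 : ℝ≥0∞) ≠ ∞ := by simp
  have h1 := hz.1.prodMk_left
  have hlt : ∫⁻ a, ∫⁻ b, ‖z (a, b)‖ₑ ^ (2 : ℝ≥0∞).toReal ∂ν ∂μ ≠ ∞ := by
    rw [← lintegral_prod _ (hz.1.enorm.pow_const _)]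
    exact (lintegral_rpow_enorm_lt_top_of_eLpNorm_lt_top h2 h2' hz.2).ne
  have h3 := ae_lt_top' (hz.1.enorm.pow_const _).lintegral_prod_right' hlt
  filter_upwards [h1, h3] with a ha1 ha3
  exact ⟨ha1, (eLpNorm_lt_top_iff_lintegral_rpow_enorm_lt_top h2 h2').2 ha3⟩

open Classical in
/-- The curried form `a ↦ z(a, ·)` of `z ∈ L²(μ ⊗ ν; X)`. The value is `0` at the (negligible) `a`
whose section is not square-integrable. -/
def curryFun (ν : Measure β) (z : α × β → X) (a : α) : Lp X 2 ν :=
  if h : MemLp (fun b => z (a, b)) 2 ν then h.toLp _ else 0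

theorem ae_curryFun_eq {z : α × β → X} (hz : MemLp z 2 (μ.prod ν)) :
    ∀ᵐ a ∂μ, curryFun ν z a =ᵐ[ν] fun b => z (a, b) := by
  filter_upwards [ae_memLp_section hz] with a ha
  rw [curryFun, dif_pos ha]
  exact ha.coeFn_toLp

theorem memLp_curryFun {z : α × β → X} (hz : MemLp z 2 (μ.prod ν)) :
    MemLp (curryFun ν z) 2 μ :=
  ⟨aestronglyMeasurable_of_ae_eq_section hz.1 (ae_curryFun_eq hz), by
    rw [eLpNorm_of_ae_eq_section hz.1 (ae_curryFun_eq hz)]; exact hz.2⟩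

/-- The isometry `L²(μ ⊗ ν; X) → L²(μ; L²(ν; X))`. -/
def curryLI (μ : Measure α) (ν : Measure β) [IsFiniteMeasure μ] [IsFiniteMeasure ν] :
    Lp X 2 (μ.prod ν) →ₗᵢ[ℝ] Lp (Lp X 2 ν) 2 μ where
  toFun z := (memLp_curryFun (Lp.memLp z)).toLp _
  map_add' z w := by
    ext1
    filter_upwards [(memLp_curryFun (Lp.memLp (z + w))).coeFn_toLp,
      Lp.coeFn_add ((memLp_curryFun (Lp.memLp z)).toLp _) ((memLp_curryFun (Lp.memLp w)).toLp _),
      (memLp_curryFun (Lp.memLp z)).coeFn_toLp, (memLp_curryFun (Lp.memLp w)).coeFn_toLp,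
      ae_curryFun_eq (Lp.memLp z), ae_curryFun_eq (Lp.memLp w), ae_curryFun_eq (Lp.memLp (z + w)),
      Measure.ae_ae_of_ae_prod (Lp.coeFn_add z w)] with a h1 h2 h3 h4 h5 h6 h7 h8
    rw [h1, h2, Pi.add_apply, h3, h4]
    ext1
    filter_upwards [h5, h6, h7, h8, Lp.coeFn_add (curryFun ν z a) (curryFun ν w a)]
      with b k5 k6 k7 k8 k9
    rw [k7, k9, k8, Pi.add_apply, Pi.add_apply, k5, k6]
  map_smul' c z := by
    ext1
    filter_upwards [(memLp_curryFun (Lp.memLp (c • z))).coeFn_toLp,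
      Lp.coeFn_smul c ((memLp_curryFun (Lp.memLp z)).toLp _),
      (memLp_curryFun (Lp.memLp z)).coeFn_toLp,
      ae_curryFun_eq (Lp.memLp z), ae_curryFun_eq (Lp.memLp (c • z)),
      Measure.ae_ae_of_ae_prod (Lp.coeFn_smul c z)] with a h1 h2 h3 h5 h7 h8
    rw [h1, RingHom.id_apply, h2, Pi.smul_apply, h3]
    ext1
    filter_upwards [h5, h7, h8, Lp.coeFn_smul c (curryFun ν z a)]
      with b k5 k7 k8 k9
    rw [k7, k9, k8, Pi.smul_apply, Pi.smul_apply, k5]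
  norm_map' z := by
    change ‖(memLp_curryFun (Lp.memLp z)).toLp _‖ = ‖z‖
    rw [Lp.norm_toLp, eLpNorm_of_ae_eq_section (Lp.memLp z).1 (ae_curryFun_eq (Lp.memLp z)),
      Lp.norm_def]

theorem ae_curryLI_eq (z : Lp X 2 (μ.prod ν)) :
    ∀ᵐ a ∂μ, curryLI μ ν z a =ᵐ[ν] fun b => z (a, b) := by
  filter_upwards [(memLp_curryFun (Lp.memLp z)).coeFn_toLp, ae_curryFun_eq (Lp.memLp z)]
    with a h1 h2
  have : curryLI μ ν z a = curryFun ν z a := h1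
  rwa [this]

/-- The range is closed, since `curryLI` is an isometry, and contains the simple functions. -/
theorem curryLI_surjective [CompleteSpace X] :
    Function.Surjective (curryLI (X := X) μ ν) := by
  have hcl : IsClosed (range (curryLI (X := X) μ ν)) :=
    (curryLI μ ν).isometry.isClosedEmbedding.isClosed_range
  intro u
  refine Lp.induction (p := 2) (by simp) (motive := fun u => u ∈ range (curryLI (X := X) μ ν))
    ?_ ?_ hcl u
  · intro g s hs hμs
    have hz : AEStronglyMeasurable (fun p : α × β => s.indicator (fun _ => (1 : ℝ)) p.1 • g p.2)
        (μ.prod ν) :=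
      ((stronglyMeasurable_const.indicator hs).aestronglyMeasurable.comp_fst).smul
        (Lp.aestronglyMeasurable g).comp_snd
    have hU : ∀ a, (s.indicator (fun _ => g) a : Lp X 2 ν) =ᵐ[ν]
        fun b => s.indicator (fun _ => (1 : ℝ)) a • g b := by
      intro a
      by_cases ha : a ∈ s
      · simp [ha]
      · simp only [ha, not_false_eq_true, indicator_of_notMem, zero_smul]
        exact Lp.coeFn_zero X 2 ν
    have hzm : MemLp (fun p : α × β => s.indicator (fun _ => (1 : ℝ)) p.1 • g p.2) 2
        (μ.prod ν) := by
      refine ⟨hz, ?_⟩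
      rw [← eLpNorm_of_ae_eq_section hz (Eventually.of_forall hU)]
      exact (memLp_indicator_const 2 hs g (Or.inr hμs.ne)).2
    refine ⟨hzm.toLp _, ?_⟩
    ext1
    rw [Lp.simpleFunc.coe_indicatorConst]
    filter_upwards [ae_curryLI_eq (hzm.toLp _), Measure.ae_ae_of_ae_prod hzm.coeFn_toLp,
      indicatorConstLp_coeFn (p := 2) (hs := hs) (hμs := hμs.ne) (c := g)] with a h1 h2 h3
    rw [h3]
    ext1
    exact (h1.trans h2).trans (hU a).symm
  · rintro f g hf hg - ⟨z, hz⟩ ⟨w, hw⟩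
    exact ⟨z + w, by rw [map_add, hz, hw]⟩

/-- `L²(μ ⊗ ν; X) ≅ L²(μ; L²(ν; X))`. -/
def curryEquiv [CompleteSpace X] (μ : Measure α) (ν : Measure β) [IsFiniteMeasure μ]
    [IsFiniteMeasure ν] : Lp X 2 (μ.prod ν) ≃ₗᵢ[ℝ] Lp (Lp X 2 ν) 2 μ :=
  LinearIsometryEquiv.ofSurjective (curryLI μ ν) curryLI_surjective

theorem ae_curryEquiv_eq [CompleteSpace X] (z : Lp X 2 (μ.prod ν)) :
    ∀ᵐ a ∂μ, curryEquiv μ ν z a =ᵐ[ν] fun b => z (a, b) :=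
  ae_curryLI_eq z

end Curry

section Swap

variable {α β X Z : Type*} [MeasurableSpace α] [MeasurableSpace β]
  [NormedAddCommGroup X] [NormedSpace ℝ X] [NormedAddCommGroup Z] [NormedSpace ℝ Z]
  {μ : Measure α} {ν : Measure β} [IsFiniteMeasure μ] [IsFiniteMeasure ν]

/-- Square-integrable functions with values in `L²(ν; X)` come from jointly measurable functions. -/
theorem exists_joint_version [CompleteSpace X] (u : Lp (Lp X 2 ν) 2 μ) :
    ∃ z : α × β → X, MemLp z 2 (μ.prod ν) ∧ ∀ᵐ a ∂μ, u a =ᵐ[ν] fun b => z (a, b) := by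
  obtain ⟨z, rfl⟩ := (curryEquiv μ ν).surjective u
  exact ⟨z, Lp.memLp z, ae_curryEquiv_eq z⟩

theorem memLp_comp_swap {z : α × β → X} (hz : MemLp z 2 (μ.prod ν)) :
    MemLp (fun p : β × α => z (p.2, p.1)) 2 (ν.prod μ) :=
  hz.comp_measurePreserving Measure.measurePreserving_swap

/-- The section-wise form `b ↦ z(·, b) ∈ L²(μ; X)` of a jointly square-integrable `z`, together
with its norm. -/
theorem exists_swapped {z : α × β → X} (hz : MemLp z 2 (μ.prod ν)) (u : Lp (Lp X 2 ν) 2 μ)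
    (hu : ∀ᵐ a ∂μ, u a =ᵐ[ν] fun b => z (a, b)) :
    ∃ v : Lp (Lp X 2 μ) 2 ν, (∀ᵐ b ∂ν, v b =ᵐ[μ] fun a => z (a, b)) ∧ ‖v‖ = ‖u‖ := by
  have hz' := memLp_comp_swap hz
  have hv : ∀ᵐ b ∂ν, (memLp_curryFun hz').toLp _ b =ᵐ[μ] fun a => z (a, b) := by
    filter_upwards [(memLp_curryFun hz').coeFn_toLp, ae_curryFun_eq hz'] with b h1 h2
    rwa [h1]
  refine ⟨(memLp_curryFun hz').toLp _, hv, ?_⟩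
  rw [Lp.norm_def, Lp.norm_def, eLpNorm_of_ae_eq_section hz.1 hu,
    eLpNorm_of_ae_eq_section hz'.1 hv]
  congr 1
  exact eLpNorm_comp_measurePreserving hz.1 Measure.measurePreserving_swap

/-- The Bochner integral of an `L²(μ; X)`-valued function can be computed pointwise. -/
theorem integral_ae_eq_integral_section [CompleteSpace X] {F : β → Lp X 2 μ}
    (hF : Integrable F ν) {z : α × β → X} (hz : Integrable z (μ.prod ν))
    (hFz : ∀ᵐ b ∂ν, F b =ᵐ[μ] fun a => z (a, b)) :
    (∫ b, F b ∂ν : Lp X 2 μ) =ᵐ[μ] fun a => ∫ b, z (a, b) ∂ν := by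
  -- both sides have the same integrals over measurable sets
  refine Integrable.ae_eq_of_forall_setIntegral_eq _ _
    ((Lp.memLp _).integrable one_le_two) hz.integral_prod_left fun s hs _ => ?_
  let L : Lp X 2 μ →L[ℝ] X := (ContinuousLinearMap.lsmul ℝ ℝ : ℝ →L[ℝ] X →L[ℝ] X).lpPairing μ 2 2
    (indicatorConstLp 2 hs (measure_ne_top μ s) 1)
  have hL : ∀ f : Lp X 2 μ, L f = ∫ a in s, f a ∂μ := by
    intro f
    rw [ContinuousLinearMap.lpPairing_eq_integral, ← integral_indicator hs]
    refine integral_congr_ae ?_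
    filter_upwards [indicatorConstLp_coeFn (p := 2) (hs := hs) (hμs := measure_ne_top μ s)
      (c := (1 : ℝ))] with a ha
    rw [ha]
    by_cases h : a ∈ s <;> simp [h]
  rw [← hL, ← L.integral_comp_comm hF]
  have h1 : ∫ b, L (F b) ∂ν = ∫ b, ∫ a in s, z (a, b) ∂μ ∂ν := by
    refine integral_congr_ae ?_
    filter_upwards [hFz] with b hb
    rw [hL]
    exact integral_congr_ae (ae_restrict_of_ae hb)
  rw [h1]
  have hi : Integrable (Function.uncurry fun a b => z (a, b)) ((μ.restrict s).prod ν) := by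
    have : (μ.restrict s).prod ν = (μ.prod ν).restrict (s ×ˢ univ) := by
      rw [← Measure.prod_restrict, Measure.restrict_univ]
    rw [this]
    exact hz.restrict
  exact (integral_integral_swap hi).symm

end Swap

/-! ### Random bounded operators -/

section RandomOperator

variable {α X Z : Type*} [MeasurableSpace α]
  [NormedAddCommGroup X] [NormedSpace ℝ X] [NormedAddCommGroup Z] [NormedSpace ℝ Z]
  {μ : Measure α}

/-- Operators that depend measurably on `a` in the strong operator topology preserve
measurability. -/
theorem aestronglyMeasurable_apply {T : α → X →L[ℝ] Z}
    (hT : ∀ x, AEStronglyMeasurable (fun a => T a x) μ) {u : α → X}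
    (hu : AEStronglyMeasurable u μ) : AEStronglyMeasurable (fun a => T a (u a)) μ := by
  have hs : ∀ f : SimpleFunc α X, AEStronglyMeasurable (fun a => T a (f a)) μ := by
    intro f
    induction f using SimpleFunc.induction with
    | const c hS =>
      refine ((hT c).indicator hS).congr (Eventually.of_forall fun a => ?_)
      classical
      simp only [SimpleFunc.coe_piecewise, SimpleFunc.coe_const, Set.indicator_apply,
        Set.piecewise, Function.const_apply]
      split_ifs <;> simp
    | add _ hf hg => exact (hf.add hg).congr (Eventually.of_forall fun a => by simp)
  obtain ⟨u', hu', huu'⟩ := hu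
  have h : AEStronglyMeasurable (fun a => T a (u' a)) μ :=
    aestronglyMeasurable_of_tendsto_ae atTop (fun n => hs (hu'.approx n))
      (Eventually.of_forall fun a => ((T a).continuous.tendsto _).comp (hu'.tendsto_approx a))
  refine h.congr ?_
  filter_upwards [huu'] with a ha
  rw [ha]

theorem memLp_apply {T : α → X →L[ℝ] Z} (hT : ∀ x, AEStronglyMeasurable (fun a => T a x) μ)
    {C : ℝ} (hC : ∀ᵐ a ∂μ, ‖T a‖ ≤ C) (u : Lp X 2 μ) : MemLp (fun a => T a (u a)) 2 μ := by
  refine (Lp.memLp u).of_le_mul (c := C)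
    (aestronglyMeasurable_apply hT (Lp.aestronglyMeasurable u)) ?_
  filter_upwards [hC] with a ha
  exact (T a).le_of_opNorm_le ha _

/-- A family of operators acting pointwise: `(randomOp T u)(a) = T(a) u(a)`. -/
def randomOp (T : α → X →L[ℝ] Z) (hT : ∀ x, AEStronglyMeasurable (fun a => T a x) μ) (C : ℝ)
    (hC : ∀ᵐ a ∂μ, ‖T a‖ ≤ C) : Lp X 2 μ →L[ℝ] Lp Z 2 μ :=
  have hm (u : Lp X 2 μ) : MemLp (fun a => T a (u a)) 2 μ := memLp_apply hT hC u
  LinearMap.mkContinuous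
    { toFun := fun u => (hm u).toLp _
      map_add' := fun u v => by
        ext1
        filter_upwards [(hm (u + v)).coeFn_toLp, (hm u).coeFn_toLp, (hm v).coeFn_toLp,
          Lp.coeFn_add u v, Lp.coeFn_add ((hm u).toLp _) ((hm v).toLp _)] with a h1 h2 h3 h4 h5
        rw [h1, h5, Pi.add_apply, h2, h3, h4, Pi.add_apply, map_add]
      map_smul' := fun c u => by
        ext1
        filter_upwards [(hm (c • u)).coeFn_toLp, (hm u).coeFn_toLp,
          Lp.coeFn_smul c u, Lp.coeFn_smul c ((hm u).toLp _)] with a h1 h2 h4 h5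
        rw [h1, RingHom.id_apply, h5, Pi.smul_apply, h2, h4, Pi.smul_apply, map_smul] }
    C fun u => by
      refine Lp.norm_le_mul_norm_of_ae_le_mul ?_
      filter_upwards [(hm u).coeFn_toLp, hC] with a h1 h2
      change ‖(hm u).toLp _ a‖ ≤ _
      rw [h1]
      exact (T a).le_of_opNorm_le h2 _

theorem coeFn_randomOp {T : α → X →L[ℝ] Z} {hT : ∀ x, AEStronglyMeasurable (fun a => T a x) μ}
    {C : ℝ} {hC : ∀ᵐ a ∂μ, ‖T a‖ ≤ C} (u : Lp X 2 μ) :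
    randomOp T hT C hC u =ᵐ[μ] fun a => T a (u a) :=
  (memLp_apply hT hC u).coeFn_toLp

end RandomOperator

/-! ### Primitives and weak derivatives in time -/

section Primitive

variable {X Z : Type*} [NormedAddCommGroup X] [NormedSpace ℝ X]
  [NormedAddCommGroup Z] [NormedSpace ℝ Z] {t₀ t₁ : ℝ}

theorem integrableOn_L2Time (w : L2Time X t₀ t₁) : IntegrableOn w (Ioo t₀ t₁) :=
  (Lp.memLp w).integrable one_le_two

theorem intervalIntegrable_of_integrableOn {w : ℝ → X} (hw : IntegrableOn w (Ioo t₀ t₁))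
    {s t : ℝ} (hs : s ∈ Icc t₀ t₁) (ht : t ∈ Icc t₀ t₁) : IntervalIntegrable w volume s t := by
  rw [intervalIntegrable_iff']
  have h : IntegrableOn w (Icc t₀ t₁) := by rwa [integrableOn_Icc_iff_integrableOn_Ioo]
  exact h.mono_set (uIcc_subset_Icc hs ht)

theorem continuousOn_primitive_Icc {w : ℝ → X} (h : t₀ ≤ t₁) (hw : IntegrableOn w (Ioo t₀ t₁)) :
    ContinuousOn (fun t => ∫ r in t₀..t, w r) (Icc t₀ t₁) := by
  have := intervalIntegral.continuousOn_primitive_interval' (μ := volume) (a := t₀)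
    (intervalIntegrable_of_integrableOn hw (left_mem_Icc.2 h) (right_mem_Icc.2 h))
    left_mem_uIcc
  rwa [uIcc_of_le h] at this

theorem aestronglyMeasurable_primitive {w : ℝ → X} (h : t₀ ≤ t₁)
    (hw : IntegrableOn w (Ioo t₀ t₁)) :
    AEStronglyMeasurable (fun t => ∫ r in t₀..t, w r) (volume.restrict (Ioo t₀ t₁)) :=
  ((continuousOn_primitive_Icc h hw).mono Ioo_subset_Icc_self).aestronglyMeasurable
    measurableSet_Ioo

theorem norm_primitive_le {w : ℝ → X} (hw : IntegrableOn w (Ioo t₀ t₁))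
    {t : ℝ} (ht : t ∈ Icc t₀ t₁) :
    ‖∫ r in t₀..t, w r‖ ≤ ∫ r in Ioo t₀ t₁, ‖w r‖ := by
  rw [intervalIntegral.integral_of_le ht.1, ← integral_Ioc_eq_integral_Ioo]
  refine (norm_integral_le_integral_norm _).trans ?_
  refine setIntegral_mono_set ?_ (Eventually.of_forall fun _ => norm_nonneg _)
    (Ioc_subset_Ioc_right ht.2).eventuallyLE
  have : IntegrableOn w (Ioc t₀ t₁) := by rwa [integrableOn_Ioc_iff_integrableOn_Ioo]
  exact this.norm

theorem sq_integral_norm_le (h : t₀ ≤ t₁) (w : L2Time X t₀ t₁) :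
    (∫ r in Ioo t₀ t₁, ‖w r‖) ^ 2 ≤ (t₁ - t₀) * ‖w‖ ^ 2 := by
  have h1 := eLpNorm_le_eLpNorm_mul_rpow_measure_univ (μ := volume.restrict (Ioo t₀ t₁))
    (one_le_two : (1 : ℝ≥0∞) ≤ 2) (Lp.aestronglyMeasurable w)
  have h2 : ∫ r in Ioo t₀ t₁, ‖w r‖ = (eLpNorm w 1 (volume.restrict (Ioo t₀ t₁))).toReal := by
    rw [integral_norm_eq_lintegral_enorm (Lp.aestronglyMeasurable w), eLpNorm_one_eq_lintegral_enorm]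
  have h3 : ∫ r in Ioo t₀ t₁, ‖w r‖ ≤ ‖w‖ * (t₁ - t₀) ^ (1 / 2 : ℝ) := by
    rw [h2]
    refine (ENNReal.toReal_mono ?_ h1).trans (le_of_eq ?_)
    · exact ENNReal.mul_ne_top (Lp.eLpNorm_ne_top w)
        (ENNReal.rpow_ne_top_of_nonneg (by norm_num) (by simp))
    · rw [ENNReal.toReal_mul, Lp.norm_def, ← ENNReal.toReal_rpow, Measure.restrict_apply_univ,
        Real.volume_Ioo, ENNReal.toReal_ofReal (sub_nonneg.2 h)]
      norm_num
  have h4 : 0 ≤ ∫ r in Ioo t₀ t₁, ‖w r‖ := integral_nonneg fun _ => norm_nonneg _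
  calc (∫ r in Ioo t₀ t₁, ‖w r‖) ^ 2 ≤ (‖w‖ * (t₁ - t₀) ^ (1 / 2 : ℝ)) ^ 2 := by gcongr
    _ = (t₁ - t₀) * ‖w‖ ^ 2 := by
      rw [mul_pow, ← Real.sqrt_eq_rpow, Real.sq_sqrt (sub_nonneg.2 h), mul_comm]

theorem integrableOn_continuous_smul {θ : ℝ → ℝ} (hθ : Continuous θ) {w : ℝ → X}
    (hw : IntegrableOn w (Ioo t₀ t₁)) : IntegrableOn (fun t => θ t • w t) (Ioo t₀ t₁) := by
  obtain ⟨C, hC⟩ := isCompact_Icc.exists_bound_of_continuousOn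
    (s := Icc t₀ t₁) hθ.continuousOn
  refine Integrable.bdd_smul hw C hθ.aestronglyMeasurable ?_
  filter_upwards [ae_restrict_mem measurableSet_Ioo] with t ht
  exact hC t (Ioo_subset_Icc_self ht)

/-- Integration by parts of a primitive against a continuously differentiable function. -/
theorem integral_deriv_smul_primitive [CompleteSpace X] {w : ℝ → X}
    (hw : IntegrableOn w (Ioo t₀ t₁)) {θ : ℝ → ℝ} (hθ : ContDiff ℝ 1 θ) :
    ∫ t in Ioo t₀ t₁, deriv θ t • ∫ r in t₀..t, w r =
      θ t₁ • (∫ t in Ioo t₀ t₁, w t) - ∫ t in Ioo t₀ t₁, θ t • w t := by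
  have hd : Continuous (deriv θ) := hθ.continuous_deriv le_rfl
  have hθi : ∀ a b : ℝ, ∫ t in a..b, deriv θ t = θ b - θ a := fun a b =>
    intervalIntegral.integral_deriv_eq_sub (fun x _ => (hθ.differentiable one_ne_zero) x)
      (hd.intervalIntegrable a b)
  have hdi : IntegrableOn (deriv θ) (Ioo t₀ t₁) :=
    (hd.integrableOn_Icc).mono_set Ioo_subset_Icc_self
  let μ : Measure ℝ := volume.restrict (Ioo t₀ t₁)
  -- Fubini's theorem on the triangle `r < t`
  let F : ℝ → ℝ → X := fun t r => (Iio t).indicator (fun r => deriv θ t • w r) r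
  have hF : Integrable (Function.uncurry F) (μ.prod μ) := by
    have h1 : Integrable (fun p : ℝ × ℝ => deriv θ p.1 • w p.2) (μ.prod μ) := hdi.smul_prod hw
    have h2 : MeasurableSet {p : ℝ × ℝ | p.2 < p.1} :=
      measurableSet_lt measurable_snd measurable_fst
    refine (h1.indicator h2).congr (Eventually.of_forall fun p => ?_)
    simp only [Function.uncurry, F, Set.indicator_apply, mem_ofPred_eq, mem_Iio]
  have e1 : ∫ t in Ioo t₀ t₁, deriv θ t • ∫ r in t₀..t, w r = ∫ t, ∫ r, F t r ∂μ ∂μ := by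
    refine setIntegral_congr_fun measurableSet_Ioo fun t ht => ?_
    simp only [F, μ]
    rw [integral_indicator measurableSet_Iio, Measure.restrict_restrict measurableSet_Iio,
      integral_smul, intervalIntegral.integral_of_le ht.1.le, integral_Ioc_eq_integral_Ioo]
    congr 3
    ext r
    simp only [mem_inter_iff, mem_Iio, mem_Ioo]
    exact ⟨fun hr => ⟨hr.2, hr.1, hr.2.trans ht.2⟩, fun hr => ⟨hr.2.1, hr.1⟩⟩
  have e2 : ∀ r ∈ Ioo t₀ t₁, ∫ t, F t r ∂μ = (θ t₁ - θ r) • w r := by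
    intro r hr
    have : (fun t => F t r) = (Ioi r).indicator fun t => deriv θ t • w r := by
      ext t
      simp only [F, Set.indicator_apply, mem_Iio, mem_Ioi]
    rw [this]
    simp only [μ]
    rw [integral_indicator measurableSet_Ioi, Measure.restrict_restrict measurableSet_Ioi,
      integral_smul_const, ← hθi r t₁, intervalIntegral.integral_of_le hr.2.le,
      integral_Ioc_eq_integral_Ioo]
    congr 3
    ext t
    simp only [mem_inter_iff, mem_Ioi, mem_Ioo]
    exact ⟨fun ht => ⟨ht.1, ht.2.2⟩, fun ht => ⟨ht.1, hr.1.trans ht.1, ht.2⟩⟩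
  have hθw := integrableOn_continuous_smul hθ.continuous hw
  have hw' : IntegrableOn (fun t => θ t₁ • w t) (Ioo t₀ t₁) := hw.smul _
  rw [e1, integral_integral_swap hF, setIntegral_congr_fun measurableSet_Ioo e2]
  simp only [sub_smul]
  rw [integral_sub hw' hθw, integral_smul]

theorem exists_isTestFunction_integral_eq_one (h : t₀ < t₁) :
    ∃ θ : ℝ → ℝ, IsTestFunction (Ioo t₀ t₁) θ ∧ ∫ t, θ t = 1 := by
  let c := (t₀ + t₁) / 2
  let f : ContDiffBump c := ⟨(t₁ - t₀) / 8, (t₁ - t₀) / 4, by linarith, by linarith⟩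
  refine ⟨f.normed volume, ⟨f.contDiff_normed, f.hasCompactSupport_normed, ?_⟩,
    f.integral_normed⟩
  rw [f.tsupport_normed_eq]
  intro t ht
  rw [Metric.mem_closedBall, Real.dist_eq, abs_le] at ht
  simp only [f, c] at ht
  exact ⟨by linarith [ht.1], by linarith [ht.2]⟩

/-- A test function with vanishing integral is the derivative of a test function. -/
theorem IsTestFunction.exists_deriv_eq {η : ℝ → ℝ} (hη : IsTestFunction (Ioo t₀ t₁) η)
    (h0 : ∫ t, η t = 0) : ∃ θ : ℝ → ℝ, IsTestFunction (Ioo t₀ t₁) θ ∧ deriv θ = η := by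
  have hc : Continuous η := hη.1.continuous
  have hder : ∀ t, HasDerivAt (fun t => ∫ r in t₀..t, η r) (η t) t := fun t =>
    intervalIntegral.integral_hasDerivAt_right (hc.intervalIntegrable _ _)
      hc.stronglyMeasurable.stronglyMeasurableAtFilter hc.continuousAt
  have hd : deriv (fun t => ∫ r in t₀..t, η r) = η := funext fun t => (hder t).deriv
  have hcd : ContDiff ℝ ((⊤ : ℕ∞) : WithTop ℕ∞) (fun t => ∫ r in t₀..t, η r) := by
    rw [contDiff_infty_iff_deriv]
    exact ⟨fun t => (hder t).differentiableAt, by rw [hd]; exact hη.1⟩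
  -- the primitive vanishes off the convex hull of the support of `η`
  obtain ⟨a, b, hab, hsub⟩ : ∃ a b : ℝ, tsupport η ⊆ Icc a b ∧ Icc a b ⊆ Ioo t₀ t₁ := by
    rcases (tsupport η).eq_empty_or_nonempty with he | hne
    · exact ⟨1, 0, by simp [he], by simp⟩
    · have hK : IsCompact (tsupport η) := hη.2.1
      exact ⟨sInf (tsupport η), sSup (tsupport η),
        fun t ht => ⟨csInf_le hK.bddBelow ht, le_csSup hK.bddAbove ht⟩,
        (Icc_subset_Icc le_rfl le_rfl).trans fun t ht =>
          ⟨(hη.2.2 (hK.sInf_mem hne)).1.trans_le ht.1, ht.2.trans_lt (hη.2.2 (hK.sSup_mem hne)).2⟩⟩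
  have hz : ∀ t, t ∉ Icc a b → η t = 0 := fun t ht =>
    image_eq_zero_of_notMem_tsupport fun h => ht (hab h)
  have hsupp : Function.support (fun t => ∫ r in t₀..t, η r) ⊆ Icc a b := by
    intro t ht
    by_contra hn
    apply ht
    by_cases hta : t < a
    · refine intervalIntegral.integral_zero_ae (Eventually.of_forall fun r hr => hz r ?_)
      intro hrI
      rcases le_total t₀ t with hl | hl
      · rw [uIoc_of_le hl] at hr
        exact absurd (hrI.1.trans hr.2) (not_le.2 hta)
      · rw [uIoc_of_ge hl] at hr
        exact absurd hr.2 (not_le.2 (hsub hrI).1)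
    · have htb : b < t ∨ b < a := by
        by_contra hcon
        push Not at hcon
        exact hn ⟨not_lt.1 hta, hcon.1⟩
      rcases htb with htb | hba
      · have hsplit : ∫ r, η r = ∫ r in t₀..t, η r := by
          rw [intervalIntegral.integral_eq_integral_of_support_subset]
          intro r hr
          have hr' := hab (subset_tsupport _ hr)
          exact ⟨(hsub hr').1, hr'.2.trans htb.le⟩
        exact hsplit.symm.trans h0
      · refine intervalIntegral.integral_zero_ae (Eventually.of_forall fun r _ => hz r ?_)
        simp [Icc_eq_empty (not_le.2 hba)]
  refine ⟨_, ⟨hcd, ?_, ?_⟩, hd⟩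
  · exact HasCompactSupport.of_support_subset_isCompact isCompact_Icc hsupp
  · exact (closure_minimal hsupp isClosed_Icc).trans hsub

theorem IsTestFunction.setIntegral_eq {η : ℝ → ℝ} (hη : IsTestFunction (Ioo t₀ t₁) η) :
    ∫ t in Ioo t₀ t₁, η t = ∫ t, η t :=
  setIntegral_eq_integral_of_forall_compl_eq_zero fun _ ht =>
    image_eq_zero_of_notMem_tsupport fun h => ht (hη.2.2 h)

/-- The lemma of du Bois-Reymond: a function with vanishing weak derivative is constant. -/
theorem ae_eq_const_of_integral_deriv_smul_eq_zero [CompleteSpace X] (h : t₀ < t₁) {g : ℝ → X}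
    (hg : IntegrableOn g (Ioo t₀ t₁))
    (hθ : ∀ θ : ℝ → ℝ, IsTestFunction (Ioo t₀ t₁) θ → ∫ t in Ioo t₀ t₁, deriv θ t • g t = 0) :
    ∃ c : X, ∀ᵐ t ∂(volume.restrict (Ioo t₀ t₁)), g t = c := by
  obtain ⟨θ₀, hθ₀, hθ₀1⟩ := exists_isTestFunction_integral_eq_one h
  let c : X := ∫ t in Ioo t₀ t₁, θ₀ t • g t
  refine ⟨c, ?_⟩
  have hgc : IntegrableOn (fun t => g t - c) (Ioo t₀ t₁) :=
    hg.sub (integrable_const (μ := volume.restrict (Ioo t₀ t₁)) c)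
  have key := isOpen_Ioo.ae_eq_zero_of_integral_contDiff_smul_eq_zero
    (f := fun t => g t - c) (μ := volume) hgc.locallyIntegrableOn ?_
  · rw [ae_restrict_iff' measurableSet_Ioo]
    filter_upwards [key] with t ht hti
    exact sub_eq_zero.1 (ht hti)
  · intro η h1 h2 h3
    have hη : IsTestFunction (Ioo t₀ t₁) η := ⟨h1, h2, h3⟩
    let m := ∫ t, η t
    -- subtracting `m θ₀` makes the integral of `η` vanish
    have hηm : IsTestFunction (Ioo t₀ t₁) (η + (-m) • θ₀) := hη.add (hθ₀.const_smul _)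
    obtain ⟨θ, hθt, hθd⟩ := hηm.exists_deriv_eq (by
      have i1 : Integrable η := h1.continuous.integrable_of_hasCompactSupport h2
      have i2 : Integrable θ₀ := hθ₀.1.continuous.integrable_of_hasCompactSupport hθ₀.2.1
      have i3 : Integrable (fun t => -m • θ₀ t) := i2.smul (-m)
      have : ∫ t, (η t + -m • θ₀ t) = 0 := by
        rw [integral_add i1 i3, integral_smul, hθ₀1]
        simp [m]
      exact this)
    have hz := hθ θ hθt
    rw [hθd] at hz
    have i1 := integrableOn_continuous_smul h1.continuous hg
    have i2 := integrableOn_continuous_smul hθ₀.1.continuous hg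
    have hz' : ∫ t in Ioo t₀ t₁, η t • g t = m • c := by
      have : ∀ t, (η + (-m) • θ₀) t • g t = η t • g t - m • (θ₀ t • g t) := by
        intro t
        change (η t + -m * θ₀ t) • g t = _
        rw [add_smul, neg_mul, neg_smul, mul_smul, sub_eq_add_neg]
      simp only [this] at hz
      have i3 : IntegrableOn (fun t => m • θ₀ t • g t) (Ioo t₀ t₁) := i2.smul m
      rw [integral_sub i1 i3, integral_smul] at hz
      exact sub_eq_zero.1 hz
    have hs : ∫ t, η t • (g t - c) = ∫ t in Ioo t₀ t₁, η t • (g t - c) := by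
      refine (setIntegral_eq_integral_of_forall_compl_eq_zero fun t ht => ?_).symm
      rw [image_eq_zero_of_notMem_tsupport fun h => ht (h3 h), zero_smul]
    rw [hs]
    simp only [smul_sub]
    rw [integral_sub i1 (integrableOn_continuous_smul h1.continuous
      (integrable_const (μ := volume.restrict (Ioo t₀ t₁)) c)), hz', integral_smul_const,
      hη.setIntegral_eq, sub_self]

/-- A function with weak derivative `w` is, up to a constant, the primitive of `w`. -/
theorem ae_eq_add_primitive [CompleteSpace X] (h : t₀ < t₁) {g w : ℝ → X}
    (hg : IntegrableOn g (Ioo t₀ t₁)) (hw : IntegrableOn w (Ioo t₀ t₁))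
    (hθ : ∀ θ : ℝ → ℝ, IsTestFunction (Ioo t₀ t₁) θ →
      ∫ t in Ioo t₀ t₁, deriv θ t • g t = -∫ t in Ioo t₀ t₁, θ t • w t) :
    ∃ c : X, ∀ᵐ t ∂(volume.restrict (Ioo t₀ t₁)), g t = c + ∫ r in t₀..t, w r := by
  have hp : IntegrableOn (fun t => ∫ r in t₀..t, w r) (Ioo t₀ t₁) :=
    (continuousOn_primitive_Icc h.le hw).integrableOn_Icc.mono_set Ioo_subset_Icc_self
  obtain ⟨c, hc⟩ := ae_eq_const_of_integral_deriv_smul_eq_zero h (hg.sub hp) fun θ hθt => by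
    have hd : Continuous (deriv θ) := hθt.1.continuous_deriv (by simp)
    simp only [Pi.sub_apply, smul_sub]
    rw [integral_sub (integrableOn_continuous_smul hd hg) (integrableOn_continuous_smul hd hp),
      hθ θ hθt, integral_deriv_smul_primitive hw (hθt.1.of_le (by simp))]
    have : θ t₁ = 0 := image_eq_zero_of_notMem_tsupport fun hh => lt_irrefl _ (hθt.2.2 hh).2
    rw [this, zero_smul, zero_sub, sub_self]
  refine ⟨c, ?_⟩
  filter_upwards [hc] with t ht
  rw [← ht, Pi.sub_apply, sub_add_cancel]

/-- Integration by parts with a factor `θ` that vanishes at the right end point only, so that the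
initial value `c` appears. -/
theorem integral_deriv_smul_of_eq_primitive [CompleteSpace X] (h : t₀ ≤ t₁) {g w : ℝ → X} {c : X}
    (hw : IntegrableOn w (Ioo t₀ t₁))
    (hg : ∀ᵐ t ∂(volume.restrict (Ioo t₀ t₁)), g t = c + ∫ r in t₀..t, w r)
    {θ : ℝ → ℝ} (hθ : ContDiff ℝ 1 θ) (h1 : θ t₁ = 0) :
    ∫ t in Ioo t₀ t₁, deriv θ t • g t = -(θ t₀ • c) - ∫ t in Ioo t₀ t₁, θ t • w t := by
  have hd : Continuous (deriv θ) := hθ.continuous_deriv le_rfl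
  have hp : IntegrableOn (fun t => ∫ r in t₀..t, w r) (Ioo t₀ t₁) :=
    (continuousOn_primitive_Icc h hw).integrableOn_Icc.mono_set Ioo_subset_Icc_self
  have e : ∫ t in Ioo t₀ t₁, deriv θ t • g t =
      ∫ t in Ioo t₀ t₁, (deriv θ t • c + deriv θ t • ∫ r in t₀..t, w r) := by
    refine integral_congr_ae ?_
    filter_upwards [hg] with t ht
    rw [ht, smul_add]
  have hθi : ∫ t in Ioo t₀ t₁, deriv θ t = -θ t₀ := by
    rw [← integral_Ioc_eq_integral_Ioo, ← intervalIntegral.integral_of_le h,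
      intervalIntegral.integral_deriv_eq_sub (fun x _ => (hθ.differentiable one_ne_zero) x)
      (hd.intervalIntegrable _ _), h1, zero_sub]
  rw [e, integral_add (integrableOn_continuous_smul hd
      (integrable_const (μ := volume.restrict (Ioo t₀ t₁)) c))
    (integrableOn_continuous_smul hd hp), integral_deriv_smul_primitive hw hθ, h1,
    integral_smul_const, hθi, zero_smul, neg_smul, zero_sub, sub_eq_add_neg]

end Primitive

/-! ### The energy identity in a Gelfand triple -/

section Translation

variable {V : Type*} [NormedAddCommGroup V]

/-- The translate `r ↦ f(r + h)` of `f ∈ L²(ℝ; V)`. -/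
def translate (h : ℝ) (f : Lp V 2 (volume : Measure ℝ)) : Lp V 2 (volume : Measure ℝ) :=
  Lp.compMeasurePreserving (fun r => r + h) (measurePreserving_add_right volume h) f

theorem coeFn_translate (h : ℝ) (f : Lp V 2 (volume : Measure ℝ)) :
    translate h f =ᵐ[volume] fun r => f (r + h) :=
  Lp.coeFn_compMeasurePreserving f (measurePreserving_add_right volume h)

theorem translate_zero (f : Lp V 2 (volume : Measure ℝ)) : translate 0 f = f := by
  ext1
  filter_upwards [coeFn_translate 0 f] with r hr
  rw [hr, add_zero]

theorem tendsto_translate (f : Lp V 2 (volume : Measure ℝ)) :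
    Tendsto (fun h => translate h f) (𝓝 0) (𝓝 f) := by
  let g : C(ℝ, C(ℝ, ℝ)) :=
    (ContinuousMap.mk (fun p : ℝ × ℝ => p.2 + p.1) (continuous_snd.add continuous_fst)).curry
  have := Filter.Tendsto.compMeasurePreservingLp (p := 2) (μ := (volume : Measure ℝ))
    (ν := (volume : Measure ℝ)) (tendsto_const_nhds (x := f) (f := 𝓝 (0 : ℝ)))
    (g.continuous.tendsto 0) (fun h => measurePreserving_add_right volume h)
    (measurePreserving_add_right volume 0) (by simp)
  rwa [show Lp.compMeasurePreserving (g 0) (measurePreserving_add_right volume 0) f = f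
    from translate_zero f]
    at this

end Translation

section Energy

variable {V H : Type*} [NormedAddCommGroup V] [InnerProductSpace ℝ V] [CompleteSpace V]
  [NormedAddCommGroup H] [InnerProductSpace ℝ H] [CompleteSpace H]

/-- The identity behind the difference quotients in `integral_deriv_mul_norm_sq`: a difference of
squares in `H` is a pairing of a difference in `V'` with a sum in `V`. -/
theorem inner_adjoint_comp_sub (j : V →L[ℝ] H) (x y : V) :
    ⟪j.adjoint (j x) - j.adjoint (j y), x + y⟫_ℝ = ‖j x‖ ^ 2 - ‖j y‖ ^ 2 := by
  rw [← map_sub, ContinuousLinearMap.adjoint_inner_left, map_add, inner_sub_left, inner_add_right,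
    inner_add_right, real_inner_self_eq_norm_sq, real_inner_self_eq_norm_sq,
    real_inner_comm (j x) (j y)]
  ring

theorem integrable_shear {h : ℝ} {w : ℝ → V} (hw : MemLp w 2) :
    Integrable (fun p : ℝ × ℝ => ‖w (p.2 + p.1)‖ ^ 2)
      ((volume.restrict (Ioc 0 h)).prod (volume : Measure ℝ)) := by
  have h1 : Integrable (fun p : ℝ × ℝ => (1 : ℝ) * ‖w p.2‖ ^ 2)
      ((volume.restrict (Ioc 0 h)).prod (volume : Measure ℝ)) :=
    (integrable_const (μ := volume.restrict (Ioc 0 h)) (1 : ℝ)).mul_prod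
      ((memLp_two_iff_integrable_sq_norm hw.1).1 hw)
  have h2 := (measurePreserving_prod_add (volume.restrict (Ioc 0 h))
    (volume : Measure ℝ)).integrable_comp_of_integrable h1
  refine h2.congr (Eventually.of_forall fun p => ?_)
  simp [add_comm]

/-- The energy identity `(‖j u‖²)' = 2 ⟨w, u⟩` in weak form, for `(j†j u)' = w`. The function
`F(h) = ∫ θ(r - h) ‖j u(r)‖² dr` is differentiated at `h = 0` in two ways: under the integral, and
after the shift of `r` by `h`, where `‖j u(r + h)‖² - ‖j u(r)‖² = ∫₀^h ⟨w(r + σ), u(r + h) + u(r)⟩ dσ`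
and translations are continuous in `L²`. -/
theorem integral_deriv_mul_norm_sq {t₀ t₁ : ℝ} (j : V →L[ℝ] H) {u w : ℝ → V}
    (hum : StronglyMeasurable u) (hwm : StronglyMeasurable w)
    (hu : MemLp u 2) (hw : MemLp w 2) {c : V}
    (hS : ∀ᵐ t, t ∈ Ioo t₀ t₁ → j.adjoint (j (u t)) = c + ∫ r in t₀..t, w r)
    {θ : ℝ → ℝ} (hθ : IsTestFunction (Ioo t₀ t₁) θ) :
    ∫ t, deriv θ t * ‖j (u t)‖ ^ 2 = -∫ t, θ t * (2 * ⟪w t, u t⟫_ℝ) := by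
  have hθc : Continuous θ := hθ.1.continuous
  have hdc : Continuous (deriv θ) := hθ.1.continuous_deriv (by simp)
  obtain ⟨C, hC⟩ := hθc.bounded_above_of_compact_support hθ.2.1
  obtain ⟨C', hC'⟩ := hdc.bounded_above_of_compact_support hθ.2.1.deriv
  have hju : MemLp (fun t => j (u t)) 2 := j.comp_memLp' hu
  have hE : Integrable (fun t => ‖j (u t)‖ ^ 2) :=
    (memLp_two_iff_integrable_sq_norm hju.1).1 hju
  let F : ℝ → ℝ := fun h => ∫ r, θ (r - h) * ‖j (u r)‖ ^ 2
  have hF : HasDerivAt F (∫ r, -deriv θ (r - 0) * ‖j (u r)‖ ^ 2) 0 := by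
    refine (hasDerivAt_integral_of_dominated_loc_of_deriv_le (s := univ)
      (F := fun h r => θ (r - h) * ‖j (u r)‖ ^ 2)
      (F' := fun h r => -deriv θ (r - h) * ‖j (u r)‖ ^ 2)
      (bound := fun r => C' * ‖j (u r)‖ ^ 2) univ_mem ?_ ?_ ?_ ?_ ?_ ?_).2
    · exact Eventually.of_forall fun h =>
        (hθc.comp (continuous_id.sub continuous_const)).aestronglyMeasurable.mul
          hE.aestronglyMeasurable
    · exact hE.bdd_mul (c := C)
        (hθc.comp (continuous_id.sub continuous_const)).aestronglyMeasurable
        (Eventually.of_forall fun r => hC _)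
    · exact ((hdc.comp (continuous_id.sub continuous_const)).neg).aestronglyMeasurable.mul
        hE.aestronglyMeasurable
    · refine Eventually.of_forall fun r h _ => ?_
      rw [norm_mul, norm_neg, Real.norm_of_nonneg (sq_nonneg ‖j (u r)‖)]
      exact mul_le_mul_of_nonneg_right (hC' _) (sq_nonneg _)
    · exact hE.const_mul _
    · refine Eventually.of_forall fun r h _ => ?_
      have hd : HasDerivAt θ (deriv θ (r - h)) (r - h) :=
        (hθ.1.differentiable (by simp) _).hasDerivAt
      have := (hd.comp_const_sub r h)
      exact this.mul_const _
  -- the pairing `Ψ σ h` is an inner product of translates, hence continuous at `(0, 0)`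
  let U : Lp V 2 (volume : Measure ℝ) := hu.toLp u
  let Wt : Lp V 2 (volume : Measure ℝ) := hw.toLp w
  let m : Lp V 2 (volume : Measure ℝ) →L[ℝ] Lp V 2 (volume : Measure ℝ) :=
    randomOp (fun r => θ r • ContinuousLinearMap.id ℝ V)
      (fun x => (hθc.smul continuous_const).aestronglyMeasurable) C
      (Eventually.of_forall fun r => by
        refine ContinuousLinearMap.opNorm_le_bound _ ((norm_nonneg _).trans (hC 0)) fun x => ?_
        rw [smul_apply, norm_smul]
        exact mul_le_mul_of_nonneg_right (hC r) (norm_nonneg _))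
  have hm : ∀ f : Lp V 2 (volume : Measure ℝ), m f =ᵐ[volume] fun r => θ r • f r :=
    fun f => coeFn_randomOp f
  let Ψ : ℝ → ℝ → ℝ := fun σ h => ∫ r, θ r * ⟪w (r + σ), u (r + h) + u r⟫_ℝ
  have hΨ : ∀ σ h, Ψ σ h = ⟪translate σ Wt, m (translate h U + U)⟫_ℝ := by
    intro σ h
    rw [L2.inner_def]
    refine integral_congr_ae ?_
    filter_upwards [coeFn_translate σ Wt, coeFn_translate h U,
      Lp.coeFn_add (translate h U) U, hu.coeFn_toLp,
      (measurePreserving_add_right volume h).quasiMeasurePreserving.ae hu.coeFn_toLp,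
      (measurePreserving_add_right volume σ).quasiMeasurePreserving.ae hw.coeFn_toLp,
      hm (translate h U + U)] with r h1 h2 h3 h4 h5 h6 h7
    rw [h7, h3, Pi.add_apply, h1, h2, h5, h6, h4]
    exact (real_inner_smul_right (w (r + σ)) (u (r + h) + u r) (θ r)).symm
  have hlim : Tendsto (fun p : ℝ × ℝ => Ψ p.1 p.2) (𝓝 (0, 0)) (𝓝 ⟪Wt, m (U + U)⟫_ℝ) := by
    simp only [hΨ]
    rw [nhds_prod_eq]
    exact ((tendsto_translate Wt).comp tendsto_fst).inner
      ((m.continuous.tendsto _).comp (((tendsto_translate U).comp tendsto_snd).add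
        tendsto_const_nhds))
  have hΨ0 : ⟪Wt, m (U + U)⟫_ℝ = ∫ t, θ t * (2 * ⟪w t, u t⟫_ℝ) := by
    have h0 := hΨ 0 0
    rw [translate_zero, translate_zero] at h0
    rw [← h0]
    refine integral_congr_ae (Eventually.of_forall fun r => ?_)
    simp only [add_zero, inner_add_right]
    ring
  -- for small `h` the shift by `h` maps the support of `θ` into `(t₀, t₁)`
  obtain ⟨δ, hδ, hδsub⟩ := hθ.2.1.isCompact.exists_thickening_subset_open isOpen_Ioo hθ.2.2
  have hsupp : ∀ h, 0 < h → h < δ → ∀ r, θ r ≠ 0 → r ∈ Ioo t₀ t₁ ∧ r + h ∈ Ioo t₀ t₁ := by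
    intro h h0 h1 r hr
    have hrt : r ∈ tsupport θ := subset_tsupport _ hr
    refine ⟨hθ.2.2 hrt, hδsub (Metric.mem_thickening_iff.2 ⟨r, hrt, ?_⟩)⟩
    simpa [Real.dist_eq, abs_of_pos h0] using h1
  have hint : ∀ h, Integrable (fun p : ℝ × ℝ => θ p.2 * ⟪w (p.2 + p.1), u (p.2 + h) + u p.2⟫_ℝ)
      ((volume.restrict (Ioc 0 h)).prod (volume : Measure ℝ)) := by
    intro h
    have huh : MemLp (fun r => u (r + h) + u r) 2 :=
      (hu.comp_measurePreserving (measurePreserving_add_right volume h)).add hu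
    have i1 := (integrable_const (μ := volume.restrict (Ioc 0 h)) (1 : ℝ)).mul_prod
      ((memLp_two_iff_integrable_sq_norm huh.1).1 huh)
    have i2 := ((integrable_shear (h := h) hw).add i1).const_mul C
    refine i2.mono' ?_ (Eventually.of_forall fun p => ?_)
    · refine ((hθc.measurable.comp measurable_snd).stronglyMeasurable.mul ?_).aestronglyMeasurable
      exact (hwm.comp_measurable (measurable_snd.add measurable_fst)).inner
        ((hum.comp_measurable (measurable_snd.add_const h)).add
          (hum.comp_measurable measurable_snd))
    · rw [norm_mul]
      refine mul_le_mul (hC _) ?_ (norm_nonneg _) ((norm_nonneg _).trans (hC 0))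
      refine (norm_inner_le_norm _ _).trans ?_
      simp only [Pi.add_apply, one_mul]
      nlinarith [sq_nonneg (‖w (p.2 + p.1)‖ - ‖u (p.2 + h) + u p.2‖),
        sq_nonneg (‖w (p.2 + p.1)‖), sq_nonneg ‖u (p.2 + h) + u p.2‖]
  have hEh : ∀ h, Integrable (fun r => θ r * ‖j (u (r + h))‖ ^ 2) := fun h =>
    (hE.comp_add_right h).bdd_mul hθc.aestronglyMeasurable (Eventually.of_forall hC)
  have hdiff : ∀ h, 0 < h → h < δ → F h - F 0 = ∫ σ in (0 : ℝ)..h, Ψ σ h := by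
    intro h h0 h1
    have e1 : F h = ∫ r, θ r * ‖j (u (r + h))‖ ^ 2 := by
      refine (integral_add_right_eq_self (fun r => θ (r - h) * ‖j (u r)‖ ^ 2) h).symm.trans ?_
      simp only [add_sub_cancel_right]
    have e2 : F 0 = ∫ r, θ r * ‖j (u r)‖ ^ 2 := by simp [F]
    have i0 : Integrable (fun r => θ r * ‖j (u r)‖ ^ 2) := by simpa using hEh 0
    rw [e1, e2, ← integral_sub (hEh h) i0, intervalIntegral.integral_of_le h0.le]
    simp only [Ψ]
    rw [integral_integral_swap (hint h)]
    refine integral_congr_ae ?_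
    filter_upwards [hS, (measurePreserving_add_right volume h).quasiMeasurePreserving.ae hS]
      with r hr hrh
    by_cases hr0 : θ r = 0
    · simp [hr0]
    obtain ⟨hr1, hr2⟩ := hsupp h h0 h1 r hr0
    have hwi : IntegrableOn w (Ioo t₀ t₁) := (hw.restrict _).integrable one_le_two
    have hIcc : t₀ ∈ Icc t₀ t₁ := left_mem_Icc.2 (hr1.1.trans hr1.2).le
    have ii := fun t (ht : t ∈ Icc t₀ t₁) => intervalIntegrable_of_integrableOn hwi hIcc ht
    have hsub : ∫ q in r..(r + h), w q = j.adjoint (j (u (r + h))) - j.adjoint (j (u r)) := by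
      rw [hrh hr2, hr hr1, add_sub_add_left_eq_sub,
        intervalIntegral.integral_interval_sub_left (ii _ (Ioo_subset_Icc_self hr2))
          (ii _ (Ioo_subset_Icc_self hr1))]
    rw [← mul_sub, ← inner_adjoint_comp_sub, ← hsub, integral_const_mul]
    congr 1
    have hsh : ∫ q in r..(r + h), w q = ∫ σ in (0 : ℝ)..h, w (r + σ) := by
      rw [intervalIntegral.integral_comp_add_left, add_zero]
    rw [hsh, intervalIntegral.integral_of_le h0.le, real_inner_comm]
    rw [← integral_inner]
    · simp only [real_inner_comm]
    · have := intervalIntegrable_of_integrableOn hwi (Ioo_subset_Icc_self hr1)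
        (Ioo_subset_Icc_self hr2)
      have h3 := this.comp_add_left r
      simp only [sub_self, add_sub_cancel_left] at h3
      exact (intervalIntegrable_iff_integrableOn_Ioc_of_le h0.le).1 h3
  -- the difference quotient is the mean of `Ψ σ h` over `σ ∈ (0, h)`
  have hlim2 : Tendsto (fun h => h⁻¹ • (F (0 + h) - F 0)) (𝓝[>] 0) (𝓝 ⟪Wt, m (U + U)⟫_ℝ) := by
    rw [Metric.tendsto_nhds]
    intro ε hε
    obtain ⟨η, hη, hηε⟩ := Metric.tendsto_nhds_nhds.1 hlim (ε / 2) (half_pos hε)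
    have : ∀ᶠ h in 𝓝[>] (0 : ℝ), h ∈ Ioo 0 (min δ η) :=
      Ioo_mem_nhdsGT (lt_min hδ hη)
    filter_upwards [this] with h hh
    have h1 := hh.2.trans_le (min_le_left _ _)
    have h2 := hh.2.trans_le (min_le_right _ _)
    have hi : IntervalIntegrable (fun σ => Ψ σ h) volume 0 h := by
      rw [intervalIntegrable_iff_integrableOn_Ioc_of_le hh.1.le]
      exact (hint h).integral_prod_left
    have hb : ‖∫ σ in (0 : ℝ)..h, (Ψ σ h - ⟪Wt, m (U + U)⟫_ℝ)‖ ≤ ε / 2 * |h - 0| := by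
      refine intervalIntegral.norm_integral_le_of_norm_le_const fun σ hσ => ?_
      rw [uIoc_of_le hh.1.le] at hσ
      refine (hηε (x := (σ, h)) ?_).le
      rw [Prod.dist_eq]
      simp only [Real.dist_eq, sub_zero]
      rw [abs_of_pos hσ.1, abs_of_pos hh.1]
      exact max_lt (hσ.2.trans_lt h2) h2
    rw [intervalIntegral.integral_sub hi intervalIntegrable_const,
      intervalIntegral.integral_const, ← hdiff h hh.1 h1, sub_zero, abs_of_pos hh.1] at hb
    have hne := hh.1.ne'
    rw [zero_add, dist_eq_norm]
    have e : h⁻¹ • (F h - F 0) - ⟪Wt, m (U + U)⟫_ℝ =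
        h⁻¹ • (F h - F 0 - h • ⟪Wt, m (U + U)⟫_ℝ) := by
      simp only [smul_eq_mul]
      field_simp
    rw [e, norm_smul, norm_inv, Real.norm_of_nonneg hh.1.le]
    calc h⁻¹ * ‖F h - F 0 - h • ⟪Wt, m (U + U)⟫_ℝ‖ ≤ h⁻¹ * (ε / 2 * h) := by
          gcongr
          exact inv_nonneg.2 hh.1.le
      _ = ε / 2 := by field_simp
      _ < ε := half_lt_self hε
  have huniq := tendsto_nhds_unique hF.tendsto_slope_zero_right hlim2
  rw [← hΨ0, ← huniq, ← integral_neg]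
  simp

end Energy

section ContRep

theorem integrable_norm_sq {α X : Type*} [MeasurableSpace α] {μ : Measure α}
    [NormedAddCommGroup X] (u : Lp X 2 μ) :
    Integrable (fun t => ‖u t‖ ^ 2) μ :=
  (memLp_two_iff_integrable_sq_norm (Lp.aestronglyMeasurable u)).1 (Lp.memLp u)

variable {V H : Type*} [NormedAddCommGroup V] [InnerProductSpace ℝ V] [CompleteSpace V]
  [NormedAddCommGroup H] [InnerProductSpace ℝ H] [CompleteSpace H] {t₀ t₁ : ℝ}

/-- The integrated energy identity `‖j u(t)‖² = e + 2 ∫ ⟨w, u⟩` for `(j†j u)' = w`. -/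
theorem exists_norm_sq_eq (h : t₀ < t₁) (j : V →L[ℝ] H) (u w : L2Time V t₀ t₁) {c : V}
    (hS : ∀ᵐ t ∂(volume.restrict (Ioo t₀ t₁)),
      j.adjoint (j (u t)) = c + ∫ r in t₀..t, w r) :
    ∃ e : ℝ, ∀ᵐ t ∂(volume.restrict (Ioo t₀ t₁)),
      ‖j (u t)‖ ^ 2 = e + ∫ r in t₀..t, 2 * ⟪w r, u r⟫_ℝ := by
  -- square-integrable representatives on the whole line, extended by zero
  have hmk : ∀ v : L2Time V t₀ t₁, ∃ v' : ℝ → V, StronglyMeasurable v' ∧ MemLp v' 2 ∧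
      v =ᵐ[volume.restrict (Ioo t₀ t₁)] v' := by
    intro v
    obtain ⟨v₁, hv₁, hvv⟩ := Lp.aestronglyMeasurable v
    refine ⟨(Ioo t₀ t₁).indicator v₁, hv₁.indicator measurableSet_Ioo, ?_, ?_⟩
    · rw [memLp_indicator_iff_restrict measurableSet_Ioo]
      exact (memLp_congr_ae hvv).1 (Lp.memLp v)
    · exact hvv.trans (indicator_ae_eq_restrict measurableSet_Ioo).symm
  obtain ⟨u', hum, hu2, huu⟩ := hmk u
  obtain ⟨w', hwm, hw2, hww⟩ := hmk w
  have hprim : ∀ t ∈ Ioo t₀ t₁, ∫ r in t₀..t, w r = ∫ r in t₀..t, w' r := by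
    intro t ht
    rw [intervalIntegral.integral_of_le ht.1.le, intervalIntegral.integral_of_le ht.1.le]
    refine integral_congr_ae (ae_restrict_of_ae_restrict_of_subset ?_ hww)
    exact fun r hr => ⟨hr.1, hr.2.trans_lt ht.2⟩
  have hS' : ∀ᵐ t, t ∈ Ioo t₀ t₁ → j.adjoint (j (u' t)) = c + ∫ r in t₀..t, w' r := by
    rw [← ae_restrict_iff' measurableSet_Ioo]
    filter_upwards [hS, huu, ae_restrict_mem measurableSet_Ioo] with t h1 h2 h3
    rw [← h2, h1, hprim t h3]
  have hju : Integrable (fun t => ‖j (u t)‖ ^ 2) (volume.restrict (Ioo t₀ t₁)) :=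
    (memLp_two_iff_integrable_sq_norm (j.comp_memLp' (Lp.memLp u)).1).1 (j.comp_memLp' (Lp.memLp u))
  refine ae_eq_add_primitive h hju ((L2.integrable_inner (𝕜 := ℝ) w u).const_mul 2)
    fun θ hθ => ?_
  have h1 := integral_deriv_mul_norm_sq j hum hwm hu2 hw2 hS' hθ
  have hz : ∀ t, t ∉ Ioo t₀ t₁ → θ t = 0 := fun t ht =>
    image_eq_zero_of_notMem_tsupport fun hh => ht (hθ.2.2 hh)
  have hdz : ∀ t, t ∉ Ioo t₀ t₁ → deriv θ t = 0 := fun t ht =>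
    image_eq_zero_of_notMem_tsupport fun hh => ht (hθ.2.2 (tsupport_deriv_subset (𝕜 := ℝ) hh))
  have e1 : ∫ t in Ioo t₀ t₁, deriv θ t * ‖j (u' t)‖ ^ 2 = ∫ t, deriv θ t * ‖j (u' t)‖ ^ 2 :=
    setIntegral_eq_integral_of_forall_compl_eq_zero fun t ht => by rw [hdz t ht, zero_mul]
  have e2 : ∫ t in Ioo t₀ t₁, θ t * (2 * ⟪w' t, u' t⟫_ℝ) = ∫ t, θ t * (2 * ⟪w' t, u' t⟫_ℝ) :=
    setIntegral_eq_integral_of_forall_compl_eq_zero fun t ht => by rw [hz t ht, zero_mul]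
  rw [← e1, ← e2] at h1
  refine (integral_congr_ae ?_).trans (h1.trans (congrArg _ (integral_congr_ae ?_)))
  · filter_upwards [huu] with t ht
    simp only [ht, smul_eq_mul]
  · filter_upwards [huu, hww] with t h1 h2
    simp only [h1, h2, smul_eq_mul]

/-- A property that holds almost everywhere on `(t₀, t₁)` holds on a dense subset of `[t₀, t₁]`. -/
theorem dense_Icc_of_ae (h : t₀ < t₁) {p : ℝ → Prop}
    (hp : ∀ᵐ t ∂(volume.restrict (Ioo t₀ t₁)), p t) :
    Dense {t : Icc t₀ t₁ | (t : ℝ) ∈ Ioo t₀ t₁ ∧ p t} := by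
  have hp' : ∀ᵐ t, t ∈ Ioo t₀ t₁ → p t := (ae_restrict_iff' measurableSet_Ioo).1 hp
  have hd : Dense {t : ℝ | t ∈ Ioo t₀ t₁ → p t} := Measure.dense_of_ae hp'
  rw [dense_iff_closure_eq, eq_univ_iff_forall]
  intro t
  rw [closure_subtype, Metric.mem_closure_iff]
  intro ε hε
  have ht : (t : ℝ) ∈ closure (Ioo t₀ t₁) := by rw [closure_Ioo h.ne]; exact t.2
  obtain ⟨s, hs, hts⟩ := Metric.mem_closure_iff.1 ht (ε / 2) (half_pos hε)
  obtain ⟨r, hr, hrs⟩ := hd.exists_mem_open (isOpen_Ioo.inter Metric.isOpen_ball)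
    ⟨s, hs, Metric.mem_ball_self (half_pos hε)⟩
  refine ⟨r, ⟨⟨r, Ioo_subset_Icc_self hrs.1⟩, ⟨hrs.1, hr hrs.1⟩, rfl⟩, ?_⟩
  calc dist (t : ℝ) r ≤ dist (t : ℝ) s + dist s r := dist_triangle _ _ _
    _ < ε / 2 + ε / 2 := add_lt_add hts (by rw [dist_comm]; exact hrs.2)
    _ = ε := add_halves ε

/-- If `(j†j u)' = w`, then `j u` has a continuous representative. For times `s', t'` in a set of
full measure one compares `j u(s')` and `j u(t')` with `j u(s)` at an intermediate time `s` at which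
`‖u(s)‖²` is at most its mean over `(s', t')`. -/
theorem exists_isContRep (h : t₀ < t₁) (j : V →L[ℝ] H) (u w : L2Time V t₀ t₁) {c : V}
    (hS : ∀ᵐ t ∂(volume.restrict (Ioo t₀ t₁)),
      j.adjoint (j (u t)) = c + ∫ r in t₀..t, w r) :
    ∃ Y : C(Icc t₀ t₁, H), IsContRep Y fun t => j (u t) := by
  obtain ⟨e, he⟩ := exists_norm_sq_eq h j u w hS
  let p : ℝ → Prop := fun t => j.adjoint (j (u t)) = c + ∫ r in t₀..t, w r ∧
    ‖j (u t)‖ ^ 2 = e + ∫ r in t₀..t, 2 * ⟪w r, u r⟫_ℝ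
  have hp : ∀ᵐ t ∂(volume.restrict (Ioo t₀ t₁)), p t := hS.and he
  let G : Set (Icc t₀ t₁) := {t | (t : ℝ) ∈ Ioo t₀ t₁ ∧ p t}
  have hG : Dense G := dense_Icc_of_ae h hp
  have iw := integrableOn_L2Time w
  have iwu : IntegrableOn (fun t => 2 * ⟪w t, u t⟫_ℝ) (Ioo t₀ t₁) :=
    (L2.integrable_inner (𝕜 := ℝ) w u).const_mul 2
  have iu2 : IntegrableOn (fun t => ‖u t‖ ^ 2) (Ioo t₀ t₁) := integrable_norm_sq u
  have iw2 : IntegrableOn (fun t => ‖w t‖ ^ 2) (Ioo t₀ t₁) := integrable_norm_sq w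
  let γ : ℝ → ℝ := fun t => ‖u t‖ ^ 2 + ‖w t‖ ^ 2
  have iγ : IntegrableOn γ (Ioo t₀ t₁) := iu2.add iw2
  -- the increment between two good times
  have hinc : ∀ s t, s ∈ Ioo t₀ t₁ → t ∈ Ioo t₀ t₁ → p s → p t →
      ‖j (u t) - j (u s)‖ ^ 2 = ∫ r in s..t, (2 * ⟪w r, u r⟫_ℝ - 2 * ⟪w r, u s⟫_ℝ) := by
    intro s t hs ht hps hpt
    have hs' := Ioo_subset_Icc_self hs
    have ht' := Ioo_subset_Icc_self ht
    have h0 : t₀ ∈ Icc t₀ t₁ := left_mem_Icc.2 h.le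
    have i1 := intervalIntegrable_of_integrableOn iw hs' ht'
    have hws : ∫ r in s..t, ⟪w r, u s⟫_ℝ = ⟪∫ r in s..t, w r, u s⟫_ℝ := by
      have := (innerSL ℝ (u s)).intervalIntegral_comp_comm i1
      simpa [real_inner_comm] using this
    have i2 : IntervalIntegrable (fun r => 2 * ⟪w r, u s⟫_ℝ) volume s t :=
      IntervalIntegrable.const_mul ⟨i1.1.inner_const (u s), i1.2.inner_const (u s)⟩ 2
    rw [intervalIntegral.integral_sub (intervalIntegrable_of_integrableOn iwu hs' ht') i2,
      intervalIntegral.integral_const_mul 2 fun r => ⟪w r, u s⟫_ℝ, hws]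
    have e1 : ∫ r in s..t, w r = j.adjoint (j (u t)) - j.adjoint (j (u s)) := by
      rw [hpt.1, hps.1, add_sub_add_left_eq_sub, intervalIntegral.integral_interval_sub_left
        (intervalIntegrable_of_integrableOn iw h0 ht')
        (intervalIntegrable_of_integrableOn iw h0 hs')]
    have e2 : ∫ r in s..t, 2 * ⟪w r, u r⟫_ℝ = ‖j (u t)‖ ^ 2 - ‖j (u s)‖ ^ 2 := by
      rw [hpt.2, hps.2, add_sub_add_left_eq_sub, intervalIntegral.integral_interval_sub_left
        (intervalIntegrable_of_integrableOn iwu h0 ht')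
        (intervalIntegrable_of_integrableOn iwu h0 hs')]
    have e3 : ⟪j.adjoint (j (u t)) - j.adjoint (j (u s)), u s⟫_ℝ =
        ⟪j (u t) - j (u s), j (u s)⟫_ℝ := by
      rw [← map_sub, ContinuousLinearMap.adjoint_inner_left]
    rw [e1, e2, e3, inner_sub_left, real_inner_self_eq_norm_sq, norm_sub_sq_real]
    ring
  have hbd : ∀ s' t', s' < t' → s' ∈ Ioo t₀ t₁ → t' ∈ Ioo t₀ t₁ → p s' → p t' →
      ‖j (u t') - j (u s')‖ ^ 2 ≤ 8 * ∫ r in s'..t', γ r := by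
    intro s' t' hlt hs' ht' hps' hpt'
    have hsub : Ioo s' t' ⊆ Ioo t₀ t₁ := Ioo_subset_Ioo hs'.1.le ht'.2.le
    -- an intermediate time at which `‖u‖²` does not exceed its mean
    obtain ⟨s, hs, hps, hsu⟩ : ∃ s ∈ Ioo s' t', p s ∧
        (t' - s') * ‖u s‖ ^ 2 ≤ ∫ r in Ioo s' t', ‖u r‖ ^ 2 := by
      have hae : ∀ᵐ r ∂(volume.restrict (Ioo s' t')), r ∈ Ioo s' t' ∧ p r :=
        (ae_restrict_mem measurableSet_Ioo).and (ae_restrict_of_ae_restrict_of_subset hsub hp)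
      obtain ⟨s, hsN, hs⟩ := exists_notMem_null_le_average
        (μ := volume.restrict (Ioo s' t')) (by simp [Measure.restrict_eq_zero, hlt])
        (iu2.mono_set hsub) (ae_iff.1 hae)
      simp only [mem_ofPred_eq, not_not] at hsN
      refine ⟨s, hsN.1, hsN.2, ?_⟩
      rw [average_eq, smul_eq_mul] at hs
      have hpos : (0 : ℝ) < t' - s' := sub_pos.2 hlt
      simp only [measureReal_restrict_apply_univ, Real.volume_real_Ioo_of_le hlt.le] at hs
      calc (t' - s') * ‖u s‖ ^ 2 ≤ (t' - s') * ((t' - s')⁻¹ * ∫ r in Ioo s' t', ‖u r‖ ^ 2) := by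
            gcongr
        _ = _ := by field_simp
    have key : ∀ t ∈ Icc s' t', p t → t ∈ Ioo t₀ t₁ →
        ‖j (u t) - j (u s)‖ ^ 2 ≤ 2 * ∫ r in Ioo s' t', γ r := by
      intro t ht hpt htI
      rw [hinc s t (hsub hs) htI hps hpt]
      have iK : IntegrableOn (fun r => 2 * ‖w r‖ ^ 2 + ‖u r‖ ^ 2 + ‖u s‖ ^ 2) (Ioo s' t') :=
        (((iw2.mono_set hsub).const_mul 2).add (iu2.mono_set hsub)).add
          (integrable_const (μ := volume.restrict (Ioo s' t')) _)
      have hu' : uIoc s t ⊆ Ioc s' t' := by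
        intro r hr
        rcases le_total s t with hl | hl
        · rw [uIoc_of_le hl] at hr
          exact ⟨hs.1.trans hr.1, hr.2.trans ht.2⟩
        · rw [uIoc_of_ge hl] at hr
          exact ⟨ht.1.trans_lt hr.1, hr.2.trans hs.2.le⟩
      have iK' : IntegrableOn (fun r => 2 * ‖w r‖ ^ 2 + ‖u r‖ ^ 2 + ‖u s‖ ^ 2) (Ioc s' t') := by
        rwa [integrableOn_Ioc_iff_integrableOn_Ioo]
      calc ∫ r in s..t, (2 * ⟪w r, u r⟫_ℝ - 2 * ⟪w r, u s⟫_ℝ)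
          ≤ ‖∫ r in s..t, (2 * ⟪w r, u r⟫_ℝ - 2 * ⟪w r, u s⟫_ℝ)‖ := le_abs_self _
        _ ≤ ∫ r in uIoc s t, (2 * ‖w r‖ ^ 2 + ‖u r‖ ^ 2 + ‖u s‖ ^ 2) := by
            rw [intervalIntegral.norm_intervalIntegral_eq]
            refine norm_integral_le_of_norm_le (iK'.mono_set hu') (Eventually.of_forall fun r => ?_)
            have h1 := norm_inner_le_norm (𝕜 := ℝ) (w r) (u r)
            have h2 := norm_inner_le_norm (𝕜 := ℝ) (w r) (u s)
            calc ‖2 * ⟪w r, u r⟫_ℝ - 2 * ⟪w r, u s⟫_ℝ‖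
                ≤ ‖2 * ⟪w r, u r⟫_ℝ‖ + ‖2 * ⟪w r, u s⟫_ℝ‖ := norm_sub_le _ _
              _ = 2 * ‖⟪w r, u r⟫_ℝ‖ + 2 * ‖⟪w r, u s⟫_ℝ‖ := by simp
              _ ≤ _ := by
                nlinarith [sq_nonneg (‖w r‖ - ‖u r‖), sq_nonneg (‖w r‖ - ‖u s‖)]
        _ ≤ ∫ r in Ioc s' t', (2 * ‖w r‖ ^ 2 + ‖u r‖ ^ 2 + ‖u s‖ ^ 2) :=
            setIntegral_mono_set iK' (Eventually.of_forall fun r => by positivity)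
              hu'.eventuallyLE
        _ = 2 * (∫ r in Ioo s' t', ‖w r‖ ^ 2) + (∫ r in Ioo s' t', ‖u r‖ ^ 2)
              + (t' - s') * ‖u s‖ ^ 2 := by
            have i3 : IntegrableOn (fun r => 2 * ‖w r‖ ^ 2 + ‖u r‖ ^ 2) (Ioo s' t') :=
              ((iw2.mono_set hsub).const_mul 2).add (iu2.mono_set hsub)
            rw [integral_Ioc_eq_integral_Ioo, integral_add i3
              (integrable_const (μ := volume.restrict (Ioo s' t')) _),
              integral_add ((iw2.mono_set hsub).const_mul 2) (iu2.mono_set hsub),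
              integral_const_mul, setIntegral_const, Real.volume_real_Ioo_of_le hlt.le, smul_eq_mul]
        _ ≤ 2 * ∫ r in Ioo s' t', γ r := by
            rw [integral_add (iu2.mono_set hsub) (iw2.mono_set hsub)]
            linarith
    rw [intervalIntegral.integral_of_le hlt.le, integral_Ioc_eq_integral_Ioo]
    have k1 := key t' (right_mem_Icc.2 hlt.le) hpt' ht'
    have k2 := key s' (left_mem_Icc.2 hlt.le) hps' hs'
    have htri : ‖j (u t') - j (u s')‖ ≤ ‖j (u t') - j (u s)‖ + ‖j (u s') - j (u s)‖ := by
      rw [norm_sub_rev (j (u s'))]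
      exact norm_sub_le_norm_sub_add_norm_sub _ _ _
    nlinarith [norm_nonneg (j (u t') - j (u s')), sq_nonneg (‖j (u t') - j (u s)‖ - ‖j (u s') - j (u s)‖)]
  -- uniform continuity on the good set
  have hΓ : UniformContinuousOn (fun t => ∫ r in t₀..t, γ r) (Icc t₀ t₁) :=
    isCompact_Icc.uniformContinuousOn_of_continuous (continuousOn_primitive_Icc h.le iγ)
  have huc : UniformContinuous fun t : G => j (u (t : Icc t₀ t₁)) := by
    rw [Metric.uniformContinuous_iff]
    intro ε hε
    obtain ⟨δ, hδ, hδε⟩ := Metric.uniformContinuousOn_iff.1 hΓ (ε ^ 2 / 8) (by positivity)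
    refine ⟨δ, hδ, ?_⟩
    have haux : ∀ s t : G, ((s : Icc t₀ t₁) : ℝ) < (t : Icc t₀ t₁) → dist s t < δ →
        dist (j (u (s : Icc t₀ t₁))) (j (u (t : Icc t₀ t₁))) < ε := by
      intro s t hst hd
      have h1 := hbd _ _ hst s.2.1 t.2.1 s.2.2 t.2.2
      have h2 := hδε _ (s : Icc t₀ t₁).2 _ (t : Icc t₀ t₁).2 hd
      have h0 : t₀ ∈ Icc t₀ t₁ := left_mem_Icc.2 h.le
      rw [dist_comm, Real.dist_eq, intervalIntegral.integral_interval_sub_left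
        (intervalIntegrable_of_integrableOn iγ h0 (t : Icc t₀ t₁).2)
        (intervalIntegrable_of_integrableOn iγ h0 (s : Icc t₀ t₁).2)] at h2
      rw [dist_comm, dist_eq_norm]
      refine lt_of_pow_lt_pow_left₀ 2 hε.le ?_
      linarith [le_abs_self (∫ r in ((s : Icc t₀ t₁) : ℝ)..(t : Icc t₀ t₁), γ r)]
    intro s t hd
    rcases lt_trichotomy ((s : Icc t₀ t₁) : ℝ) (t : Icc t₀ t₁) with hlt | heq | hgt
    · exact haux s t hlt hd
    · rw [heq, dist_self]; exact hε
    · rw [dist_comm]; exact haux t s hgt (by rwa [dist_comm])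
  refine ⟨⟨hG.extend fun t : G => j (u (t : Icc t₀ t₁)),
    (hG.uniformContinuous_extend huc).continuous⟩, ?_⟩
  filter_upwards [hp, ae_restrict_mem measurableSet_Ioo] with t h1 h2 ht
  exact (hG.extend_of_ind huc ⟨⟨t, ht⟩, h2, h1⟩).symm

theorem eq_of_continuous_of_ae_eq {X : Type*} [TopologicalSpace X] [T2Space X] (h : t₀ < t₁)
    {f g : Icc t₀ t₁ → X} (hf : Continuous f) (hg : Continuous g)
    (hfg : ∀ᵐ t ∂(volume.restrict (Ioo t₀ t₁)), ∀ ht : t ∈ Icc t₀ t₁, f ⟨t, ht⟩ = g ⟨t, ht⟩) :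
    f = g :=
  hf.ext_on (dense_Icc_of_ae h hfg) hg fun t ht => ht.2 t.2

/-- The energy identity and the evolution equation at every time of `[t₀, t₁]`. -/
theorem IsContRep.norm_sq_eq (h : t₀ < t₁) {j : V →L[ℝ] H} {u w : L2Time V t₀ t₁} {c : V}
    (hS : ∀ᵐ t ∂(volume.restrict (Ioo t₀ t₁)),
      j.adjoint (j (u t)) = c + ∫ r in t₀..t, w r)
    {Y : C(Icc t₀ t₁, H)} (hY : IsContRep Y fun t => j (u t)) (t : Icc t₀ t₁) :
    j.adjoint (Y t) = c + (∫ r in t₀..t, w r) ∧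
    ‖Y t‖ ^ 2 = ‖Y ⟨t₀, left_mem_Icc.2 h.le⟩‖ ^ 2 + ∫ r in t₀..t, 2 * ⟪w r, u r⟫_ℝ := by
  obtain ⟨e, he⟩ := exists_norm_sq_eq h j u w hS
  have iwu : IntegrableOn (fun t => 2 * ⟪w t, u t⟫_ℝ) (Ioo t₀ t₁) :=
    (L2.integrable_inner (𝕜 := ℝ) w u).const_mul 2
  have c1 : Continuous fun t : Icc t₀ t₁ => c + ∫ r in t₀..t, w r :=
    continuous_const.add
      (continuousOn_iff_continuous_domRestrict.1
        (continuousOn_primitive_Icc h.le (integrableOn_L2Time w)))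
  have c2 : Continuous fun t : Icc t₀ t₁ => e + ∫ r in t₀..t, 2 * ⟪w r, u r⟫_ℝ :=
    continuous_const.add
      (continuousOn_iff_continuous_domRestrict.1 (continuousOn_primitive_Icc h.le iwu))
  have e1 : (fun t : Icc t₀ t₁ => j.adjoint (Y t)) = fun t : Icc t₀ t₁ => c + ∫ r in t₀..t, w r := by
    refine eq_of_continuous_of_ae_eq h (j.adjoint.continuous.comp Y.continuous) c1 ?_
    filter_upwards [hS, hY] with t h1 h2 ht
    rw [← h2 ht, h1]
  have e2 : (fun t : Icc t₀ t₁ => ‖Y t‖ ^ 2) = fun t : Icc t₀ t₁ => e + ∫ r in t₀..t, 2 * ⟪w r, u r⟫_ℝ := by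
    refine eq_of_continuous_of_ae_eq h (Y.continuous.norm.pow 2) c2 ?_
    filter_upwards [he, hY] with t h1 h2 ht
    rw [← h2 ht, h1]
  have e3 := congrFun e2 ⟨t₀, left_mem_Icc.2 h.le⟩
  simp only [intervalIntegral.integral_same, add_zero] at e3
  rw [e3]
  exact ⟨congrFun e1 t, congrFun e2 t⟩

end ContRep

/-! ### Solvability of random linear equations -/

section Lions

variable {X : Type*} [NormedAddCommGroup X] [InnerProductSpace ℝ X] [CompleteSpace X]

/-- A vector `g` with `|⟨g, ψ⟩| ≤ ‖N†ψ‖` for all `ψ` lies in the range of `N`. -/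
theorem exists_apply_eq_of_inner_le (N : X →L[ℝ] X) (g : X)
    (h : ∀ ψ, |⟪g, ψ⟫_ℝ| ≤ ‖N.adjoint ψ‖) : ∃ u, N u = g := by
  let A : X →ₗ[ℝ] X := N.adjoint
  let ℓ : Module.Dual ℝ X := (innerSL ℝ g : X →L[ℝ] ℝ)
  have hℓ : ℓ ∈ LinearMap.range A.dualMap := by
    rw [LinearMap.range_dualMap_eq_dualAnnihilator_ker, Submodule.mem_dualAnnihilator]
    intro ψ hψ
    have h1 := h ψ
    have h2 : N.adjoint ψ = 0 := hψ
    rw [h2, norm_zero] at h1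
    exact abs_nonpos_iff.1 h1
  obtain ⟨F, hF⟩ := hℓ
  have hFA : ∀ ψ, F (N.adjoint ψ) = ⟪g, ψ⟫_ℝ := fun ψ => LinearMap.congr_fun hF ψ
  let p : Submodule ℝ X := LinearMap.range A
  let F₀ : StrongDual ℝ p := LinearMap.mkContinuous (F.comp p.subtype) 1 (by
    rintro ⟨x, ψ, rfl⟩
    rw [one_mul]
    change |F (N.adjoint ψ)| ≤ ‖N.adjoint ψ‖
    rw [hFA]
    exact h ψ)
  -- Hahn-Banach: the functional `N†ψ ↦ ⟨g, ψ⟩` extends to `X`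
  obtain ⟨G, hG, -⟩ := exists_extension_norm_eq p F₀
  refine ⟨(InnerProductSpace.toDual ℝ X).symm G, ext_inner_right ℝ fun ψ => ?_⟩
  rw [← ContinuousLinearMap.adjoint_inner_right, InnerProductSpace.toDual_symm_apply]
  have h1 := hG ⟨N.adjoint ψ, ψ, rfl⟩
  exact h1.trans (hFA ψ)

/-- Lions' projection lemma: test operators `Q` for which `⟨ψ, N Q ψ⟩` controls both `Q` and the
right-hand side yield solvability of `N u = g`. -/
theorem exists_apply_eq_of_coercive (N Q : X →L[ℝ] X) (g : X)
    (h1 : ∀ ψ, ⟪g, ψ⟫_ℝ ^ 2 ≤ ⟪ψ, N (Q ψ)⟫_ℝ) (h2 : ∀ ψ, ‖Q ψ‖ ^ 2 ≤ ⟪ψ, N (Q ψ)⟫_ℝ) :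
    ∃ u, N u = g := by
  refine exists_apply_eq_of_inner_le N g fun ψ => ?_
  have h3 : ⟪ψ, N (Q ψ)⟫_ℝ ≤ ‖N.adjoint ψ‖ * ‖Q ψ‖ := by
    rw [← ContinuousLinearMap.adjoint_inner_left]
    exact real_inner_le_norm _ _
  have h4 : ‖Q ψ‖ ≤ ‖N.adjoint ψ‖ := by
    rcases (norm_nonneg (Q ψ)).eq_or_lt with h0 | h0
    · rw [← h0]; exact norm_nonneg _
    · have := (h2 ψ).trans h3
      rw [sq] at this
      exact le_of_mul_le_mul_right this h0
  have h5 : ⟪g, ψ⟫_ℝ ^ 2 ≤ ‖N.adjoint ψ‖ ^ 2 := by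
    refine ((h1 ψ).trans h3).trans ?_
    rw [sq]
    exact mul_le_mul_of_nonneg_left h4 (norm_nonneg _)
  exact abs_le_of_sq_le_sq h5 (norm_nonneg _)

variable {Ω : Type*} [MeasurableSpace Ω] {P : Measure Ω} [IsProbabilityMeasure P]

theorem sq_integral_le {f : Ω → ℝ} (hf : MemLp f 2 P) : (∫ ω, f ω ∂P) ^ 2 ≤ ∫ ω, f ω ^ 2 ∂P := by
  have h := ProbabilityTheory.variance_nonneg f P
  rw [ProbabilityTheory.variance_eq_sub hf] at h
  simpa using h

/-- The random version of Lions' projection lemma. The operator norms and the coercivity constants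
may be unbounded in `ω`; rescaling equation and unknown reduces to a bounded operator on
`L²(Ω; X)`, so that the solution is measurable in `ω`. -/
theorem exists_random_solution {N : Ω → X →L[ℝ] X} (Q : X →L[ℝ] X) (g : X) {b C : Ω → ℝ}
    (hN : ∀ x, AEStronglyMeasurable (fun ω => N ω x) P) (hb : AEMeasurable b P)
    (hC : AEMeasurable C P) (hNb : ∀ᵐ ω ∂P, ‖N ω‖ ≤ b ω)
    (h1 : ∀ᵐ ω ∂P, 1 ≤ C ω ∧ ∀ ψ, ⟪g, ψ⟫_ℝ ^ 2 ≤ C ω * ⟪ψ, N ω (Q ψ)⟫_ℝ ∧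
      ‖Q ψ‖ ^ 2 ≤ C ω * ⟪ψ, N ω (Q ψ)⟫_ℝ) :
    ∃ u : Ω → X, AEStronglyMeasurable u P ∧ ∀ᵐ ω ∂P, N ω (u ω) = g := by
  -- With this weight, `r C N` has norm at most `1` and `r Q` norm at most `‖Q‖`. The equation solved
  -- in `L²(Ω; X)` is `(r C N) u = r g`, and `C u` solves the original one.
  let r : Ω → ℝ := fun ω => (C ω * (1 + b ω))⁻¹
  have hr : AEStronglyMeasurable r P := ((hC.mul (hb.const_add 1)).inv).aestronglyMeasurable
  have hr1 : ∀ᵐ ω ∂P, 0 < r ω ∧ r ω ≤ 1 ∧ r ω * C ω * b ω ≤ 1 := by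
    filter_upwards [hNb, h1] with ω hω1 hω2
    have hb0 : 0 ≤ b ω := (norm_nonneg _).trans hω1
    have hC0 : 0 < C ω := one_pos.trans_le hω2.1
    have hpos : 0 < C ω * (1 + b ω) := by positivity
    refine ⟨inv_pos.2 hpos, inv_le_one_of_one_le₀ ?_, ?_⟩
    · nlinarith [hω2.1]
    · simp only [r]
      rw [mul_assoc, inv_mul_le_iff₀ hpos, mul_one]
      nlinarith
  let N' : Lp X 2 P →L[ℝ] Lp X 2 P := randomOp (fun ω => (r ω * C ω) • N ω)
    (fun x => (hr.mul hC.aestronglyMeasurable).smul (hN x)) 1 (by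
      filter_upwards [hNb, h1, hr1] with ω hω1 hω2 hω3
      rw [norm_smul, Real.norm_of_nonneg (mul_nonneg hω3.1.le (zero_le_one.trans hω2.1))]
      exact (mul_le_mul_of_nonneg_left hω1
        (mul_nonneg hω3.1.le (zero_le_one.trans hω2.1))).trans hω3.2.2)
  let Q' : Lp X 2 P →L[ℝ] Lp X 2 P := randomOp (fun ω => r ω • Q)
    (fun x => hr.smul aestronglyMeasurable_const) ‖Q‖ (by
      filter_upwards [hr1] with ω hω
      rw [norm_smul, Real.norm_of_nonneg hω.1.le]
      exact mul_le_of_le_one_left (norm_nonneg _) hω.2.1)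
  have hg : MemLp (fun ω => r ω • g) 2 P := by
    refine MemLp.of_bound (hr.smul aestronglyMeasurable_const) ‖g‖ ?_
    filter_upwards [hr1] with ω hω
    rw [norm_smul, Real.norm_of_nonneg hω.1.le]
    exact mul_le_of_le_one_left (norm_nonneg _) hω.2.1
  have hN' : ∀ f : Lp X 2 P, N' f =ᵐ[P] fun ω => (r ω * C ω) • N ω (f ω) :=
    fun f => coeFn_randomOp f
  have hQ' : ∀ f : Lp X 2 P, Q' f =ᵐ[P] fun ω => r ω • Q (f ω) := fun f => coeFn_randomOp f
  have hNQ : ∀ ψ : Lp X 2 P, ∀ᵐ ω ∂P, ⟪ψ ω, N' (Q' ψ) ω⟫_ℝ =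
      r ω ^ 2 * (C ω * ⟪ψ ω, N ω (Q (ψ ω))⟫_ℝ) := by
    intro ψ
    filter_upwards [hN' (Q' ψ), hQ' ψ] with ω k1 k2
    rw [k1, k2, map_smul, inner_smul_right, inner_smul_right]
    ring
  obtain ⟨u, hu⟩ := exists_apply_eq_of_coercive N' Q' (hg.toLp _) (fun ψ => by
      have i1 : MemLp (fun ω => ⟪r ω • g, ψ ω⟫_ℝ) 2 P := by
        refine ((Lp.memLp ψ).norm.const_mul ‖g‖).mono (hg.1.inner (Lp.aestronglyMeasurable ψ)) ?_
        filter_upwards [hr1] with ω hω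
        refine (norm_inner_le_norm _ _).trans ?_
        rw [norm_mul, norm_norm, norm_norm, norm_smul, Real.norm_of_nonneg hω.1.le]
        exact mul_le_mul_of_nonneg_right (mul_le_of_le_one_left (norm_nonneg _) hω.2.1)
          (norm_nonneg _)
      have e1 : ⟪hg.toLp _, ψ⟫_ℝ = ∫ ω, ⟪r ω • g, ψ ω⟫_ℝ ∂P := by
        rw [L2.inner_def]
        refine integral_congr_ae ?_
        filter_upwards [hg.coeFn_toLp] with ω hω
        rw [hω]
      rw [e1, L2.inner_def]
      refine (sq_integral_le i1).trans (integral_mono_ae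
        ((memLp_two_iff_integrable_sq i1.1).1 i1) (L2.integrable_inner ψ (N' (Q' ψ))) ?_)
      filter_upwards [hNQ ψ, h1] with ω k1 k2
      rw [k1, real_inner_smul_left, mul_pow]
      exact mul_le_mul_of_nonneg_left (k2.2 _).1 (sq_nonneg _)) (fun ψ => by
      rw [← real_inner_self_eq_norm_sq, L2.inner_def, L2.inner_def]
      refine integral_mono_ae (L2.integrable_inner _ _) (L2.integrable_inner ψ (N' (Q' ψ))) ?_
      filter_upwards [hNQ ψ, h1, hQ' ψ] with ω k1 k2 k3
      rw [k1, k3, real_inner_self_eq_norm_sq, norm_smul, mul_pow, Real.norm_eq_abs, sq_abs]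
      exact mul_le_mul_of_nonneg_left (k2.2 _).2 (sq_nonneg _))
  refine ⟨fun ω => C ω • u ω, hC.aestronglyMeasurable.smul (Lp.aestronglyMeasurable u), ?_⟩
  have hu' : (N' u : Ω → X) =ᵐ[P] fun ω => r ω • g := by rw [hu]; exact hg.coeFn_toLp
  filter_upwards [hu', hN' u, hr1] with ω k1 k2 k3
  rw [k1, mul_smul] at k2
  rw [map_smul]
  exact (smul_right_injective X k3.1.ne' k2).symm

end Lions

/-! ### The integrated evolution equation -/

section Volterra

variable {X Z : Type*} [NormedAddCommGroup X] [NormedSpace ℝ X]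
  [NormedAddCommGroup Z] [NormedSpace ℝ Z] {t₀ t₁ : ℝ}

theorem memLp_primitive (h : t₀ ≤ t₁) (w : L2Time X t₀ t₁) :
    MemLp (fun t => ∫ r in t₀..t, w r) 2 (volume.restrict (Ioo t₀ t₁)) := by
  refine MemLp.of_bound (aestronglyMeasurable_primitive h (integrableOn_L2Time w))
    (∫ r in Ioo t₀ t₁, ‖w r‖) ?_
  filter_upwards [ae_restrict_mem measurableSet_Ioo] with t ht
  exact norm_primitive_le (integrableOn_L2Time w) (Ioo_subset_Icc_self ht)

theorem integral_norm_le (h : t₀ ≤ t₁) (w : L2Time X t₀ t₁) :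
    ∫ r in Ioo t₀ t₁, ‖w r‖ ≤ √(t₁ - t₀) * ‖w‖ := by
  refine abs_le_of_sq_le_sq' ?_ (by positivity) |>.2
  rw [mul_pow, Real.sq_sqrt (sub_nonneg.2 h)]
  exact sq_integral_norm_le h w

/-- The integral `w ↦ ∫ w` over `(t₀, t₁)`. -/
def timeIntegral (h : t₀ ≤ t₁) : L2Time X t₀ t₁ →L[ℝ] X :=
  LinearMap.mkContinuous
    { toFun := fun w => ∫ r in Ioo t₀ t₁, w r
      map_add' := fun v w => by
        rw [← integral_add (integrableOn_L2Time v) (integrableOn_L2Time w)]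
        exact integral_congr_ae (Lp.coeFn_add v w)
      map_smul' := fun c w => by
        rw [RingHom.id_apply, ← integral_smul]
        exact integral_congr_ae (Lp.coeFn_smul c w) }
    (√(t₁ - t₀)) fun w => (norm_integral_le_integral_norm _).trans (integral_norm_le h w)

theorem timeIntegral_apply (h : t₀ ≤ t₁) (w : L2Time X t₀ t₁) :
    timeIntegral h w = ∫ r in Ioo t₀ t₁, w r := rfl

theorem primitive_congr {v w : ℝ → X} (hvw : v =ᵐ[volume.restrict (Ioo t₀ t₁)] w) {t : ℝ}
    (ht : t ∈ Icc t₀ t₁) : ∫ r in t₀..t, v r = ∫ r in t₀..t, w r := by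
  rw [intervalIntegral.integral_of_le ht.1, intervalIntegral.integral_of_le ht.1,
    integral_Ioc_eq_integral_Ioo, integral_Ioc_eq_integral_Ioo]
  exact integral_congr_ae (ae_restrict_of_ae_restrict_of_subset (Ioo_subset_Ioo_right ht.2) hvw)

/-- The Volterra operator `w ↦ (t ↦ ∫_{t₀}^t w)`. -/
def volterra (h : t₀ ≤ t₁) : L2Time X t₀ t₁ →L[ℝ] L2Time X t₀ t₁ :=
  LinearMap.mkContinuous
    { toFun := fun w => (memLp_primitive h w).toLp _
      map_add' := fun v w => by
        ext1
        filter_upwards [(memLp_primitive h (v + w)).coeFn_toLp, (memLp_primitive h v).coeFn_toLp,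
          (memLp_primitive h w).coeFn_toLp, Lp.coeFn_add ((memLp_primitive h v).toLp _)
          ((memLp_primitive h w).toLp _), ae_restrict_mem measurableSet_Ioo] with t h1 h2 h3 h4 ht
        have h0 : t₀ ∈ Icc t₀ t₁ := left_mem_Icc.2 h
        have ht' := Ioo_subset_Icc_self ht
        rw [h1, h4, Pi.add_apply, h2, h3, primitive_congr (Lp.coeFn_add v w) ht',
          ← intervalIntegral.integral_add
            (intervalIntegrable_of_integrableOn (integrableOn_L2Time v) h0 ht')
            (intervalIntegrable_of_integrableOn (integrableOn_L2Time w) h0 ht')]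
        rfl
      map_smul' := fun c w => by
        ext1
        filter_upwards [(memLp_primitive h (c • w)).coeFn_toLp,
          (memLp_primitive h w).coeFn_toLp, Lp.coeFn_smul c ((memLp_primitive h w).toLp _),
          ae_restrict_mem measurableSet_Ioo] with t h1 h3 h4 ht
        rw [h1, RingHom.id_apply, h4, Pi.smul_apply, h3,
          primitive_congr (Lp.coeFn_smul c w) (Ioo_subset_Icc_self ht),
          ← intervalIntegral.integral_smul]
        rfl }
    (((measureUnivNNReal (volume.restrict (Ioo t₀ t₁)) : ℝ) ^ (ENNReal.toReal 2)⁻¹) * √(t₁ - t₀))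
    fun w => by
      rw [mul_assoc]
      refine (Lp.norm_le_of_ae_bound (C := ∫ r in Ioo t₀ t₁, ‖w r‖)
        (integral_nonneg fun _ => norm_nonneg _) ?_).trans
        (mul_le_mul_of_nonneg_left (integral_norm_le h w) (by positivity))
      filter_upwards [(memLp_primitive h w).coeFn_toLp, ae_restrict_mem measurableSet_Ioo]
        with t h1 ht
      change ‖(memLp_primitive h w).toLp _ t‖ ≤ _
      rw [h1]
      exact norm_primitive_le (integrableOn_L2Time w) (Ioo_subset_Icc_self ht)

theorem coeFn_volterra (h : t₀ ≤ t₁) (w : L2Time X t₀ t₁) :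
    volterra h w =ᵐ[volume.restrict (Ioo t₀ t₁)] fun t => ∫ r in t₀..t, w r :=
  (memLp_primitive h w).coeFn_toLp

end Volterra

section Backward

variable {X Z : Type*} [NormedAddCommGroup X] [InnerProductSpace ℝ X] [CompleteSpace X]
  [NormedAddCommGroup Z] [InnerProductSpace ℝ Z] [CompleteSpace Z] {t₀ t₁ : ℝ}

/-- The operator `w ↦ (t ↦ ∫_t^{t₁} w)`, the adjoint of the Volterra operator. -/
def backward (h : t₀ ≤ t₁) : L2Time X t₀ t₁ →L[ℝ] L2Time X t₀ t₁ :=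
  (Lp.constL 2 (volume.restrict (Ioo t₀ t₁)) ℝ).comp (timeIntegral h) - volterra h

theorem coeFn_backward (h : t₀ ≤ t₁) (w : L2Time X t₀ t₁) :
    backward h w =ᵐ[volume.restrict (Ioo t₀ t₁)]
      fun t => (∫ r in Ioo t₀ t₁, w r) + ∫ r in t₀..t, (-w) r := by
  have e : backward h w = Lp.const 2 (volume.restrict (Ioo t₀ t₁)) (timeIntegral h w) -
    volterra h w := rfl
  rw [e]
  filter_upwards [Lp.coeFn_sub (Lp.const 2 (volume.restrict (Ioo t₀ t₁)) (timeIntegral h w))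
    (volterra h w), Lp.coeFn_const (p := 2) (μ := volume.restrict (Ioo t₀ t₁)) (timeIntegral h w),
    coeFn_volterra h w, ae_restrict_mem measurableSet_Ioo] with t h1 h2 h3 ht
  rw [h1, Pi.sub_apply, h2, h3, Function.const_apply, timeIntegral_apply,
    primitive_congr (Lp.coeFn_neg w) (Ioo_subset_Icc_self ht), sub_eq_add_neg,
    ← intervalIntegral.integral_neg]
  rfl

theorem compLp_backward (h : t₀ ≤ t₁) (L : X →L[ℝ] Z) (w : L2Time X t₀ t₁) :
    L.compLp (backward h w) = backward h (L.compLp w) := by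
  ext1
  filter_upwards [L.coeFn_compLp (backward h w), coeFn_backward h w, coeFn_backward h (L.compLp w),
    ae_restrict_mem measurableSet_Ioo] with t h1 h2 h3 ht
  have ht' := Ioo_subset_Icc_self ht
  have e1 : ∫ r in Ioo t₀ t₁, L.compLp w r = L (∫ r in Ioo t₀ t₁, w r) := by
    rw [← L.integral_comp_comm (integrableOn_L2Time w)]
    exact integral_congr_ae (L.coeFn_compLp w)
  have e2 : ∫ r in t₀..t, (-L.compLp w) r = L (∫ r in t₀..t, (-w) r) := by
    rw [← L.intervalIntegral_comp_comm (intervalIntegrable_of_integrableOn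
      (integrableOn_L2Time (-w)) (left_mem_Icc.2 (ht'.1.trans ht'.2)) ht')]
    refine primitive_congr ?_ ht'
    filter_upwards [Lp.coeFn_neg (L.compLp w), Lp.coeFn_neg w, L.coeFn_compLp w] with r k1 k2 k3
    rw [k1, Pi.neg_apply, k2, Pi.neg_apply, k3, map_neg]
  rw [h1, h2, h3, e1, e2, map_add]

/-- The energy balance of `R(t) = ∫_t^{t₁} η`, weighted by `e^{2λ(t - t₀)}`. -/
theorem integral_exp_mul_inner_backward (h : t₀ < t₁) (η : L2Time X t₀ t₁) (l : ℝ) :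
    ∫ t in Ioo t₀ t₁, Real.exp (2 * l * (t - t₀)) * ⟪η t, backward h.le η t⟫_ℝ =
      ‖∫ t in Ioo t₀ t₁, η t‖ ^ 2 / 2 +
        l * ∫ t in Ioo t₀ t₁, Real.exp (2 * l * (t - t₀)) * ‖backward h.le η t‖ ^ 2 := by
  set R := backward h.le η
  set c := ∫ t in Ioo t₀ t₁, η t
  have hS : ∀ᵐ t ∂(volume.restrict (Ioo t₀ t₁)), (ContinuousLinearMap.id ℝ X).adjoint
      ((ContinuousLinearMap.id ℝ X) (R t)) = c + ∫ r in t₀..t, (-η) r := by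
    filter_upwards [coeFn_backward h.le η] with t ht
    rw [ContinuousLinearMap.adjoint_id]
    exact ht
  let Y : C(Icc t₀ t₁, X) := ⟨fun t => c + ∫ r in t₀..t, (-η) r, continuous_const.add
    (continuousOn_iff_continuous_domRestrict.1
      (continuousOn_primitive_Icc h.le (integrableOn_L2Time (-η))))⟩
  have hY : IsContRep Y fun t => (ContinuousLinearMap.id ℝ X) (R t) := by
    filter_upwards [coeFn_backward h.le η] with t ht ht'
    exact ht
  have hneg : ∀ᵐ t ∂(volume.restrict (Ioo t₀ t₁)),
      2 * ⟪(-η) t, R t⟫_ℝ = -(2 * ⟪η t, R t⟫_ℝ) := by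
    filter_upwards [Lp.coeFn_neg η] with t ht
    rw [ht, Pi.neg_apply, inner_neg_left, mul_neg]
  have iη : IntegrableOn (fun t => -(2 * ⟪η t, R t⟫_ℝ)) (Ioo t₀ t₁) :=
    ((L2.integrable_inner (𝕜 := ℝ) η R).const_mul 2).neg
  have hY0 : Y ⟨t₀, left_mem_Icc.2 h.le⟩ = c := by simp [Y]
  have hY1 : Y ⟨t₁, right_mem_Icc.2 h.le⟩ = 0 := by
    change c + ∫ r in t₀..t₁, (-η) r = 0
    rw [intervalIntegral.integral_of_le h.le, integral_Ioc_eq_integral_Ioo,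
      integral_congr_ae (Lp.coeFn_neg η)]
    simp only [Pi.neg_apply, integral_neg]
    exact add_neg_cancel c
  have hE : ∀ t : Icc t₀ t₁, ‖Y t‖ ^ 2 = ‖c‖ ^ 2 + ∫ r in t₀..t, -(2 * ⟪η r, R r⟫_ℝ) := by
    intro t
    rw [(IsContRep.norm_sq_eq h hS hY t).2, hY0, primitive_congr hneg t.2]
  have hE1 : ∫ t in Ioo t₀ t₁, -(2 * ⟪η t, R t⟫_ℝ) = -‖c‖ ^ 2 := by
    have := hE ⟨t₁, right_mem_Icc.2 h.le⟩
    rw [hY1, norm_zero, intervalIntegral.integral_of_le h.le, integral_Ioc_eq_integral_Ioo] at this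
    linarith
  let ρ : ℝ → ℝ := fun t => Real.exp (2 * l * (t - t₀))
  have hρ : ContDiff ℝ 1 ρ := by fun_prop
  have hder : ∀ t, HasDerivAt (fun t => ρ t - ρ t₁) (2 * l * ρ t) t := by
    intro t
    have := (((hasDerivAt_id t).sub_const t₀).const_mul (2 * l)).exp
    refine (this.sub_const (ρ t₁)).congr_deriv ?_
    simp [ρ]; ring
  -- integration by parts against `ρ - ρ(t₁)`, which vanishes at `t₁`
  have key := integral_deriv_smul_of_eq_primitive h.le (g := fun t => ‖R t‖ ^ 2) (c := ‖c‖ ^ 2) iη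
    (by
      filter_upwards [hY, ae_restrict_mem measurableSet_Ioo] with t h1 ht
      have h2 := h1 (Ioo_subset_Icc_self ht)
      rw [← hE ⟨t, Ioo_subset_Icc_self ht⟩, ← h2]
      rfl) (θ := fun t => ρ t - ρ t₁) (hρ.sub contDiff_const) (sub_self _)
  have e1 : ∀ t, deriv (fun t => ρ t - ρ t₁) t = 2 * l * ρ t := fun t => (hder t).deriv
  have hρ0 : ρ t₀ = 1 := by simp [ρ]
  have i1 : IntegrableOn (fun t => ρ t * -(2 * ⟪η t, R t⟫_ℝ)) (Ioo t₀ t₁) :=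
    integrableOn_continuous_smul hρ.continuous iη
  have e2 : ∫ t in Ioo t₀ t₁, (ρ t - ρ t₁) • -(2 * ⟪η t, R t⟫_ℝ) =
      (∫ t in Ioo t₀ t₁, ρ t * -(2 * ⟪η t, R t⟫_ℝ)) + ρ t₁ * ‖c‖ ^ 2 := by
    have i2 : IntegrableOn (fun t => ρ t₁ * -(2 * ⟪η t, R t⟫_ℝ)) (Ioo t₀ t₁) := iη.const_mul _
    have e3 : ∫ t in Ioo t₀ t₁, ρ t₁ * -(2 * ⟪η t, R t⟫_ℝ) = -(ρ t₁ * ‖c‖ ^ 2) := by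
      rw [integral_const_mul, hE1]; ring
    rw [← sub_neg_eq_add, ← e3, ← integral_sub i1 i2]
    refine integral_congr_ae (Eventually.of_forall fun t => ?_)
    simp only [smul_eq_mul]; ring
  have e4 : ∫ t in Ioo t₀ t₁, ρ t * -(2 * ⟪η t, R t⟫_ℝ) =
      -2 * ∫ t in Ioo t₀ t₁, ρ t * ⟪η t, R t⟫_ℝ := by
    rw [← integral_const_mul]
    refine integral_congr_ae (Eventually.of_forall fun t => ?_)
    simp only []; ring
  have e5 : ∫ t in Ioo t₀ t₁, (2 * l * ρ t) • ‖R t‖ ^ 2 =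
      2 * l * ∫ t in Ioo t₀ t₁, ρ t * ‖R t‖ ^ 2 := by
    rw [← integral_const_mul]
    refine integral_congr_ae (Eventually.of_forall fun t => ?_)
    simp only [smul_eq_mul]; ring
  simp only [e1] at key
  rw [e5, e2, e4, hρ0, smul_eq_mul] at key
  change ∫ t in Ioo t₀ t₁, ρ t * ⟪η t, R t⟫_ℝ = _ / 2 + l * ∫ t in Ioo t₀ t₁, ρ t * ‖R t‖ ^ 2
  linarith

theorem inner_const_left_eq (h : t₀ ≤ t₁) (x : X) (ψ : L2Time X t₀ t₁) :
    ⟪Lp.const 2 (volume.restrict (Ioo t₀ t₁)) x, ψ⟫_ℝ = ⟪x, timeIntegral h ψ⟫_ℝ := by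
  rw [L2.inner_def, timeIntegral_apply, ← integral_inner (integrableOn_L2Time ψ)]
  refine integral_congr_ae ?_
  filter_upwards [Lp.coeFn_const (p := 2) (μ := volume.restrict (Ioo t₀ t₁)) x] with t ht
  rw [ht]
  rfl

/-- `backward` is the adjoint of `volterra`: for `λ = 0` the energy balance reads
`⟨η, backward η⟩ = ‖∫ η‖² / 2`, and polarization gives the claim. -/
theorem inner_volterra_left (h : t₀ < t₁) (w ψ : L2Time X t₀ t₁) :
    ⟪volterra h.le w, ψ⟫_ℝ = ⟪w, backward h.le ψ⟫_ℝ := by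
  have hq : ∀ η : L2Time X t₀ t₁, ⟪η, backward h.le η⟫_ℝ =
      ⟪timeIntegral h.le η, timeIntegral h.le η⟫_ℝ / 2 := by
    intro η
    have := integral_exp_mul_inner_backward h η 0
    simp only [mul_zero, zero_mul, Real.exp_zero, one_mul, add_zero] at this
    rw [L2.inner_def, this, real_inner_self_eq_norm_sq, timeIntegral_apply]
  have h1 := hq (w + ψ)
  simp only [map_add, inner_add_left, inner_add_right, hq w, hq ψ] at h1
  have h2 : backward h.le w = Lp.const 2 (volume.restrict (Ioo t₀ t₁)) (timeIntegral h.le w) -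
    volterra h.le w := rfl
  have h3 : ⟪ψ, backward h.le w⟫_ℝ = ⟪timeIntegral h.le w, timeIntegral h.le ψ⟫_ℝ -
      ⟪volterra h.le w, ψ⟫_ℝ := by
    rw [real_inner_comm, h2, inner_sub_left, inner_const_left_eq h.le]
  rw [h3, real_inner_comm (timeIntegral h.le w) (timeIntegral h.le ψ)] at h1
  linarith

/-- Multiplication by `e^{2λ(t - t₀)}`. -/
def expMul (t₀ t₁ : ℝ) {l : ℝ} (hl : 0 ≤ l) : L2Time X t₀ t₁ →L[ℝ] L2Time X t₀ t₁ :=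
  randomOp (fun t => Real.exp (2 * l * (t - t₀)) • ContinuousLinearMap.id ℝ X)
    (fun x => by
      have : Continuous fun t => Real.exp (2 * l * (t - t₀)) := by fun_prop
      exact this.aestronglyMeasurable.smul_const x)
    (Real.exp (2 * l * (t₁ - t₀))) (by
      filter_upwards [ae_restrict_mem measurableSet_Ioo] with t ht
      rw [norm_smul, Real.norm_of_nonneg (Real.exp_pos _).le]
      refine (mul_le_of_le_one_right (Real.exp_pos _).le ContinuousLinearMap.norm_id_le).trans ?_
      refine Real.exp_le_exp.2 (mul_le_mul_of_nonneg_left ?_ (by positivity))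
      linarith [ht.2])

theorem coeFn_expMul {l : ℝ} (hl : 0 ≤ l) (u : L2Time X t₀ t₁) :
    expMul t₀ t₁ hl u =ᵐ[volume.restrict (Ioo t₀ t₁)]
      fun t => Real.exp (2 * l * (t - t₀)) • u t :=
  coeFn_randomOp u

end Backward

section Coercive

variable {V H : Type*} [NormedAddCommGroup V] [InnerProductSpace ℝ V] [CompleteSpace V]
  [NormedAddCommGroup H] [InnerProductSpace ℝ H] [CompleteSpace H] {t₀ t₁ : ℝ}

/-- Coercivity of the integrated evolution operator `u ↦ j†j u + ∫ B u` against the test functions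
`e^{2λ(t - t₀)} ∫_t^{t₁} ψ`. -/
theorem le_inner_evolution (h : t₀ < t₁) (j : V →L[ℝ] H) {B : ℝ → V →L[ℝ] V}
    {𝓑 : L2Time V t₀ t₁ →L[ℝ] L2Time V t₀ t₁}
    (h𝓑 : ∀ u, 𝓑 u =ᵐ[volume.restrict (Ioo t₀ t₁)] fun t => B t (u t)) {α l : ℝ} (hα : 0 ≤ α)
    (hl : 0 ≤ l) (hB : ∀ᵐ t ∂(volume.restrict (Ioo t₀ t₁)), ∀ v,
      α * ‖v‖ ^ 2 ≤ ⟪B t v, v⟫_ℝ + l * ‖j v‖ ^ 2) (ψ : L2Time V t₀ t₁) :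
    ‖j (timeIntegral h.le ψ)‖ ^ 2 / 2 + α * ‖backward h.le ψ‖ ^ 2 ≤
      ⟪ψ, ((j.adjoint.comp j).compLpL 2 (volume.restrict (Ioo t₀ t₁)) + (volterra h.le).comp 𝓑)
        (expMul t₀ t₁ hl (backward h.le ψ))⟫_ℝ := by
  set Φ := backward h.le ψ with hΦ
  set ρ : ℝ → ℝ := fun t => Real.exp (2 * l * (t - t₀)) with hρ
  have hρc : Continuous ρ := by fun_prop
  have hjΦ := compLp_backward h.le j ψ
  have e1 : ⟪ψ, (j.adjoint.comp j).compLp (expMul t₀ t₁ hl Φ)⟫_ℝ =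
      ‖j (timeIntegral h.le ψ)‖ ^ 2 / 2 + l * ∫ t in Ioo t₀ t₁, ρ t * ‖j (Φ t)‖ ^ 2 := by
    have k := integral_exp_mul_inner_backward h (j.compLp ψ) l
    rw [← hjΦ] at k
    have k1 : ∫ t in Ioo t₀ t₁, j.compLp ψ t = j (timeIntegral h.le ψ) := by
      rw [timeIntegral_apply, ← j.integral_comp_comm (integrableOn_L2Time ψ)]
      exact integral_congr_ae (j.coeFn_compLp ψ)
    rw [k1] at k
    have k2 : ∫ t in Ioo t₀ t₁, ρ t * ‖j (Φ t)‖ ^ 2 =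
        ∫ t in Ioo t₀ t₁, ρ t * ‖j.compLp Φ t‖ ^ 2 := by
      refine integral_congr_ae ?_
      filter_upwards [j.coeFn_compLp Φ] with t ht
      simp only [ht]
    rw [k2, ← k, L2.inner_def]
    refine integral_congr_ae ?_
    filter_upwards [(j.adjoint.comp j).coeFn_compLp (expMul t₀ t₁ hl Φ), coeFn_expMul hl Φ,
      j.coeFn_compLp Φ, j.coeFn_compLp ψ] with t h1 h2 h3 h4
    rw [h1, h2, h3, h4, ContinuousLinearMap.comp_apply, ContinuousLinearMap.adjoint_inner_right,
      map_smul, inner_smul_right]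
  have e2 : ⟪ψ, volterra h.le (𝓑 (expMul t₀ t₁ hl Φ))⟫_ℝ =
      ∫ t in Ioo t₀ t₁, ρ t * ⟪B t (Φ t), Φ t⟫_ℝ := by
    rw [real_inner_comm, inner_volterra_left h, L2.inner_def]
    refine integral_congr_ae ?_
    filter_upwards [h𝓑 (expMul t₀ t₁ hl Φ), coeFn_expMul hl Φ] with t h1 h2
    rw [h1, h2, map_smul, real_inner_smul_left]
  have i1 : IntegrableOn (fun t => ρ t * ⟪B t (Φ t), Φ t⟫_ℝ) (Ioo t₀ t₁) := by
    refine integrableOn_continuous_smul hρc ?_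
    refine (L2.integrable_inner (𝕜 := ℝ) (𝓑 Φ) Φ).congr ?_
    filter_upwards [h𝓑 Φ] with t ht
    rw [ht]
  have i2 : IntegrableOn (fun t => ρ t * ‖j (Φ t)‖ ^ 2) (Ioo t₀ t₁) := by
    refine integrableOn_continuous_smul hρc ?_
    refine (integrable_norm_sq (j.compLp Φ)).congr ?_
    filter_upwards [j.coeFn_compLp Φ] with t ht
    rw [ht]
  have e3 : α * ‖Φ‖ ^ 2 ≤ (∫ t in Ioo t₀ t₁, ρ t * ⟪B t (Φ t), Φ t⟫_ℝ) +
      l * ∫ t in Ioo t₀ t₁, ρ t * ‖j (Φ t)‖ ^ 2 := by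
    rw [← integral_const_mul, ← integral_add i1 (i2.const_mul l), ← real_inner_self_eq_norm_sq,
      L2.inner_def, ← integral_const_mul]
    refine integral_mono_ae ((L2.integrable_inner Φ Φ).const_mul α) (i1.add (i2.const_mul l)) ?_
    filter_upwards [hB, ae_restrict_mem measurableSet_Ioo] with t h1 ht
    have h2 := h1 (Φ t)
    have h3 : 1 ≤ ρ t := Real.one_le_exp (mul_nonneg (by positivity) (by linarith [ht.1]))
    rw [real_inner_self_eq_norm_sq]
    have h4 : α * ‖Φ t‖ ^ 2 ≤ ρ t * (α * ‖Φ t‖ ^ 2) :=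
      le_mul_of_one_le_left (by positivity) h3
    refine h4.trans ((mul_le_mul_of_nonneg_left h2 (zero_le_one.trans h3)).trans (le_of_eq ?_))
    ring
  rw [add_apply, inner_add_right]
  change _ ≤ ⟪ψ, (j.adjoint.comp j).compLp (expMul t₀ t₁ hl Φ)⟫_ℝ +
    ⟪ψ, volterra h.le (𝓑 (expMul t₀ t₁ hl Φ))⟫_ℝ
  rw [e1, e2]
  linarith

/-- The right-hand side `j†y₀ + ∫ F` is bounded by the two terms which `le_inner_evolution`
controls. -/
theorem sq_inner_data_le (h : t₀ < t₁) (j : V →L[ℝ] H) (y₀ : H) (F ψ : L2Time V t₀ t₁) :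
    ⟪Lp.const 2 (volume.restrict (Ioo t₀ t₁)) (j.adjoint y₀) + volterra h.le F, ψ⟫_ℝ ^ 2 ≤
      2 * ‖y₀‖ ^ 2 * ‖j (timeIntegral h.le ψ)‖ ^ 2 + 2 * ‖F‖ ^ 2 * ‖backward h.le ψ‖ ^ 2 := by
  rw [inner_add_left, inner_const_left_eq h.le, inner_volterra_left h,
    ContinuousLinearMap.adjoint_inner_left]
  have h1 : ⟪y₀, j (timeIntegral h.le ψ)⟫_ℝ ^ 2 ≤ ‖y₀‖ ^ 2 * ‖j (timeIntegral h.le ψ)‖ ^ 2 := by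
    rw [← mul_pow]
    exact sq_le_sq' (neg_le_of_abs_le (abs_real_inner_le_norm _ _)) (real_inner_le_norm _ _)
  have h2 : ⟪F, backward h.le ψ⟫_ℝ ^ 2 ≤ ‖F‖ ^ 2 * ‖backward h.le ψ‖ ^ 2 := by
    rw [← mul_pow]
    exact sq_le_sq' (neg_le_of_abs_le (abs_real_inner_le_norm _ _)) (real_inner_le_norm _ _)
  linarith [add_sq_le (a := ⟪y₀, j (timeIntegral h.le ψ)⟫_ℝ) (b := ⟪F, backward h.le ψ⟫_ℝ)]

variable {Ω : Type*} [MeasurableSpace Ω] {P : Measure Ω} [IsProbabilityMeasure P]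

/-- Existence of measurable solutions `u(ω)` of the random evolution equations
`(j†j u)' + B(ω, t) u = F`, `u(t₀) = y₀`, written in integrated form. -/
theorem exists_random_evolution (h : t₀ < t₁) (j : V →L[ℝ] H) {B : Ω → ℝ → V →L[ℝ] V}
    {𝓑 : Ω → L2Time V t₀ t₁ →L[ℝ] L2Time V t₀ t₁}
    (hm : ∀ u, AEStronglyMeasurable (fun ω => 𝓑 ω u) P) {b α : Ω → ℝ} (hb : AEMeasurable b P)
    (hαm : AEMeasurable α P) {l : ℝ} (hl : 0 ≤ l)
    (h𝓑 : ∀ᵐ ω ∂P, ‖𝓑 ω‖ ≤ b ω ∧ 0 < α ω ∧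
      (∀ u, 𝓑 ω u =ᵐ[volume.restrict (Ioo t₀ t₁)] fun t => B ω t (u t)) ∧
      ∀ᵐ t ∂(volume.restrict (Ioo t₀ t₁)), ∀ v,
        α ω * ‖v‖ ^ 2 ≤ ⟪B ω t v, v⟫_ℝ + l * ‖j v‖ ^ 2)
    (y₀ : H) (F : L2Time V t₀ t₁) :
    ∃ u : Ω → L2Time V t₀ t₁, AEStronglyMeasurable u P ∧ ∀ᵐ ω ∂P,
      ∀ᵐ t ∂(volume.restrict (Ioo t₀ t₁)), j.adjoint (j (u ω t)) =
        j.adjoint y₀ + ∫ r in t₀..t, (F - 𝓑 ω (u ω)) r := by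
  let S : L2Time V t₀ t₁ →L[ℝ] L2Time V t₀ t₁ :=
    (j.adjoint.comp j).compLpL 2 (volume.restrict (Ioo t₀ t₁))
  let N : Ω → L2Time V t₀ t₁ →L[ℝ] L2Time V t₀ t₁ := fun ω => S + (volterra h.le).comp (𝓑 ω)
  let R := ‖(expMul t₀ t₁ hl : L2Time V t₀ t₁ →L[ℝ] L2Time V t₀ t₁)‖
  -- `C` collects the constants of the two bounds required by Lions' lemma, which `k4` and `k5` below
  -- derive from `le_inner_evolution`
  obtain ⟨u, hu, hu'⟩ := exists_random_solution (P := P) (N := N)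
    ((expMul t₀ t₁ hl).comp (backward h.le))
    (Lp.const 2 (volume.restrict (Ioo t₀ t₁)) (j.adjoint y₀) + volterra h.le F)
    (b := fun ω => ‖S‖ + ‖(volterra h.le : L2Time V t₀ t₁ →L[ℝ] L2Time V t₀ t₁)‖ * b ω)
    (C := fun ω => 1 + 4 * ‖y₀‖ ^ 2 + (R ^ 2 + 2 * ‖F‖ ^ 2) * (α ω)⁻¹)
    (fun x => aestronglyMeasurable_const.add
      ((volterra h.le).continuous.comp_aestronglyMeasurable (hm x)))
    ((hb.const_mul _).const_add _) ((hαm.inv.const_mul _).const_add _) (by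
      filter_upwards [h𝓑] with ω hω
      refine (norm_add_le _ _).trans (add_le_add le_rfl ?_)
      exact (ContinuousLinearMap.opNorm_comp_le _ _).trans
        (mul_le_mul_of_nonneg_left hω.1 (norm_nonneg _))) (by
      filter_upwards [h𝓑] with ω ⟨_, hα, hω, hc⟩
      have hi : 0 < (α ω)⁻¹ := inv_pos.2 hα
      refine ⟨le_add_of_le_of_nonneg (le_add_of_nonneg_right (by positivity)) (by positivity),
        fun ψ => ?_⟩
      have k1 := le_inner_evolution h j hω hα.le hl hc ψ
      have k2 := sq_inner_data_le h j y₀ F ψ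
      have k3 : ‖expMul t₀ t₁ hl (backward h.le ψ)‖ ^ 2 ≤ R ^ 2 * ‖backward h.le ψ‖ ^ 2 := by
        rw [← mul_pow]
        exact pow_le_pow_left₀ (norm_nonneg _) (ContinuousLinearMap.le_opNorm _ _) 2
      set q := ⟪ψ, N ω ((expMul t₀ t₁ hl).comp (backward h.le) ψ)⟫_ℝ with hq
      change ‖j (timeIntegral h.le ψ)‖ ^ 2 / 2 + α ω * ‖backward h.le ψ‖ ^ 2 ≤ q at k1
      have hA : 0 ≤ ‖j (timeIntegral h.le ψ)‖ ^ 2 := by positivity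
      have hΦ : 0 ≤ α ω * ‖backward h.le ψ‖ ^ 2 := by positivity
      have hq0 : 0 ≤ q := by linarith
      have k4 : ‖backward h.le ψ‖ ^ 2 ≤ (α ω)⁻¹ * q := by
        rw [inv_mul_eq_div, le_div_iff₀ hα]
        linarith
      have k5 : ‖j (timeIntegral h.le ψ)‖ ^ 2 ≤ 2 * q := by linarith
      constructor
      · refine k2.trans ?_
        calc _ ≤ 2 * ‖y₀‖ ^ 2 * (2 * q) + 2 * ‖F‖ ^ 2 * ((α ω)⁻¹ * q) := by gcongr
          _ ≤ (1 + R ^ 2 * (α ω)⁻¹) * q + (2 * ‖y₀‖ ^ 2 * (2 * q) +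
              2 * ‖F‖ ^ 2 * ((α ω)⁻¹ * q)) := le_add_of_nonneg_left (by positivity)
          _ = _ := by ring
      · refine k3.trans ?_
        calc _ ≤ R ^ 2 * ((α ω)⁻¹ * q) := by gcongr
          _ ≤ (1 + 4 * ‖y₀‖ ^ 2 + 2 * ‖F‖ ^ 2 * (α ω)⁻¹) * q + R ^ 2 * ((α ω)⁻¹ * q) :=
            le_add_of_nonneg_left (by positivity)
          _ = _ := by ring)
  refine ⟨u, hu, ?_⟩
  filter_upwards [hu'] with ω hω
  have e : S (u ω) = Lp.const 2 (volume.restrict (Ioo t₀ t₁)) (j.adjoint y₀) +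
      volterra h.le (F - 𝓑 ω (u ω)) := by
    have : S (u ω) + volterra h.le (𝓑 ω (u ω)) =
      Lp.const 2 (volume.restrict (Ioo t₀ t₁)) (j.adjoint y₀) + volterra h.le F := hω
    rw [map_sub, ← add_sub_assoc, ← this, add_sub_cancel_right]
  have e' : (S (u ω) : ℝ → V) =ᵐ[volume.restrict (Ioo t₀ t₁)] fun t => j.adjoint (j (u ω t)) :=
    (j.adjoint.comp j).coeFn_compLp (u ω)
  filter_upwards [e', Lp.coeFn_add (Lp.const 2 (volume.restrict (Ioo t₀ t₁)) (j.adjoint y₀))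
    (volterra h.le (F - 𝓑 ω (u ω))), coeFn_volterra h.le (F - 𝓑 ω (u ω)),
    Lp.coeFn_const (p := 2) (μ := volume.restrict (Ioo t₀ t₁)) (j.adjoint y₀)] with t h1 h2 h3 h4
  rw [← h1, e, h2, Pi.add_apply, h3, h4]
  rfl

end Coercive

/-! ### Estimates for deterministic evolution equations -/

/-- Gronwall's inequality in integral form. -/
theorem le_mul_exp_of_le_add_integral {t₀ : ℝ} {E : ℝ → ℝ} (hE : Continuous E) (h0 : ∀ t, 0 ≤ E t)
    {A L t₁ : ℝ} (hA : 0 ≤ A) (hL : 0 ≤ L)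
    (h : ∀ t ∈ Icc t₀ t₁, E t ≤ A + L * ∫ r in t₀..t, E r) {t : ℝ} (ht : t ∈ Icc t₀ t₁) :
    A + L * (∫ r in t₀..t, E r) ≤ A * Real.exp (L * (t - t₀)) := by
  let G : ℝ → ℝ := fun t => A + L * ∫ r in t₀..t, E r
  have hG : ∀ t, HasDerivAt G (L * E t) t := fun t =>
    ((intervalIntegral.integral_hasDerivAt_right (hE.intervalIntegrable _ _)
      hE.stronglyMeasurable.stronglyMeasurableAtFilter hE.continuousAt).const_mul L).const_add A
  have hG0 : ∀ t ∈ Icc t₀ t₁, 0 ≤ G t := fun t ht => (h0 t).trans (h t ht)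
  have key := norm_le_gronwallBound_of_norm_deriv_right_le (f := G) (f' := fun t => L * E t)
    (δ := A) (K := L) (ε := 0) (a := t₀) (b := t₁)
    (fun t _ => (hG t).continuousAt.continuousWithinAt) (fun t _ => (hG t).hasDerivWithinAt)
    (by simp [G, abs_of_nonneg hA]) (fun t ht => by
      have ht' := Ico_subset_Icc_self ht
      rw [Real.norm_of_nonneg (mul_nonneg hL (h0 t)), Real.norm_of_nonneg (hG0 t ht'), add_zero]
      exact mul_le_mul_of_nonneg_left (h t ht') hL) t ht
  rw [gronwallBound_ε0, Real.norm_of_nonneg (hG0 t ht)] at key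
  exact key

section Estimates

variable {V H : Type*} [NormedAddCommGroup V] [InnerProductSpace ℝ V] [CompleteSpace V]
  [NormedAddCommGroup H] [InnerProductSpace ℝ H] [CompleteSpace H] {t₀ t₁ : ℝ}

/-- `u` solves `(j†j u)' + 𝓑 u = j† F`, `u(t₀) = y₀`, in integrated form. Here `V` is identified
with its dual through the Riesz isomorphism, so that `j†j` stands for the embedding `V → V'`. -/
def IsIntegratedSolution (j : V →L[ℝ] H) (𝓑 : L2Time V t₀ t₁ →L[ℝ] L2Time V t₀ t₁) (y₀ : H)
    (F : L2Time H t₀ t₁) (u : L2Time V t₀ t₁) : Prop :=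
  ∀ᵐ t ∂(volume.restrict (Ioo t₀ t₁)),
    j.adjoint (j (u t)) = j.adjoint y₀ + ∫ r in t₀..t, (j.adjoint.compLp F - 𝓑 u) r

variable {j : V →L[ℝ] H} {𝓑 : L2Time V t₀ t₁ →L[ℝ] L2Time V t₀ t₁} {y₀ : H} {F : L2Time H t₀ t₁}
  {u : L2Time V t₀ t₁}

theorem inner_rhs_eq (j : V →L[ℝ] H) (𝓑 : L2Time V t₀ t₁ →L[ℝ] L2Time V t₀ t₁)
    (F : L2Time H t₀ t₁) (u : L2Time V t₀ t₁) :
    ∀ᵐ t ∂(volume.restrict (Ioo t₀ t₁)), ⟪(j.adjoint.compLp F - 𝓑 u) t, u t⟫_ℝ =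
      ⟪F t, j (u t)⟫_ℝ - ⟪𝓑 u t, u t⟫_ℝ := by
  filter_upwards [Lp.coeFn_sub (j.adjoint.compLp F) (𝓑 u), j.adjoint.coeFn_compLp F] with t h1 h2
  rw [h1, Pi.sub_apply, h2, inner_sub_left, ContinuousLinearMap.adjoint_inner_left]

/-- A solution has a continuous representative, which attains the initial value and satisfies the
energy identity. -/
theorem IsIntegratedSolution.exists_isContRep (h : t₀ < t₁) (hj : Function.Injective j.adjoint)
    (hu : IsIntegratedSolution j 𝓑 y₀ F u) : ∃ Y : C(Icc t₀ t₁, H),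
      IsContRep Y (fun t => j (u t)) ∧ Y ⟨t₀, left_mem_Icc.2 h.le⟩ = y₀ ∧
      ∀ t : Icc t₀ t₁, ‖Y t‖ ^ 2 =
        ‖y₀‖ ^ 2 + ∫ r in t₀..t, 2 * ⟪(j.adjoint.compLp F - 𝓑 u) r, u r⟫_ℝ := by
  obtain ⟨Y, hY⟩ := RandomParabolic.exists_isContRep h j u (j.adjoint.compLp F - 𝓑 u) hu
  have h0 : Y ⟨t₀, left_mem_Icc.2 h.le⟩ = y₀ := by
    have := (hY.norm_sq_eq h hu ⟨t₀, left_mem_Icc.2 h.le⟩).1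
    simp only [intervalIntegral.integral_same, add_zero] at this
    exact hj this
  exact ⟨Y, hY, h0, fun t => by rw [(hY.norm_sq_eq h hu t).2, h0]⟩

theorem norm_sq_eq_integral {α X : Type*} [MeasurableSpace α] {μ : Measure α}
    [NormedAddCommGroup X] [InnerProductSpace ℝ X] (v : Lp X 2 μ) :
    ‖v‖ ^ 2 = ∫ t, ‖v t‖ ^ 2 ∂μ := by
  rw [← real_inner_self_eq_norm_sq, L2.inner_def]
  simp only [real_inner_self_eq_norm_sq]

theorem integral_norm_sq_le {X : Type*} [NormedAddCommGroup X] [InnerProductSpace ℝ X]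
    (v : L2Time X t₀ t₁) {t : ℝ} (ht : t ∈ Icc t₀ t₁) : ∫ r in t₀..t, ‖v r‖ ^ 2 ≤ ‖v‖ ^ 2 := by
  rw [norm_sq_eq_integral, intervalIntegral.integral_of_le ht.1, integral_Ioc_eq_integral_Ioo]
  exact setIntegral_mono_set (integrable_norm_sq v) (Eventually.of_forall fun _ => sq_nonneg _)
    (Ioo_subset_Ioo_right ht.2).eventuallyLE

/-- The energy estimate: Gårding's inequality, `2 ⟨F, j u⟩ ≤ ‖F‖² + ‖j u‖²` and Gronwall's
inequality. -/
theorem IsIntegratedSolution.energy_le (h : t₀ < t₁) (hj : Function.Injective j.adjoint)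
    (hu : IsIntegratedSolution j 𝓑 y₀ F u) {α l : ℝ} (hα : 0 ≤ α) (hl : 0 ≤ l)
    (hB : ∀ᵐ t ∂(volume.restrict (Ioo t₀ t₁)),
      α * ‖u t‖ ^ 2 ≤ ⟪𝓑 u t, u t⟫_ℝ + l * ‖j (u t)‖ ^ 2) :
    (∀ᵐ t ∂(volume.restrict (Ioo t₀ t₁)), ‖j (u t)‖ ^ 2 ≤
      (‖y₀‖ ^ 2 + ‖F‖ ^ 2) * Real.exp ((2 * l + 1) * (t₁ - t₀))) ∧
    2 * α * ‖u‖ ^ 2 ≤ (‖y₀‖ ^ 2 + ‖F‖ ^ 2) * Real.exp ((2 * l + 1) * (t₁ - t₀)) := by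
  obtain ⟨Y, hY, -, hE⟩ := hu.exists_isContRep h hj
  let E : ℝ → ℝ := IccExtend h.le fun t => ‖Y t‖ ^ 2
  have hEc : Continuous E := (Y.continuous.norm.pow 2).Icc_extend'
  have hE0 : ∀ t, 0 ≤ E t := fun t => sq_nonneg _
  have hEt : ∀ t (ht : t ∈ Icc t₀ t₁), E t = ‖Y ⟨t, ht⟩‖ ^ 2 := fun t ht =>
    IccExtend_of_mem _ _ ht
  have hEu : ∀ᵐ t ∂(volume.restrict (Ioo t₀ t₁)), E t = ‖j (u t)‖ ^ 2 := by
    filter_upwards [hY, ae_restrict_mem measurableSet_Ioo] with t h1 ht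
    rw [hEt t (Ioo_subset_Icc_self ht), ← h1 (Ioo_subset_Icc_self ht)]
  set A := ‖y₀‖ ^ 2 + ‖F‖ ^ 2 with hA
  set L := 2 * l + 1 with hL
  have hA0 : 0 ≤ A := by positivity
  have hL0 : 0 ≤ L := by positivity
  have key : ∀ t ∈ Icc t₀ t₁, E t + 2 * α * (∫ r in t₀..t, ‖u r‖ ^ 2) ≤
      A + L * ∫ r in t₀..t, E r := by
    intro t ht
    have hs := left_mem_Icc.2 h.le
    have i1 := intervalIntegrable_of_integrableOn (integrable_norm_sq u) hs ht
    have i2 := intervalIntegrable_of_integrableOn (integrable_norm_sq F) hs ht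
    have i3 := hEc.intervalIntegrable (μ := volume) t₀ t
    have i4 := intervalIntegrable_of_integrableOn
      ((L2.integrable_inner (𝕜 := ℝ) (j.adjoint.compLp F - 𝓑 u) u).const_mul 2) hs ht
    have h1 : ∫ r in t₀..t, 2 * ⟪(j.adjoint.compLp F - 𝓑 u) r, u r⟫_ℝ ≤
        ∫ r in t₀..t, (‖F r‖ ^ 2 + L * E r - 2 * α * ‖u r‖ ^ 2) := by
      refine intervalIntegral.integral_mono_ae_restrict ht.1 i4
        ((i2.add (i3.const_mul L)).sub (i1.const_mul _)) ?_
      rw [← restrict_Ioo_eq_restrict_Icc]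
      have hsub : Ioo t₀ t ⊆ Ioo t₀ t₁ := Ioo_subset_Ioo_right ht.2
      filter_upwards [ae_restrict_of_ae_restrict_of_subset hsub (inner_rhs_eq j 𝓑 F u),
        ae_restrict_of_ae_restrict_of_subset hsub hB,
        ae_restrict_of_ae_restrict_of_subset hsub hEu] with r k1 k2 k3
      rw [k1, k3]
      have k4 := real_inner_le_norm (F r) (j (u r))
      nlinarith [sq_nonneg (‖F r‖ - ‖j (u r)‖)]
    have h2 : ∫ r in t₀..t, (‖F r‖ ^ 2 + L * E r - 2 * α * ‖u r‖ ^ 2) =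
        (∫ r in t₀..t, ‖F r‖ ^ 2) + L * (∫ r in t₀..t, E r) -
          2 * α * ∫ r in t₀..t, ‖u r‖ ^ 2 := by
      rw [intervalIntegral.integral_sub (i2.add (i3.const_mul L)) (i1.const_mul _),
        intervalIntegral.integral_add i2 (i3.const_mul L), intervalIntegral.integral_const_mul,
        intervalIntegral.integral_const_mul]
    have h3 := integral_norm_sq_le F ht
    rw [hEt t ht, hE ⟨t, ht⟩]
    change ‖y₀‖ ^ 2 + (∫ r in t₀..t, 2 * ⟪(j.adjoint.compLp F - 𝓑 u) r, u r⟫_ℝ) + _ ≤ _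
    linarith
  have hn : ∀ t ∈ Icc t₀ t₁, 0 ≤ ∫ r in t₀..t, ‖u r‖ ^ 2 := fun t ht =>
    intervalIntegral.integral_nonneg ht.1 fun _ _ => sq_nonneg _
  have hle : ∀ t ∈ Icc t₀ t₁, E t ≤ A + L * ∫ r in t₀..t, E r := fun t ht => by
    have := mul_nonneg (mul_nonneg zero_le_two hα) (hn t ht)
    linarith [key t ht]
  have hG : ∀ t ∈ Icc t₀ t₁, A + L * (∫ r in t₀..t, E r) ≤ A * Real.exp (L * (t₁ - t₀)) :=
    fun t ht => (le_mul_exp_of_le_add_integral hEc hE0 hA0 hL0 hle ht).trans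
      (mul_le_mul_of_nonneg_left (Real.exp_le_exp.2
        (mul_le_mul_of_nonneg_left (by linarith [ht.2]) hL0)) hA0)
  constructor
  · filter_upwards [hEu, ae_restrict_mem measurableSet_Ioo] with t h1 ht
    rw [← h1]
    exact (hle t (Ioo_subset_Icc_self ht)).trans (hG t (Ioo_subset_Icc_self ht))
  · have h1 := key t₁ (right_mem_Icc.2 h.le)
    rw [intervalIntegral.integral_of_le h.le, integral_Ioc_eq_integral_Ioo,
      ← norm_sq_eq_integral] at h1
    linarith [hE0 t₁, hG t₁ (right_mem_Icc.2 h.le)]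

/-- Solutions are unique: the energy estimate applies to the difference of two solutions. -/
theorem IsIntegratedSolution.eq (h : t₀ < t₁) (hj : Function.Injective j.adjoint)
    {v : L2Time V t₀ t₁} (hu : IsIntegratedSolution j 𝓑 y₀ F u)
    (hv : IsIntegratedSolution j 𝓑 y₀ F v) {α l : ℝ} (hα : 0 < α) (hl : 0 ≤ l)
    (hB : ∀ u : L2Time V t₀ t₁, ∀ᵐ t ∂(volume.restrict (Ioo t₀ t₁)),
      α * ‖u t‖ ^ 2 ≤ ⟪𝓑 u t, u t⟫_ℝ + l * ‖j (u t)‖ ^ 2) : u = v := by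
  have hd : IsIntegratedSolution j 𝓑 0 0 (u - v) := by
    filter_upwards [hu, hv, Lp.coeFn_sub u v, ae_restrict_mem measurableSet_Ioo] with t h1 h2 h3 ht
    have ht' := Ioo_subset_Icc_self ht
    have hs := left_mem_Icc.2 h.le
    have e : ∫ r in t₀..t, (j.adjoint.compLp (0 : L2Time H t₀ t₁) - 𝓑 (u - v)) r =
        (∫ r in t₀..t, (j.adjoint.compLp F - 𝓑 u) r) -
          ∫ r in t₀..t, (j.adjoint.compLp F - 𝓑 v) r := by
      rw [← intervalIntegral.integral_sub
        (intervalIntegrable_of_integrableOn (integrableOn_L2Time _) hs ht')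
        (intervalIntegrable_of_integrableOn (integrableOn_L2Time _) hs ht')]
      have e1 : j.adjoint.compLp (0 : L2Time H t₀ t₁) - 𝓑 (u - v) =
          (j.adjoint.compLp F - 𝓑 u) - (j.adjoint.compLp F - 𝓑 v) := by
        have : j.adjoint.compLp (0 : L2Time H t₀ t₁) = 0 :=
          map_zero (j.adjoint.compLpL 2 (volume.restrict (Ioo t₀ t₁)))
        rw [this, map_sub]
        abel
      rw [e1]
      exact primitive_congr (Lp.coeFn_sub _ _) ht'
    rw [e, h3, Pi.sub_apply, map_sub, map_sub, h1, h2, map_zero]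
    abel
  have h1 := (hd.energy_le h hj hα.le hl (hB _)).2
  simp only [norm_zero, ne_eq, OfNat.ofNat_ne_zero, not_false_eq_true, zero_pow, add_zero,
    zero_mul] at h1
  have h2 : ‖u - v‖ ^ 2 ≤ 0 := by
    by_contra! h3
    nlinarith [mul_pos hα h3]
  exact sub_eq_zero.1 (norm_eq_zero.1 (pow_eq_zero_iff two_ne_zero |>.1
    (le_antisymm h2 (sq_nonneg _))))

/-- The initial value is controlled by the solution: integrate the energy identity against
`(t₁ - t) / (t₁ - t₀)`. -/
theorem IsIntegratedSolution.sq_norm_initial_le (h : t₀ < t₁) (hj : Function.Injective j.adjoint)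
    (hu : IsIntegratedSolution j 𝓑 y₀ F u) {b : ℝ}
    (hB : ∀ᵐ t ∂(volume.restrict (Ioo t₀ t₁)), |⟪𝓑 u t, u t⟫_ℝ| ≤ b * ‖u t‖ ^ 2) :
    ‖y₀‖ ^ 2 ≤ ((1 / (t₁ - t₀) + 1) * ‖j‖ ^ 2 + 2 * b) * ‖u‖ ^ 2 + ‖F‖ ^ 2 := by
  obtain ⟨Y, hY, -, hE⟩ := hu.exists_isContRep h hj
  have hT : 0 < t₁ - t₀ := sub_pos.2 h
  have iw := (L2.integrable_inner (𝕜 := ℝ) (j.adjoint.compLp F - 𝓑 u) u).const_mul 2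
  let θ : ℝ → ℝ := fun t => (t₁ - t) / (t₁ - t₀)
  have hθ : ContDiff ℝ 1 θ := by fun_prop
  have hd : ∀ t, deriv θ t = -(1 / (t₁ - t₀)) := fun t => by
    have : HasDerivAt θ (-1 / (t₁ - t₀)) t :=
      ((hasDerivAt_id t).const_sub t₁).div_const _
    rw [this.deriv, neg_div]
  have key := integral_deriv_smul_of_eq_primitive h.le (g := fun t => ‖j (u t)‖ ^ 2)
    (c := ‖y₀‖ ^ 2) iw (by
      filter_upwards [hY, ae_restrict_mem measurableSet_Ioo] with t h1 ht
      have ht' := Ioo_subset_Icc_self ht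
      rw [h1 ht', hE ⟨t, ht'⟩]) hθ (by simp [θ])
  simp only [hd, smul_eq_mul] at key
  have hθ0 : θ t₀ = 1 := div_self hT.ne'
  rw [integral_const_mul, hθ0, one_mul] at key
  have ij : IntegrableOn (fun t => ‖j (u t)‖ ^ 2) (Ioo t₀ t₁) := by
    refine (integrable_norm_sq (j.compLp u)).congr ?_
    filter_upwards [j.coeFn_compLp u] with t ht
    rw [ht]
  have h1 : ∫ t in Ioo t₀ t₁, ‖j (u t)‖ ^ 2 ≤ ‖j‖ ^ 2 * ‖u‖ ^ 2 := by
    rw [norm_sq_eq_integral, ← integral_const_mul]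
    refine integral_mono ij ((integrable_norm_sq u).const_mul _) fun t => ?_
    change ‖j (u t)‖ ^ 2 ≤ ‖j‖ ^ 2 * ‖u t‖ ^ 2
    rw [← mul_pow]
    exact pow_le_pow_left₀ (norm_nonneg _) (j.le_opNorm _) 2
  have h2 : -∫ t in Ioo t₀ t₁, θ t * (2 * ⟪(j.adjoint.compLp F - 𝓑 u) t, u t⟫_ℝ) ≤
      ‖F‖ ^ 2 + (∫ t in Ioo t₀ t₁, ‖j (u t)‖ ^ 2) + 2 * b * ‖u‖ ^ 2 := by
    have iθ : IntegrableOn (fun t => θ t * (2 * ⟪(j.adjoint.compLp F - 𝓑 u) t, u t⟫_ℝ))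
        (Ioo t₀ t₁) := integrableOn_continuous_smul hθ.continuous iw
    have iF := integrable_norm_sq F
    have iu := (integrable_norm_sq u).const_mul (2 * b)
    have iFj : IntegrableOn (fun t => ‖F t‖ ^ 2 + ‖j (u t)‖ ^ 2) (Ioo t₀ t₁) := iF.add ij
    rw [norm_sq_eq_integral F, norm_sq_eq_integral u, ← integral_add iF ij, ← integral_const_mul,
      ← integral_add iFj iu, ← integral_neg]
    refine integral_mono_ae iθ.neg (iFj.add iu) ?_
    filter_upwards [inner_rhs_eq j 𝓑 F u, hB, ae_restrict_mem measurableSet_Ioo] with t k1 k2 ht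
    have k3 : 0 ≤ θ t := div_nonneg (by linarith [ht.2]) hT.le
    have k4 : θ t ≤ 1 := (div_le_one hT).2 (by linarith [ht.1])
    have k5 := abs_le.1 (abs_real_inner_le_norm (F t) (j (u t)))
    have k6 := abs_le.1 k2
    have k7 : -(2 * (⟪F t, j (u t)⟫_ℝ - ⟪𝓑 u t, u t⟫_ℝ)) ≤
        ‖F t‖ ^ 2 + ‖j (u t)‖ ^ 2 + 2 * b * ‖u t‖ ^ 2 := by
      nlinarith [sq_nonneg (‖F t‖ - ‖j (u t)‖), k5.1, k6.2]
    have k8 : 0 ≤ ‖F t‖ ^ 2 + ‖j (u t)‖ ^ 2 + 2 * b * ‖u t‖ ^ 2 := by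
      have := (abs_nonneg _).trans k2
      nlinarith [sq_nonneg ‖F t‖, sq_nonneg ‖j (u t)‖]
    change -(θ t * (2 * ⟪(j.adjoint.compLp F - 𝓑 u) t, u t⟫_ℝ)) ≤ _
    rw [k1]
    calc -(θ t * (2 * (⟪F t, j (u t)⟫_ℝ - ⟪𝓑 u t, u t⟫_ℝ)))
        = θ t * -(2 * (⟪F t, j (u t)⟫_ℝ - ⟪𝓑 u t, u t⟫_ℝ)) := by ring
      _ ≤ θ t * (‖F t‖ ^ 2 + ‖j (u t)‖ ^ 2 + 2 * b * ‖u t‖ ^ 2) :=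
        mul_le_mul_of_nonneg_left k7 k3
      _ ≤ _ := mul_le_of_le_one_left k8 k4
  have h3 : (1 / (t₁ - t₀) + 1) * ∫ t in Ioo t₀ t₁, ‖j (u t)‖ ^ 2 ≤
      (1 / (t₁ - t₀) + 1) * (‖j‖ ^ 2 * ‖u‖ ^ 2) :=
    mul_le_mul_of_nonneg_left h1 (by positivity)
  linarith

end Estimates

/-! ### Multiplication operators -/

section Multiplication

variable {α X : Type*} [MeasurableSpace α] [NormedAddCommGroup X] [InnerProductSpace ℝ X]
  {μ : Measure α} {κ : α → ℝ}

theorem memLp_top_of_abs_le {C : ℝ} (hm : AEStronglyMeasurable κ μ) (hC : ∀ᵐ x ∂μ, |κ x| ≤ C) :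
    MemLp κ ∞ μ :=
  memLp_top_of_bound hm C hC

theorem ae_abs_le_of_memLp_top (h : MemLp κ ∞ μ) :
    ∀ᵐ x ∂μ, |κ x| ≤ (eLpNorm κ ∞ μ).toReal := by
  filter_upwards [ae_le_eLpNormEssSup (f := κ) (μ := μ)] with x hx
  rw [← eLpNorm_exponent_top] at hx
  have := ENNReal.toReal_mono h.2.ne hx
  rwa [toReal_enorm, Real.norm_eq_abs] at this

open Classical in
/-- Multiplication by an essentially bounded function `κ`, with the junk value `0` for other
`κ`. -/
def mulOp (μ : Measure α) (X : Type*) [NormedAddCommGroup X] [InnerProductSpace ℝ X]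
    (κ : α → ℝ) : Lp X 2 μ →L[ℝ] Lp X 2 μ :=
  if h : MemLp κ ∞ μ then
    randomOp (fun x => κ x • ContinuousLinearMap.id ℝ X) (fun v => h.1.smul_const v)
      (eLpNorm κ ∞ μ).toReal (by
        filter_upwards [ae_abs_le_of_memLp_top h] with x hx
        rw [norm_smul]
        exact (mul_le_of_le_one_right (norm_nonneg _) ContinuousLinearMap.norm_id_le).trans hx)
  else 0

theorem coeFn_mulOp (h : MemLp κ ∞ μ) (u : Lp X 2 μ) :
    mulOp μ X κ u =ᵐ[μ] fun x => κ x • u x := by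
  rw [mulOp, dif_pos h]
  exact coeFn_randomOp u

theorem norm_mulOp_le {C : ℝ} (hm : AEStronglyMeasurable κ μ) (hC0 : 0 ≤ C)
    (hC : ∀ᵐ x ∂μ, |κ x| ≤ C) : ‖mulOp μ X κ‖ ≤ C := by
  refine ContinuousLinearMap.opNorm_le_bound _ hC0 fun u => Lp.norm_le_mul_norm_of_ae_le_mul ?_
  filter_upwards [coeFn_mulOp (memLp_top_of_abs_le hm hC) u, hC] with x h1 h2
  rw [h1, norm_smul]
  exact mul_le_mul_of_nonneg_right h2 (norm_nonneg _)

theorem inner_mulOp (h : MemLp κ ∞ μ) (u v : Lp X 2 μ) :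
    ⟪mulOp μ X κ u, v⟫_ℝ = ∫ x, κ x * ⟪u x, v x⟫_ℝ ∂μ := by
  rw [L2.inner_def]
  refine integral_congr_ae ?_
  filter_upwards [coeFn_mulOp h u] with x hx
  rw [hx, real_inner_smul_left]

theorem integrable_mul_inner (h : MemLp κ ∞ μ) (u v : Lp X 2 μ) :
    Integrable (fun x => κ x * ⟪u x, v x⟫_ℝ) μ := by
  refine (L2.integrable_inner (𝕜 := ℝ) (mulOp μ X κ u) v).congr ?_
  filter_upwards [coeFn_mulOp h u] with x hx
  rw [hx, real_inner_smul_left]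

theorem le_inner_mulOp {m : ℝ} (h : MemLp κ ∞ μ) (hm : ∀ᵐ x ∂μ, m ≤ κ x) (u : Lp X 2 μ) :
    m * ‖u‖ ^ 2 ≤ ⟪mulOp μ X κ u, u⟫_ℝ := by
  rw [inner_mulOp h, ← real_inner_self_eq_norm_sq, L2.inner_def, ← integral_const_mul]
  refine integral_mono_ae ((L2.integrable_inner u u).const_mul m) (integrable_mul_inner h u u) ?_
  filter_upwards [hm] with x hx
  exact mul_le_mul_of_nonneg_right hx real_inner_self_nonneg

theorem aestronglyMeasurable_mulOp {Ω : Type*} [MeasurableSpace Ω] {P : Measure Ω}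
    [IsFiniteMeasure P] [IsFiniteMeasure μ] {κ : Ω → α → ℝ}
    (hκ : AEStronglyMeasurable (Function.uncurry κ) (P.prod μ))
    (hκb : ∀ᵐ ω ∂P, MemLp (κ ω) ∞ μ) (u : Lp X 2 μ) :
    AEStronglyMeasurable (fun ω => mulOp μ X (κ ω) u) P := by
  refine aestronglyMeasurable_of_ae_eq_section (ν := μ) (z := fun p => κ p.1 p.2 • u p.2)
    (hκ.smul (Lp.aestronglyMeasurable u).comp_snd) ?_
  filter_upwards [hκb] with ω hω
  exact coeFn_mulOp hω u

theorem aestronglyMeasurable_compLp {X Z β : Type*} [NormedAddCommGroup X] [NormedSpace ℝ X]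
    [NormedAddCommGroup Z] [NormedSpace ℝ Z] [MeasurableSpace β] {ν : Measure β}
    {Ω : Type*} [MeasurableSpace Ω] {P : Measure Ω}
    [IsFiniteMeasure P] [IsFiniteMeasure ν] {A : Ω → X →L[ℝ] Z}
    (hA : ∀ x, AEStronglyMeasurable (fun ω => A ω x) P) (u : Lp X 2 ν) :
    AEStronglyMeasurable (fun ω => (A ω).compLp u) P := by
  refine aestronglyMeasurable_of_ae_eq_section (ν := ν) (z := fun p => A p.1 (u p.2)) ?_
    (Eventually.of_forall fun ω => (A ω).coeFn_compLp u)
  exact aestronglyMeasurable_apply (T := fun p : Ω × β => A p.1) (fun x => (hA x).comp_fst)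
    (Lp.aestronglyMeasurable u).comp_snd

end Multiplication

/-! ### The spatial operators -/

section Riesz

variable (V : Type*) [NormedAddCommGroup V] [InnerProductSpace ℝ V] [CompleteSpace V]

/-- The Riesz isomorphism of a real Hilbert space, as a linear (rather than conjugate-linear)
isometry. -/
def riesz : V ≃ₗᵢ[ℝ] StrongDual ℝ V where
  toFun := InnerProductSpace.toDual ℝ V
  map_add' := map_add _
  map_smul' c v := by simp
  invFun := (InnerProductSpace.toDual ℝ V).symm
  left_inv := (InnerProductSpace.toDual ℝ V).symm_apply_apply
  right_inv := (InnerProductSpace.toDual ℝ V).apply_symm_apply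
  norm_map' := (InnerProductSpace.toDual ℝ V).norm_map

variable {V}

theorem riesz_apply (u v : V) : riesz V u v = ⟪u, v⟫_ℝ := InnerProductSpace.toDual_apply_apply

theorem inner_riesz_symm (ℓ : StrongDual ℝ V) (v : V) : ⟪(riesz V).symm ℓ, v⟫_ℝ = ℓ v := by
  rw [← riesz_apply, LinearIsometryEquiv.apply_symm_apply]

end Riesz

section Spatial

variable {n : ℕ} (D : Set (E n))

/-- Under the Riesz isomorphism the embedding `V → V'` is `j†j`, with `j : V → H`. -/
theorem toDual_eq (u : H10 D) : toDual D u = riesz (H10 D) ((toL2 D).adjoint (toL2 D u)) := by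
  ext v
  rw [riesz_apply, ContinuousLinearMap.adjoint_inner_left]
  rfl

theorem norm_sq_H10 (u : H10 D) : ‖u‖ ^ 2 = ‖toL2 D u‖ ^ 2 + ‖grad D u‖ ^ 2 :=
  WithLp.prod_norm_sq_eq_of_L2 (H10.pair D u)

theorem norm_toL2_apply_le (u : H10 D) : ‖toL2 D u‖ ≤ ‖u‖ :=
  abs_le_of_sq_le_sq' (by rw [norm_sq_H10]; linarith [sq_nonneg ‖grad D u‖]) (norm_nonneg _) |>.2

theorem norm_grad_apply_le (u : H10 D) : ‖grad D u‖ ≤ ‖u‖ :=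
  abs_le_of_sq_le_sq' (by rw [norm_sq_H10]; linarith [sq_nonneg ‖toL2 D u‖]) (norm_nonneg _) |>.2

theorem norm_toL2_le : ‖toL2 D‖ ≤ 1 :=
  ContinuousLinearMap.opNorm_le_bound _ zero_le_one fun u => by
    rw [one_mul]; exact norm_toL2_apply_le D u

theorem norm_grad_le : ‖grad D‖ ≤ 1 :=
  ContinuousLinearMap.opNorm_le_bound _ zero_le_one fun u => by
    rw [one_mul]; exact norm_grad_apply_le D u

variable {D}

theorem IsTestFunction.exists_H10 {φ : E n → ℝ} (hφ : IsTestFunction D φ) :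
    ∃ u : H10 D, (toL2 D u : E n → ℝ) =ᵐ[volume.restrict D] φ := by
  have h1 : MemLp φ 2 (volume.restrict D) :=
    (hφ.1.continuous.memLp_of_hasCompactSupport hφ.2.1).restrict D
  have hg : gradient φ = fun x => (InnerProductSpace.toDual ℝ (E n)).symm (fderiv ℝ φ x) := rfl
  have h2 : MemLp (gradient φ) 2 (volume.restrict D) := by
    refine (Continuous.memLp_of_hasCompactSupport (p := 2) (μ := (volume : Measure (E n)))
      ?_ ?_).restrict D
    · rw [hg]
      exact (LinearIsometryEquiv.continuous _).comp (hφ.1.continuous_fderiv (by simp))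
    · rw [hg]
      exact (hφ.2.1.fderiv ℝ).comp_left (map_zero (InnerProductSpace.toDual ℝ (E n)).symm)
  let p : WithLp 2 (L2 D × L2Vec D) := WithLp.toLp 2 (h1.toLp φ, h2.toLp (gradient φ))
  have hp : p ∈ testGraph D := ⟨φ, hφ, h1.coeFn_toLp, h2.coeFn_toLp⟩
  exact ⟨(⟨p, subset_closure hp⟩ : ↥(testGraph D).topologicalClosure), h1.coeFn_toLp⟩

/-- `H¹₀(D)` is dense in `L²(D)`, in its dual form. -/
theorem injective_adjoint_toL2 (hD : IsOpen D) : Function.Injective (toL2 D).adjoint := by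
  rw [injective_iff_map_eq_zero]
  intro h hh
  have hloc : LocallyIntegrableOn (h : E n → ℝ) D volume :=
    locallyIntegrableOn_of_locallyIntegrable_restrict ((Lp.memLp h).locallyIntegrable one_le_two)
  have key := hD.ae_eq_zero_of_integral_contDiff_smul_eq_zero hloc (fun g hg hgc hgs => by
      obtain ⟨u, hu⟩ := IsTestFunction.exists_H10 (D := D) ⟨hg, hgc, hgs⟩
      have h1 : ⟪h, toL2 D u⟫_ℝ = 0 := by
        rw [← ContinuousLinearMap.adjoint_inner_left, hh, inner_zero_left]
      rw [L2.inner_def] at h1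
      rw [← setIntegral_eq_integral_of_forall_compl_eq_zero (s := D), ← h1]
      swap
      · intro x hx
        rw [image_eq_zero_of_notMem_tsupport fun hx' => hx (hgs hx'), zero_smul]
      refine integral_congr_ae ?_
      filter_upwards [hu] with x hx
      rw [hx]
      simp)
  ext1
  refine EventuallyEq.trans ?_ (Lp.coeFn_zero _ _ _).symm
  exact (ae_restrict_iff' hD.measurableSet).2 key

variable (D)

/-- The operator of the form `∫ κ ∇u · ∇v` on `V`. -/
def diffusionOp (κ : E n → ℝ) : H10 D →L[ℝ] H10 D :=
  (grad D).adjoint.comp ((mulOp (volume.restrict D) (E n) κ).comp (grad D))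

/-- The operator of the form `∫ b u v` on `V`. -/
def reactionOp (b : E n → ℝ) : H10 D →L[ℝ] H10 D :=
  (toL2 D).adjoint.comp ((mulOp (volume.restrict D) ℝ b).comp (toL2 D))

variable {D}

theorem inner_diffusionOp (κ : E n → ℝ) (u v : H10 D) :
    ⟪diffusionOp D κ u, v⟫_ℝ = ⟪mulOp (volume.restrict D) (E n) κ (grad D u), grad D v⟫_ℝ := by
  rw [diffusionOp, ContinuousLinearMap.comp_apply, ContinuousLinearMap.adjoint_inner_left,
    ContinuousLinearMap.comp_apply]

theorem inner_reactionOp (b : E n → ℝ) (u v : H10 D) :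
    ⟪reactionOp D b u, v⟫_ℝ = ⟪mulOp (volume.restrict D) ℝ b (toL2 D u), toL2 D v⟫_ℝ := by
  rw [reactionOp, ContinuousLinearMap.comp_apply, ContinuousLinearMap.adjoint_inner_left,
    ContinuousLinearMap.comp_apply]

theorem norm_conj_le {V Z : Type*} [NormedAddCommGroup V] [InnerProductSpace ℝ V] [CompleteSpace V]
    [NormedAddCommGroup Z] [InnerProductSpace ℝ Z] [CompleteSpace Z] (L : V →L[ℝ] Z)
    (hL : ‖L‖ ≤ 1) (M : Z →L[ℝ] Z) {C : ℝ} (hC : 0 ≤ C) (hM : ‖M‖ ≤ C) :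
    ‖L.adjoint.comp (M.comp L)‖ ≤ C := by
  refine (ContinuousLinearMap.opNorm_comp_le _ _).trans ?_
  rw [LinearIsometryEquiv.norm_map]
  calc ‖L‖ * ‖M.comp L‖ ≤ 1 * ‖M.comp L‖ := by gcongr
    _ ≤ ‖M‖ * ‖L‖ := by rw [one_mul]; exact ContinuousLinearMap.opNorm_comp_le _ _
    _ ≤ C * 1 := mul_le_mul hM hL (norm_nonneg _) hC
    _ = C := mul_one C

theorem norm_diffusionOp_le {κ : E n → ℝ} {C : ℝ}
    (hm : AEStronglyMeasurable κ (volume.restrict D)) (hC0 : 0 ≤ C)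
    (hC : ∀ᵐ x ∂(volume.restrict D), |κ x| ≤ C) : ‖diffusionOp D κ‖ ≤ C :=
  norm_conj_le _ (norm_grad_le D) _ hC0 (norm_mulOp_le hm hC0 hC)

theorem norm_reactionOp_le {b : E n → ℝ} {C : ℝ}
    (hm : AEStronglyMeasurable b (volume.restrict D)) (hC0 : 0 ≤ C)
    (hC : ∀ᵐ x ∂(volume.restrict D), |b x| ≤ C) : ‖reactionOp D b‖ ≤ C :=
  norm_conj_le _ (norm_toL2_le D) _ hC0 (norm_mulOp_le hm hC0 hC)

/-- Gårding's inequality. -/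
theorem le_inner_diffusion_add_reaction {κ b : E n → ℝ} {m C : ℝ}
    (hκ : MemLp κ ∞ (volume.restrict D)) (hm : ∀ᵐ x ∂(volume.restrict D), m ≤ κ x)
    (hb : AEStronglyMeasurable b (volume.restrict D))
    (hC : ∀ᵐ x ∂(volume.restrict D), |b x| ≤ C) (v : H10 D) :
    min m 1 * ‖v‖ ^ 2 ≤ ⟪diffusionOp D κ v + reactionOp D b v, v⟫_ℝ + (C + 1) * ‖toL2 D v‖ ^ 2 := by
  have h1 := le_inner_mulOp hκ hm (grad D v)
  have h2 : -C * ‖toL2 D v‖ ^ 2 ≤ ⟪mulOp (volume.restrict D) ℝ b (toL2 D v), toL2 D v⟫_ℝ :=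
    le_inner_mulOp (memLp_top_of_abs_le hb hC) (hC.mono fun x hx => neg_le_of_abs_le hx) _
  rw [inner_add_left, inner_diffusionOp, inner_reactionOp, norm_sq_H10]
  have h3 : min m 1 * ‖grad D v‖ ^ 2 ≤ m * ‖grad D v‖ ^ 2 :=
    mul_le_mul_of_nonneg_right (min_le_left _ _) (sq_nonneg _)
  have h4 : min m 1 * ‖toL2 D v‖ ^ 2 ≤ 1 * ‖toL2 D v‖ ^ 2 :=
    mul_le_mul_of_nonneg_right (min_le_right _ _) (sq_nonneg _)
  linarith

end Spatial

/-! ### The weak formulation -/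

section Weak

variable {n : ℕ} {D : Set (E n)} {t₀ t₁ : ℝ}

/-- `κ` is a diffusion coefficient on `D` with values in `[m, M]`, where `m > 0`. -/
structure IsDiffusion (D : Set (E n)) (κ : E n → ℝ) (m M : ℝ) : Prop where
  meas : AEStronglyMeasurable κ (volume.restrict D)
  pos : 0 < m
  bounds : ∀ᵐ x ∂(volume.restrict D), m ≤ κ x ∧ κ x ≤ M

/-- `a` is a reaction coefficient on `(t₀, t₁) × D` bounded by `C`. -/
structure IsReaction (D : Set (E n)) (t₀ t₁ : ℝ) (a : ℝ → E n → ℝ) (C : ℝ) : Prop where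
  meas : AEStronglyMeasurable (Function.uncurry a)
    ((volume.restrict (Ioo t₀ t₁)).prod (volume.restrict D))
  nonneg : 0 ≤ C
  bounds : ∀ᵐ t ∂(volume.restrict (Ioo t₀ t₁)),
    AEStronglyMeasurable (a t) (volume.restrict D) ∧ ∀ᵐ x ∂(volume.restrict D), |a t x| ≤ C

theorem IsDiffusion.abs_le {κ : E n → ℝ} {m M : ℝ} (h : IsDiffusion D κ m M) :
    ∀ᵐ x ∂(volume.restrict D), |κ x| ≤ |M| := by
  filter_upwards [h.bounds] with x hx
  rw [abs_of_pos (h.pos.trans_le hx.1)]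
  exact hx.2.trans (le_abs_self M)

theorem IsDiffusion.memLp {κ : E n → ℝ} {m M : ℝ} (h : IsDiffusion D κ m M) :
    MemLp κ ∞ (volume.restrict D) :=
  memLp_top_of_abs_le h.meas h.abs_le

theorem IsReaction.ae_memLp {a : ℝ → E n → ℝ} {C : ℝ} (h : IsReaction D t₀ t₁ a C) :
    ∀ᵐ t ∂(volume.restrict (Ioo t₀ t₁)), MemLp (a t) ∞ (volume.restrict D) :=
  h.bounds.mono fun _ ht => memLp_top_of_abs_le ht.1 ht.2

variable [IsFiniteMeasure ((volume : Measure (E n)).restrict D)] {a : ℝ → E n → ℝ} {C : ℝ}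
  {κ : E n → ℝ} {m M : ℝ}

/-- The reaction operator `u ↦ a u` on time-dependent functions. -/
def reactionTimeOp (ha : IsReaction D t₀ t₁ a C) :
    L2Time (H10 D) t₀ t₁ →L[ℝ] L2Time (H10 D) t₀ t₁ :=
  randomOp (fun t => reactionOp D (a t))
    (fun v => (toL2 D).adjoint.continuous.comp_aestronglyMeasurable
      (aestronglyMeasurable_mulOp ha.meas ha.ae_memLp (toL2 D v))) C
    (ha.bounds.mono fun _ ht => norm_reactionOp_le ht.1 ha.nonneg ht.2)

/-- The operator `u ↦ -∇ · (κ ∇u) + a u` on time-dependent functions. -/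
def evolutionOp (κ : E n → ℝ) (ha : IsReaction D t₀ t₁ a C) :
    L2Time (H10 D) t₀ t₁ →L[ℝ] L2Time (H10 D) t₀ t₁ :=
  (diffusionOp D κ).compLpL 2 (volume.restrict (Ioo t₀ t₁)) + reactionTimeOp ha

theorem coeFn_reactionTimeOp (ha : IsReaction D t₀ t₁ a C) (u : L2Time (H10 D) t₀ t₁) :
    reactionTimeOp ha u =ᵐ[volume.restrict (Ioo t₀ t₁)] fun t => reactionOp D (a t) (u t) :=
  coeFn_randomOp u

theorem evolutionOp_apply (κ : E n → ℝ) (ha : IsReaction D t₀ t₁ a C)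
    (u : L2Time (H10 D) t₀ t₁) :
    evolutionOp κ ha u = (diffusionOp D κ).compLp u + reactionTimeOp ha u := rfl

theorem coeFn_evolutionOp (κ : E n → ℝ) (ha : IsReaction D t₀ t₁ a C)
    (u : L2Time (H10 D) t₀ t₁) :
    evolutionOp κ ha u =ᵐ[volume.restrict (Ioo t₀ t₁)]
      fun t => (diffusionOp D κ + reactionOp D (a t)) (u t) := by
  rw [evolutionOp_apply]
  filter_upwards [Lp.coeFn_add ((diffusionOp D κ).compLp u) (reactionTimeOp ha u),
    (diffusionOp D κ).coeFn_compLp u, coeFn_reactionTimeOp ha u] with t h1 h2 h3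
  rw [h1, Pi.add_apply, h2, h3, add_apply]

theorem norm_diffusion_add_reaction_le (hκ : IsDiffusion D κ m M) (ha : IsReaction D t₀ t₁ a C) :
    ∀ᵐ t ∂(volume.restrict (Ioo t₀ t₁)), ‖diffusionOp D κ + reactionOp D (a t)‖ ≤ |M| + C := by
  filter_upwards [ha.bounds] with t ht
  exact (norm_add_le _ _).trans (add_le_add (norm_diffusionOp_le hκ.meas (abs_nonneg M) hκ.abs_le)
    (norm_reactionOp_le ht.1 ha.nonneg ht.2))

theorem norm_evolutionOp_le (hκ : IsDiffusion D κ m M) (ha : IsReaction D t₀ t₁ a C) :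
    ‖evolutionOp κ ha‖ ≤ |M| + C := by
  refine ContinuousLinearMap.opNorm_le_bound _ (add_nonneg (abs_nonneg M) ha.nonneg) fun u =>
    Lp.norm_le_mul_norm_of_ae_le_mul ?_
  filter_upwards [coeFn_evolutionOp κ ha u, norm_diffusion_add_reaction_le hκ ha] with t h1 h2
  rw [h1]
  exact ContinuousLinearMap.le_of_opNorm_le _ h2 _

theorem abs_inner_evolutionOp_le (hκ : IsDiffusion D κ m M) (ha : IsReaction D t₀ t₁ a C)
    (u : L2Time (H10 D) t₀ t₁) : ∀ᵐ t ∂(volume.restrict (Ioo t₀ t₁)),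
      |⟪evolutionOp κ ha u t, u t⟫_ℝ| ≤ (|M| + C) * ‖u t‖ ^ 2 := by
  filter_upwards [coeFn_evolutionOp κ ha u, norm_diffusion_add_reaction_le hκ ha] with t h1 h2
  rw [h1, sq, ← mul_assoc]
  exact (abs_real_inner_le_norm _ _).trans (mul_le_mul_of_nonneg_right
    (ContinuousLinearMap.le_of_opNorm_le _ h2 _) (norm_nonneg _))

theorem le_inner_diffusion_add_reaction_ae (hκ : IsDiffusion D κ m M)
    (ha : IsReaction D t₀ t₁ a C) : ∀ᵐ t ∂(volume.restrict (Ioo t₀ t₁)), ∀ v,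
      min m 1 * ‖v‖ ^ 2 ≤ ⟪(diffusionOp D κ + reactionOp D (a t)) v, v⟫_ℝ +
        (C + 1) * ‖toL2 D v‖ ^ 2 := by
  filter_upwards [ha.bounds] with t ht v
  exact le_inner_diffusion_add_reaction hκ.memLp (hκ.bounds.mono fun _ hx => hx.1) ht.1 ht.2 v

theorem le_inner_evolutionOp (hκ : IsDiffusion D κ m M) (ha : IsReaction D t₀ t₁ a C)
    (u : L2Time (H10 D) t₀ t₁) : ∀ᵐ t ∂(volume.restrict (Ioo t₀ t₁)),
      min m 1 * ‖u t‖ ^ 2 ≤ ⟪evolutionOp κ ha u t, u t⟫_ℝ + (C + 1) * ‖toL2 D (u t)‖ ^ 2 := by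
  filter_upwards [coeFn_evolutionOp κ ha u, le_inner_diffusion_add_reaction_ae hκ ha] with t h1 h2
  rw [h1]
  exact h2 _

theorem aestronglyMeasurable_evolutionOp {Ω : Type*} [MeasurableSpace Ω] {P : Measure Ω}
    [IsFiniteMeasure P] {ν : Ω → E n → ℝ}
    (hν : AEStronglyMeasurable (Function.uncurry ν) (P.prod (volume.restrict D)))
    (hνb : ∀ᵐ ω ∂P, MemLp (ν ω) ∞ (volume.restrict D)) (ha : IsReaction D t₀ t₁ a C)
    (u : L2Time (H10 D) t₀ t₁) : AEStronglyMeasurable (fun ω => evolutionOp (ν ω) ha u) P := by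
  refine AEStronglyMeasurable.add ?_ aestronglyMeasurable_const
  exact aestronglyMeasurable_compLp (A := fun ω => diffusionOp D (ν ω))
    (fun v => (grad D).adjoint.continuous.comp_aestronglyMeasurable
      (aestronglyMeasurable_mulOp hν hνb (grad D v))) u

/-- The Riesz isomorphism `V → V'` as a bounded operator. -/
abbrev rieszL (D : Set (E n)) : H10 D →L[ℝ] Hm1 D :=
  ((riesz (H10 D)).toContinuousLinearEquiv : H10 D →L[ℝ] Hm1 D)

/-- The inverse `V' → V` of the Riesz isomorphism as a bounded operator. -/
abbrev rieszSymmL (D : Set (E n)) : Hm1 D →L[ℝ] H10 D :=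
  ((riesz (H10 D)).symm.toContinuousLinearEquiv : Hm1 D →L[ℝ] H10 D)

theorem rieszL_apply (u : H10 D) : rieszL D u = riesz (H10 D) u := rfl

theorem rieszSymmL_apply (ℓ : Hm1 D) : rieszSymmL D ℓ = (riesz (H10 D)).symm ℓ := rfl

theorem rieszSymmL_toDual (u : H10 D) :
    rieszSymmL D (toDual D u) = (toL2 D).adjoint (toL2 D u) := by
  rw [toDual_eq, rieszSymmL_apply, LinearIsometryEquiv.symm_apply_apply]

theorem rieszSymmL_compLp_eq_iff {v : L2Time (H10 D) t₀ t₁} {w : L2Time (Hm1 D) t₀ t₁} :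
    (rieszSymmL D).compLp w = v ↔ w = (rieszL D).compLp v := by
  constructor
  · rintro rfl
    ext1
    filter_upwards [(rieszL D).coeFn_compLp ((rieszSymmL D).compLp w),
      (rieszSymmL D).coeFn_compLp w] with t h1 h2
    rw [h1, h2, rieszL_apply, rieszSymmL_apply, LinearIsometryEquiv.apply_symm_apply]
  · rintro rfl
    ext1
    filter_upwards [(rieszSymmL D).coeFn_compLp ((rieszL D).compLp v),
      (rieszL D).coeFn_compLp v] with t h1 h2
    rw [h1, h2, rieszL_apply, rieszSymmL_apply, LinearIsometryEquiv.symm_apply_apply]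

theorem norm_rieszL_compLp {α : Type*} [MeasurableSpace α] {μ : Measure α}
    (v : Lp (H10 D) 2 μ) : ‖(rieszL D).compLp v‖ = ‖v‖ := by
  refine le_antisymm (Lp.norm_le_norm_of_ae_le ?_) (Lp.norm_le_norm_of_ae_le ?_) <;>
  · filter_upwards [(rieszL D).coeFn_compLp v] with t h1
    rw [h1, rieszL_apply, LinearIsometryEquiv.norm_map]

/-- Testing the equation with `φ` amounts to pairing with `φ` in `L²(V)`. -/
theorem weakForm_eq_inner (hκ : MemLp κ ∞ (volume.restrict D)) (ha : IsReaction D t₀ t₁ a C)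
    (u : L2Time (H10 D) t₀ t₁) (w : L2Time (Hm1 D) t₀ t₁) (φ : L2Time (H10 D) t₀ t₁) :
    (∫ t in Ioo t₀ t₁, (w t) (φ t))
      + (∫ t in Ioo t₀ t₁, ∫ x in D, κ x * inner ℝ (grad D (u t) x) (grad D (φ t) x))
      + (∫ t in Ioo t₀ t₁, ∫ x in D, a t x * toL2 D (u t) x * toL2 D (φ t) x)
      = ⟪(rieszSymmL D).compLp w + evolutionOp κ ha u, φ⟫_ℝ := by
  rw [evolutionOp_apply, inner_add_left, inner_add_left, ← add_assoc]
  congr 1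
  · congr 1
    · rw [L2.inner_def]
      refine integral_congr_ae ?_
      filter_upwards [(rieszSymmL D).coeFn_compLp w] with t ht
      rw [ht, rieszSymmL_apply, inner_riesz_symm]
    · rw [L2.inner_def]
      refine integral_congr_ae ?_
      filter_upwards [(diffusionOp D κ).coeFn_compLp u] with t ht
      rw [ht, inner_diffusionOp, inner_mulOp hκ]
  · rw [L2.inner_def]
    refine integral_congr_ae ?_
    filter_upwards [coeFn_reactionTimeOp ha u, ha.ae_memLp] with t ht hat
    rw [ht, inner_reactionOp, inner_mulOp hat]
    refine integral_congr_ae (Eventually.of_forall fun x => ?_)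
    simp only [RCLike.inner_apply, conj_trivial]
    ring

theorem integral_inner_data_eq (f : L2Time (L2 D) t₀ t₁) (φ : L2Time (H10 D) t₀ t₁) :
    ∫ t in Ioo t₀ t₁, inner ℝ (f t) (toL2 D (φ t)) = ⟪(toL2 D).adjoint.compLp f, φ⟫_ℝ := by
  rw [L2.inner_def]
  refine integral_congr_ae ?_
  filter_upwards [(toL2 D).adjoint.coeFn_compLp f] with t ht
  rw [ht, ContinuousLinearMap.adjoint_inner_left]

/-- If `S u` is a primitive of `w`, then `R w` is the weak time derivative of `u`, regarded as a
function with values in the larger space through `R S`. -/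
theorem isTimeDeriv_of_eq_primitive {X Z Z' : Type*} [NormedAddCommGroup X] [NormedSpace ℝ X]
    [NormedAddCommGroup Z] [NormedSpace ℝ Z] [CompleteSpace Z] [NormedAddCommGroup Z']
    [NormedSpace ℝ Z'] [CompleteSpace Z'] (h : t₀ ≤ t₁) (S : X →L[ℝ] Z) (R : Z →L[ℝ] Z')
    {u : L2Time X t₀ t₁} {w : L2Time Z t₀ t₁} {c : Z}
    (hu : ∀ᵐ t ∂(volume.restrict (Ioo t₀ t₁)), S (u t) = c + ∫ r in t₀..t, w r) :
    IsTimeDeriv (R.comp S) t₀ t₁ u (R.compLp w) := by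
  intro θ hθ
  have h0 : ∀ t, t ∉ Ioo t₀ t₁ → θ t = 0 := fun t ht =>
    image_eq_zero_of_notMem_tsupport fun hx => ht (hθ.2.2 hx)
  have key := integral_deriv_smul_of_eq_primitive h (integrableOn_L2Time w) hu
    (hθ.1.of_le (by exact_mod_cast le_top)) (h0 t₁ (fun ht => ht.2.false))
  rw [h0 t₀ (fun ht => ht.1.false), zero_smul, neg_zero, zero_sub] at key
  have hd : Continuous (deriv θ) := hθ.1.continuous_deriv (by simp)
  have e1 : ∫ t in Ioo t₀ t₁, deriv θ t • R.comp S (u t) =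
      R (∫ t in Ioo t₀ t₁, deriv θ t • S (u t)) := by
    rw [← ContinuousLinearMap.integral_comp_comm]
    · refine integral_congr_ae (Eventually.of_forall fun t => ?_)
      simp only [map_smul, ContinuousLinearMap.comp_apply]
    · exact integrableOn_continuous_smul hd (S.integrable_comp (integrableOn_L2Time u))
  rw [e1, key, map_neg, ← ContinuousLinearMap.integral_comp_comm _
    (integrableOn_continuous_smul hθ.1.continuous (integrableOn_L2Time w))]
  congr 1
  refine integral_congr_ae ?_
  filter_upwards [R.coeFn_compLp w] with t ht
  rw [ht, map_smul]

theorem toDual_eq_comp :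
    toDual D = (rieszL D).comp ((toL2 D).adjoint.comp (toL2 D)) :=
  ContinuousLinearMap.ext fun u => toDual_eq D u

theorem IsIntegratedSolution.isTimeDeriv (h : t₀ ≤ t₁)
    {𝓑 : L2Time (H10 D) t₀ t₁ →L[ℝ] L2Time (H10 D) t₀ t₁} {y₀ : L2 D} {F : L2Time (L2 D) t₀ t₁}
    {u : L2Time (H10 D) t₀ t₁} (hu : IsIntegratedSolution (toL2 D) 𝓑 y₀ F u) :
    IsTimeDeriv (toDual D) t₀ t₁ u
      ((rieszL D).compLp ((toL2 D).adjoint.compLp F - 𝓑 u)) := by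
  rw [toDual_eq_comp]
  exact isTimeDeriv_of_eq_primitive h ((toL2 D).adjoint.comp (toL2 D)) (rieszL D) hu

/-- Weak solutions are the solutions of the integrated equation. -/
theorem isWeakSolution_iff (hD : IsOpen D) {T : ℝ} (hT : 0 < T)
    (hκ : MemLp κ ∞ (volume.restrict D)) (ha : IsReaction D t₀ (t₀ + T) a C) {y₀ : L2 D}
    {f : L2Time (L2 D) t₀ (t₀ + T)} {w : W D t₀ (t₀ + T)} :
    IsWeakSolution D κ a t₀ T y₀ f w ↔
      IsIntegratedSolution (toL2 D) (evolutionOp κ ha) y₀ f w.val ∧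
      w.dt = (rieszL D).compLp ((toL2 D).adjoint.compLp f - evolutionOp κ ha w.val) := by
  have h : t₀ < t₀ + T := by linarith
  have hj := injective_adjoint_toL2 hD
  have hw : (∀ φ : L2Time (H10 D) t₀ (t₀ + T),
      (∫ t in Ioo t₀ (t₀ + T), (w.dt t) (φ t))
      + (∫ t in Ioo t₀ (t₀ + T), ∫ x in D, κ x * inner ℝ (grad D (w.val t) x) (grad D (φ t) x))
      + (∫ t in Ioo t₀ (t₀ + T), ∫ x in D, a t x * toL2 D (w.val t) x * toL2 D (φ t) x)
      = ∫ t in Ioo t₀ (t₀ + T), inner ℝ (f t) (toL2 D (φ t))) ↔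
      w.dt = (rieszL D).compLp ((toL2 D).adjoint.compLp f - evolutionOp κ ha w.val) := by
    rw [← rieszSymmL_compLp_eq_iff, eq_sub_iff_add_eq]
    simp only [weakForm_eq_inner hκ ha, integral_inner_data_eq]
    exact ⟨fun hφ => ext_inner_right ℝ hφ, fun hφ φ => by rw [hφ]⟩
  rw [IsWeakSolution, hw, and_comm (a := IsIntegratedSolution _ _ _ _ _)]
  refine and_congr_right fun hdt => ⟨?_, fun hu => ?_⟩
  · -- the integration constant is identified by the value of `Y` at `t₀`
    rintro ⟨Y, hY, hY0⟩
    set w' := (toL2 D).adjoint.compLp f - evolutionOp κ ha w.val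
    obtain ⟨c, hc⟩ := ae_eq_add_primitive h
      (g := fun t => (toL2 D).adjoint (toL2 D (w.val t))) (w := w')
      (((toL2 D).adjoint.comp (toL2 D)).integrable_comp (integrableOn_L2Time w.val))
      (integrableOn_L2Time w') (fun θ hθ => by
        have k := congrArg (rieszSymmL D) (w.isTimeDeriv θ hθ)
        have hd : Continuous (deriv θ) := hθ.1.continuous_deriv (by simp)
        rw [map_neg, ← ContinuousLinearMap.integral_comp_comm _
          (integrableOn_continuous_smul hθ.1.continuous (integrableOn_L2Time w.dt)),
          ← ContinuousLinearMap.integral_comp_comm _ (integrableOn_continuous_smul hd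
            ((toDual D).integrable_comp (integrableOn_L2Time w.val)))] at k
        simp only [map_smul, rieszSymmL_toDual] at k
        rw [k]
        congr 1
        refine integral_congr_ae ?_
        filter_upwards [(rieszSymmL D).coeFn_compLp w.dt] with t ht
        rw [← rieszSymmL_compLp_eq_iff.2 hdt, ht])
    have h0 := (hY.norm_sq_eq h hc ⟨t₀, left_mem_Icc.2 h.le⟩).1
    rw [intervalIntegral.integral_same, add_zero, hY0] at h0
    rw [← h0] at hc
    exact hc
  · obtain ⟨Y, hY, hY0, -⟩ := hu.exists_isContRep h hj
    exact ⟨Y, hY, fun _ => hY0⟩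

end Weak

/-! ### Random functions of time -/

section Swap

variable {Ω X Z : Type*} [MeasurableSpace Ω] {P : Measure Ω} [IsProbabilityMeasure P]
  [NormedAddCommGroup X] [InnerProductSpace ℝ X] [CompleteSpace X]
  [NormedAddCommGroup Z] [InnerProductSpace ℝ Z] [CompleteSpace Z] {t₀ t₁ : ℝ}

/-- `v ∈ L²((t₀, t₁); L²(Ω; X))` and the random function `u(ω) ∈ L²((t₀, t₁); X)` have a common
jointly measurable version. -/
def IsSwap (v : L2Time (Lp X 2 P) t₀ t₁) (u : Ω → L2Time X t₀ t₁) : Prop :=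
  ∃ z : Ω → ℝ → X,
    AEStronglyMeasurable (Function.uncurry z) (P.prod (volume.restrict (Ioo t₀ t₁))) ∧
    (∀ᵐ t ∂(volume.restrict (Ioo t₀ t₁)), (v t : Ω → X) =ᵐ[P] fun ω => z ω t) ∧
    (∀ᵐ ω ∂P, (u ω : ℝ → X) =ᵐ[volume.restrict (Ioo t₀ t₁)] z ω)

/-- The order of the variables can be exchanged, with the same norm. -/
theorem exists_isSwap {u : Ω → L2Time X t₀ t₁} (hu : MemLp u 2 P) :
    ∃ v : L2Time (Lp X 2 P) t₀ t₁, IsSwap v u ∧ ‖v‖ ^ 2 = ∫ ω, ‖u ω‖ ^ 2 ∂P := by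
  obtain ⟨z, hz, huz⟩ := exists_joint_version (hu.toLp u)
  obtain ⟨v, hv, hvn⟩ := exists_swapped hz (hu.toLp u) huz
  refine ⟨v, ⟨fun ω t => z (ω, t), hz.1, hv, ?_⟩, ?_⟩
  · filter_upwards [huz, hu.coeFn_toLp] with ω h1 h2
    rwa [h2] at h1
  · rw [hvn, norm_sq_eq_integral]
    refine integral_congr_ae ?_
    filter_upwards [hu.coeFn_toLp] with ω hω
    rw [hω]

/-- The joint version of an element of `L²((t₀, t₁); L²(Ω; X))` is jointly square-integrable. -/
theorem memLp_of_ae_eq_section {v : L2Time (Lp X 2 P) t₀ t₁} {z : Ω → ℝ → X}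
    (hz : AEStronglyMeasurable (Function.uncurry z) (P.prod (volume.restrict (Ioo t₀ t₁))))
    (hv : ∀ᵐ t ∂(volume.restrict (Ioo t₀ t₁)), (v t : Ω → X) =ᵐ[P] fun ω => z ω t) :
    MemLp (Function.uncurry z) 2 (P.prod (volume.restrict (Ioo t₀ t₁))) := by
  have h1 : AEStronglyMeasurable (fun p : ℝ × Ω => z p.2 p.1)
      ((volume.restrict (Ioo t₀ t₁)).prod P) :=
    hz.comp_measurePreserving Measure.measurePreserving_swap
  have h2 : MemLp (fun p : ℝ × Ω => z p.2 p.1) 2 ((volume.restrict (Ioo t₀ t₁)).prod P) := by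
    refine ⟨h1, ?_⟩
    rw [← eLpNorm_of_ae_eq_section h1 hv]
    exact (Lp.memLp v).2
  exact h2.comp_measurePreserving Measure.measurePreserving_swap

/-- A random function has at most one counterpart, whichever joint versions are used. -/
theorem IsSwap.eq {v v' : L2Time (Lp X 2 P) t₀ t₁} {u : Ω → L2Time X t₀ t₁} (h : IsSwap v u)
    (h' : IsSwap v' u) : v = v' := by
  obtain ⟨z, hz, hv, hu⟩ := h
  obtain ⟨z', hz', hv', hu'⟩ := h'
  have hd : AEStronglyMeasurable (fun p : Ω × ℝ => z p.1 p.2 - z' p.1 p.2)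
    (P.prod (volume.restrict (Ioo t₀ t₁))) := hz.sub hz'
  have h1 := eLpNorm_of_ae_eq_section (U := fun _ => 0) hd (by
    filter_upwards [hu, hu'] with ω k1 k2
    filter_upwards [k1, k2, Lp.coeFn_zero X 2 (volume.restrict (Ioo t₀ t₁))] with t l1 l2 l3
    rw [l3, ← l1, ← l2, sub_self]
    rfl)
  rw [eLpNorm_zero', eq_comm, eLpNorm_eq_zero_iff hd two_ne_zero] at h1
  have h2 : ∀ᵐ p ∂((volume.restrict (Ioo t₀ t₁)).prod P), z p.2 p.1 - z' p.2 p.1 = 0 :=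
    (Measure.measurePreserving_swap (μ := volume.restrict (Ioo t₀ t₁)) (ν := P)).quasiMeasurePreserving.ae h1
  ext1
  filter_upwards [hv, hv', Measure.ae_ae_of_ae_prod h2] with t k1 k2 k3
  ext1
  filter_upwards [k1, k2, k3] with ω l1 l2 l3
  rw [l1, l2]
  exact sub_eq_zero.1 l3

/-- Weighted time integrals of a counterpart can be computed for each `ω` separately. -/
theorem IsSwap.integral_smul {v : L2Time (Lp X 2 P) t₀ t₁} {u : Ω → L2Time X t₀ t₁}
    (h : IsSwap v u) (L : X →L[ℝ] Z) {θ : ℝ → ℝ} (hθ : Continuous θ) :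
    (∫ t in Ioo t₀ t₁, θ t • L.compLpL 2 P (v t) : Lp Z 2 P) =ᵐ[P]
      fun ω => ∫ t in Ioo t₀ t₁, θ t • L (u ω t) := by
  obtain ⟨z, hz, hv, hu⟩ := h
  have hLz : Integrable (fun p : Ω × ℝ => L (z p.1 p.2))
      (P.prod (volume.restrict (Ioo t₀ t₁))) :=
    (L.comp_memLp' (memLp_of_ae_eq_section hz hv)).integrable one_le_two
  obtain ⟨C, hC⟩ := isCompact_Icc.exists_bound_of_continuousOn (s := Icc t₀ t₁) hθ.continuousOn
  have hi : Integrable (fun p : Ω × ℝ => θ p.2 • L (z p.1 p.2))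
      (P.prod (volume.restrict (Ioo t₀ t₁))) := by
    refine hLz.bdd_smul C hθ.aestronglyMeasurable.comp_snd ?_
    filter_upwards [Measure.quasiMeasurePreserving_snd.ae (ae_restrict_mem measurableSet_Ioo)]
      with p hp
    exact hC _ (Ioo_subset_Icc_self hp)
  have key := integral_ae_eq_integral_section (μ := P) (ν := volume.restrict (Ioo t₀ t₁))
    (F := fun t => θ t • L.compLpL 2 P (v t)) (integrableOn_continuous_smul hθ
      ((L.compLpL 2 P).integrable_comp (integrableOn_L2Time v))) hi (by
    filter_upwards [hv] with t ht
    filter_upwards [ht, Lp.coeFn_smul (θ t) (L.compLpL 2 P (v t)), L.coeFn_compLpL (v t)]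
      with ω h1 h2 h3
    rw [h2, Pi.smul_apply, h3, h1])
  filter_upwards [key, hu] with ω h1 h2
  rw [h1]
  refine integral_congr_ae ?_
  filter_upwards [h2] with t ht
  rw [ht]

/-- A bound that is uniform in `ω` and `t` carries over to the `L²(Ω)`-norm, because `Ω` has measure
one. -/
theorem IsSwap.norm_le {v : L2Time (Lp X 2 P) t₀ t₁} {u : Ω → L2Time X t₀ t₁}
    (h : IsSwap v u) (L : X →L[ℝ] Z) {B : ℝ} (hB0 : 0 ≤ B)
    (hB : ∀ᵐ ω ∂P, ∀ᵐ t ∂(volume.restrict (Ioo t₀ t₁)), ‖L (u ω t)‖ ≤ B) :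
    ∀ᵐ t ∂(volume.restrict (Ioo t₀ t₁)), ‖L.compLpL 2 P (v t)‖ ≤ B := by
  -- the almost everywhere quantifiers in `ω` and `t` commute for a measurable version `z'`
  obtain ⟨z, ⟨z', hz', hzz'⟩, hv, hu⟩ := h
  have hm : MeasurableSet {p : Ω × ℝ | ‖L (z' (p.1, p.2))‖ ≤ B} :=
    measurableSet_le (L.continuous.comp_stronglyMeasurable hz').norm.measurable measurable_const
  have h1 : ∀ᵐ ω ∂P, ∀ᵐ t ∂(volume.restrict (Ioo t₀ t₁)), ‖L (z' (ω, t))‖ ≤ B := by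
    filter_upwards [hB, hu, Measure.ae_ae_of_ae_prod hzz'] with ω k1 k2 k3
    filter_upwards [k1, k2, k3] with t l1 l2 l3
    rw [← l3]
    change ‖L (z ω t)‖ ≤ B
    rwa [← l2]
  have h2 := (Measure.ae_ae_comm (p := fun ω t => ‖L (z' (ω, t))‖ ≤ B) hm).1 h1
  have h3 : ∀ᵐ p ∂((volume.restrict (Ioo t₀ t₁)).prod P), z p.2 p.1 = z' (p.2, p.1) :=
    (Measure.measurePreserving_swap (μ := volume.restrict (Ioo t₀ t₁)) (ν := P)).quasiMeasurePreserving.ae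
      hzz'
  filter_upwards [hv, h2, Measure.ae_ae_of_ae_prod h3] with t k1 k2 k3
  have := Lp.norm_le_of_ae_bound (f := L.compLpL 2 P (v t)) hB0 (by
    filter_upwards [k1, k2, k3, L.coeFn_compLpL (v t)] with ω l1 l2 l3 l4
    rw [l4, l1, l3]
    exact l2)
  simpa [measureUnivNNReal] using this

end Swap

section Lift

variable {Ω V H : Type*} [MeasurableSpace Ω] {P : Measure Ω} [IsProbabilityMeasure P]
  [NormedAddCommGroup V] [InnerProductSpace ℝ V] [CompleteSpace V]
  [NormedAddCommGroup H] [InnerProductSpace ℝ H] [CompleteSpace H] {t₀ t₁ : ℝ}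

theorem adjoint_compLpL (j : V →L[ℝ] H) :
    (j.compLpL 2 P).adjoint = j.adjoint.compLpL 2 P := by
  refine ContinuousLinearMap.ext fun f => ext_inner_right ℝ fun g => ?_
  rw [ContinuousLinearMap.adjoint_inner_left, L2.inner_def, L2.inner_def]
  refine integral_congr_ae ?_
  filter_upwards [j.coeFn_compLpL g, j.adjoint.coeFn_compLpL f] with ω h1 h2
  rw [h1, h2, ContinuousLinearMap.adjoint_inner_left]

theorem injective_compLpL {L : V →L[ℝ] H} (hL : Function.Injective L) :
    Function.Injective (L.compLpL 2 P) := by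
  intro f g hfg
  ext1
  have h1 := L.coeFn_compLpL f
  rw [hfg] at h1
  filter_upwards [h1, L.coeFn_compLpL g] with ω k1 k2
  exact hL (k1.symm.trans k2)

theorem compLpL_const (L : V →L[ℝ] H) (x : V) :
    L.compLpL 2 P (Lp.const 2 P x) = Lp.const 2 P (L x) := by
  ext1
  filter_upwards [L.coeFn_compLpL (Lp.const 2 P x), Lp.coeFn_const (p := 2) (μ := P) x,
    Lp.coeFn_const (p := 2) (μ := P) (L x)] with ω h1 h2 h3
  rw [h1, h2, h3]
  rfl

theorem compLpL_adjoint_comp (j : V →L[ℝ] H) (v : Lp V 2 P) :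
    (j.compLpL 2 P).adjoint (j.compLpL 2 P v) = (j.adjoint.comp j).compLpL 2 P v := by
  rw [adjoint_compLpL]
  ext1
  filter_upwards [j.adjoint.coeFn_compLpL (j.compLpL 2 P v), j.coeFn_compLpL v,
    (j.adjoint.comp j).coeFn_compLpL v] with ω h1 h2 h3
  rw [h1, h2, h3]
  rfl

/-- The integrated evolution equation, valid for almost every `ω`, holds in `L²(Ω; V)`. -/
theorem IsSwap.integrated_eq (h : t₀ < t₁) (j : V →L[ℝ] H) {v q : L2Time (Lp V 2 P) t₀ t₁}
    {u w : Ω → L2Time V t₀ t₁} (hv : IsSwap v u) (hq : IsSwap q w) {c : V}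
    (hu : ∀ᵐ ω ∂P, ∀ᵐ t ∂(volume.restrict (Ioo t₀ t₁)),
      j.adjoint (j (u ω t)) = c + ∫ r in t₀..t, w ω r) :
    ∀ᵐ t ∂(volume.restrict (Ioo t₀ t₁)), (j.compLpL 2 P).adjoint (j.compLpL 2 P (v t)) =
      Lp.const 2 P c + ∫ r in t₀..t, q r := by
  simp only [compLpL_adjoint_comp]
  have iS : IntegrableOn (fun t => (j.adjoint.comp j).compLpL 2 P (v t)) (Ioo t₀ t₁) :=
    ((j.adjoint.comp j).compLpL 2 P).integrable_comp (integrableOn_L2Time v)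
  -- tested against `θ`, both sides can be computed for each `ω` separately
  have key : ∀ θ : ℝ → ℝ, ContDiff ℝ 1 θ → θ t₁ = 0 →
      ∫ t in Ioo t₀ t₁, deriv θ t • (j.adjoint.comp j).compLpL 2 P (v t) =
        -(θ t₀ • Lp.const 2 P c) - ∫ t in Ioo t₀ t₁, θ t • q t := by
    intro θ hθ h1
    have hq' := hq.integral_smul (ContinuousLinearMap.id ℝ V) hθ.continuous
    have e : ∀ t, (ContinuousLinearMap.id ℝ V).compLpL 2 P (q t) = q t := fun t => by
      ext1
      exact (ContinuousLinearMap.id ℝ V).coeFn_compLpL (q t)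
    simp only [e] at hq'
    ext1
    filter_upwards [hv.integral_smul (j.adjoint.comp j) (hθ.continuous_deriv le_rfl), hq', hu,
      Lp.coeFn_sub (-(θ t₀ • Lp.const 2 P c)) (∫ t in Ioo t₀ t₁, θ t • q t),
      Lp.coeFn_neg (θ t₀ • Lp.const 2 P c), Lp.coeFn_smul (θ t₀) (Lp.const 2 P c),
      Lp.coeFn_const (p := 2) (μ := P) c] with ω k1 k2 k3 k4 k5 k6 k7
    rw [k1, k4, Pi.sub_apply, k2, k5, Pi.neg_apply, k6, Pi.smul_apply, k7]
    exact integral_deriv_smul_of_eq_primitive h.le (integrableOn_L2Time (w ω)) k3 hθ h1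
  obtain ⟨c', hc'⟩ := ae_eq_add_primitive h iS (integrableOn_L2Time q) fun θ hθ => by
    have h0 : ∀ t, t ∉ Ioo t₀ t₁ → θ t = 0 := fun t ht =>
      image_eq_zero_of_notMem_tsupport fun hx => ht (hθ.2.2 hx)
    rw [key θ (hθ.1.of_le (by exact_mod_cast le_top)) (h0 t₁ fun ht => ht.2.false),
      h0 t₀ fun ht => ht.1.false, zero_smul, neg_zero, zero_sub]
  -- `θ(t) = t₁ - t` does not vanish at `t₀` and identifies the constant
  have hθ : ContDiff ℝ 1 fun t : ℝ => t₁ - t := by fun_prop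
  have h1 := key _ hθ (sub_self _)
  rw [integral_deriv_smul_of_eq_primitive h.le (integrableOn_L2Time q) hc' hθ (sub_self _)] at h1
  have h2 : c' = Lp.const 2 P c :=
    smul_right_injective _ (sub_pos.2 h).ne' (neg_injective (sub_left_injective h1))
  rwa [h2] at hc'

end Lift

section TimeSobolev

variable {X Z : Type*} [NormedAddCommGroup X] [NormedSpace ℝ X]
  [NormedAddCommGroup Z] [NormedSpace ℝ Z] [CompleteSpace Z] {ι : X →L[ℝ] Z} {t₀ t₁ : ℝ}

/-- The element of the space with prescribed value and time derivative. -/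
def TimeSobolev.mk (v : L2Time X t₀ t₁) (w : L2Time Z t₀ t₁) (h : IsTimeDeriv ι t₀ t₁ v w) :
    TimeSobolev ι t₀ t₁ :=
  (⟨WithLp.toLp 2 (v, w), h⟩ : ↥(timeSobolev ι t₀ t₁))

theorem TimeSobolev.val_mk (v : L2Time X t₀ t₁) (w : L2Time Z t₀ t₁)
    (h : IsTimeDeriv ι t₀ t₁ v w) : (TimeSobolev.mk v w h).val = v := rfl

theorem TimeSobolev.dt_mk (v : L2Time X t₀ t₁) (w : L2Time Z t₀ t₁)
    (h : IsTimeDeriv ι t₀ t₁ v w) : (TimeSobolev.mk v w h).dt = w := rfl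

/-- The weak time derivative is unique. -/
theorem IsTimeDeriv.eq {v : L2Time X t₀ t₁} {w w' : L2Time Z t₀ t₁}
    (h : IsTimeDeriv ι t₀ t₁ v w) (h' : IsTimeDeriv ι t₀ t₁ v w') : w = w' := by
  have hloc : LocallyIntegrableOn (w - w' : L2Time Z t₀ t₁) (Ioo t₀ t₁) volume :=
    locallyIntegrableOn_of_locallyIntegrable_restrict
      ((Lp.memLp (w - w')).locallyIntegrable one_le_two)
  have key := isOpen_Ioo.ae_eq_zero_of_integral_contDiff_smul_eq_zero hloc fun θ hθ hc hs => by
    rw [← setIntegral_eq_integral_of_forall_compl_eq_zero (s := Ioo t₀ t₁) fun t ht => by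
      rw [image_eq_zero_of_notMem_tsupport fun hx => ht (hs hx), zero_smul]]
    have e := h θ ⟨hθ, hc, hs⟩
    rw [h' θ ⟨hθ, hc, hs⟩, neg_inj] at e
    rw [← sub_eq_zero.2 e.symm, ← integral_sub (integrable_smul_of_continuous hθ.continuous hc w)
      (integrable_smul_of_continuous hθ.continuous hc w')]
    refine integral_congr_ae ?_
    filter_upwards [Lp.coeFn_sub w w'] with t ht
    rw [ht, Pi.sub_apply, smul_sub]
  rw [← sub_eq_zero]
  ext1
  refine EventuallyEq.trans ?_ (Lp.coeFn_zero _ _ _).symm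
  exact (ae_restrict_iff' measurableSet_Ioo).2 key

theorem TimeSobolev.ext_val {y y' : TimeSobolev ι t₀ t₁} (h : y.val = y'.val) : y = y' := by
  have h1 := y.isTimeDeriv
  rw [h] at h1
  exact Subtype.ext (WithLp.ofLp_injective 2 (Prod.ext h (h1.eq y'.isTimeDeriv)))

theorem aestronglyMeasurable_timeSobolev {Ω : Type*} [MeasurableSpace Ω] {P : Measure Ω}
    {Y : Ω → TimeSobolev ι t₀ t₁} (h1 : AEStronglyMeasurable (fun ω => (Y ω).val) P)
    (h2 : AEStronglyMeasurable (fun ω => (Y ω).dt) P) : AEStronglyMeasurable Y P := by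
  have h3 : Topology.IsEmbedding
      (fun y : TimeSobolev ι t₀ t₁ => Subtype.val (p := (· ∈ timeSobolev ι t₀ t₁)) y) :=
    Topology.IsEmbedding.subtypeVal
  refine h3.aestronglyMeasurable_comp_iff.1 ?_
  exact (WithLp.prod_continuous_toLp 2 _ _).comp_aestronglyMeasurable (h1.prodMk h2)

end TimeSobolev

/-! ### Bounds for the solution in terms of the data -/

section Bounds

variable {n : ℕ} {D : Set (E n)} {t₀ T : ℝ}
  [IsFiniteMeasure ((volume : Measure (E n)).restrict D)] {a : ℝ → E n → ℝ} {C : ℝ}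
  {κ : E n → ℝ} {m M : ℝ} {y₀ : L2 D} {f : L2Time (L2 D) t₀ (t₀ + T)}
  {u : L2Time (H10 D) t₀ (t₀ + T)}

theorem adjoint_compLp_norm_le (f : L2Time (L2 D) t₀ (t₀ + T)) :
    ‖(toL2 D).adjoint.compLp f‖ ≤ ‖f‖ := by
  have := (toL2 D).adjoint.norm_compLp_le f
  rw [LinearIsometryEquiv.norm_map] at this
  exact this.trans (mul_le_of_le_one_left (norm_nonneg _) (norm_toL2_le D))

/-- The pathwise bounds in `C(H)` and in `W`. -/
theorem IsIntegratedSolution.bounds (hD : IsOpen D) (hT : 0 < T) (hκ : IsDiffusion D κ m M)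
    (ha : IsReaction D t₀ (t₀ + T) a C)
    (hu : IsIntegratedSolution (toL2 D) (evolutionOp κ ha) y₀ f u) :
    (∀ᵐ t ∂(volume.restrict (Ioo t₀ (t₀ + T))), ‖toL2 D (u t)‖ ^ 2 ≤
      Real.exp ((2 * C + 3) * T) * (‖y₀‖ ^ 2 + ‖f‖ ^ 2)) ∧
    ‖u‖ ^ 2 + ‖(toL2 D).adjoint.compLp f - evolutionOp κ ha u‖ ^ 2 ≤
      (Real.exp ((2 * C + 3) * T) * ((1 + ‖1 / m‖) * (1 + 2 * (|M| + C) ^ 2)) + 2) *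
        (‖y₀‖ ^ 2 + ‖f‖ ^ 2) := by
  have h : t₀ < t₀ + T := by linarith
  have hα : 0 < min m 1 := lt_min hκ.pos one_pos
  obtain ⟨h1, h2⟩ := hu.energy_le h (injective_adjoint_toL2 hD) hα.le
    (add_nonneg ha.nonneg zero_le_one) (le_inner_evolutionOp hκ ha u)
  have e : (2 * (C + 1) + 1) * (t₀ + T - t₀) = (2 * C + 3) * T := by ring
  rw [e] at h1 h2
  set K := Real.exp ((2 * C + 3) * T)
  set R := ‖y₀‖ ^ 2 + ‖f‖ ^ 2 with hR
  have hR0 : 0 ≤ R := by positivity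
  have hK0 : 0 < K := Real.exp_pos _
  refine ⟨h1.mono fun t ht => by rwa [mul_comm], ?_⟩
  have h3 : ‖u‖ ^ 2 ≤ K * (1 + ‖1 / m‖) * R := by
    -- the coercivity constant `min m 1` is at least `(1 + 1 / m)⁻¹`
    have h4 : (1 + ‖1 / m‖) * min m 1 ≥ 1 := by
      rw [Real.norm_of_nonneg (by have := hκ.pos; positivity)]
      rcases le_total m 1 with hm | hm
      · rw [min_eq_left hm, add_mul, one_div_mul_cancel hκ.pos.ne']
        linarith [hκ.pos]
      · rw [min_eq_right hm, mul_one]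
        have : 0 ≤ 1 / m := by have := hκ.pos; positivity
        linarith
    have h5 : 0 ≤ 1 + ‖1 / m‖ := by positivity
    calc ‖u‖ ^ 2 ≤ ((1 + ‖1 / m‖) * min m 1) * ‖u‖ ^ 2 :=
          le_mul_of_one_le_left (sq_nonneg _) h4
      _ = (1 + ‖1 / m‖) * (min m 1 * ‖u‖ ^ 2) := by ring
      _ ≤ (1 + ‖1 / m‖) * (R * K) := by
          refine mul_le_mul_of_nonneg_left ?_ h5
          nlinarith [mul_nonneg hα.le (sq_nonneg ‖u‖)]
      _ = _ := by ring
  have h6 : ‖(toL2 D).adjoint.compLp f - evolutionOp κ ha u‖ ^ 2 ≤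
      2 * ‖f‖ ^ 2 + 2 * ((|M| + C) ^ 2 * ‖u‖ ^ 2) := by
    have k1 := (norm_sub_le ((toL2 D).adjoint.compLp f) (evolutionOp κ ha u)).trans
      (add_le_add (adjoint_compLp_norm_le f)
        (ContinuousLinearMap.le_of_opNorm_le _ (norm_evolutionOp_le hκ ha) u))
    refine (pow_le_pow_left₀ (norm_nonneg _) k1 2).trans ?_
    rw [← mul_pow]
    linarith [add_sq_le (a := ‖f‖) (b := (|M| + C) * ‖u‖)]
  have h7 : ‖f‖ ^ 2 ≤ R := by rw [hR]; linarith [sq_nonneg ‖y₀‖]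
  calc _ ≤ ‖u‖ ^ 2 + (2 * ‖f‖ ^ 2 + 2 * ((|M| + C) ^ 2 * ‖u‖ ^ 2)) := by gcongr
    _ = (1 + 2 * (|M| + C) ^ 2) * ‖u‖ ^ 2 + 2 * ‖f‖ ^ 2 := by ring
    _ ≤ (1 + 2 * (|M| + C) ^ 2) * (K * (1 + ‖1 / m‖) * R) + 2 * R := by gcongr
    _ = _ := by ring

/-- The pathwise bound of the initial value by the solution. -/
theorem IsIntegratedSolution.sq_norm_data_le (hD : IsOpen D) (hT : 0 < T)
    (hκ : IsDiffusion D κ m M) (ha : IsReaction D t₀ (t₀ + T) a C)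
    (hu : IsIntegratedSolution (toL2 D) (evolutionOp κ ha) y₀ f u) :
    ‖y₀‖ ^ 2 ≤ (1 / T + 1 + 2 * (|M| + C)) * ‖u‖ ^ 2 + ‖f‖ ^ 2 := by
  have h : t₀ < t₀ + T := by linarith
  have h1 := hu.sq_norm_initial_le h (injective_adjoint_toL2 hD) (abs_inner_evolutionOp_le hκ ha u)
  rw [add_sub_cancel_left] at h1
  have h2 : ‖toL2 D‖ ^ 2 ≤ 1 := pow_le_one₀ (norm_nonneg _) (norm_toL2_le D)
  have h3 : (1 / T + 1) * ‖toL2 D‖ ^ 2 ≤ 1 / T + 1 :=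
    mul_le_of_le_one_right (by positivity) h2
  refine h1.trans (add_le_add (mul_le_mul_of_nonneg_right ?_ (sq_nonneg _)) le_rfl)
  linarith

end Bounds

section RandomCoefficients

variable {n : ℕ} {D : Set (E n)} [IsFiniteMeasure ((volume : Measure (E n)).restrict D)]
  {Ω : Type*} [MeasurableSpace Ω] {P : Measure Ω} [IsProbabilityMeasure P]
  {a : ℝ → E n → ℝ} {C t₀ T : ℝ} {ν : Ω → E n → ℝ} {νmin νmax : Ω → ℝ}

theorem isReaction_of_memLp (ha : MemLp (Function.uncurry a) ∞
      ((volume.restrict (Ioi (0 : ℝ))).prod ((volume : Measure (E n)).restrict D)))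
    {t₀ t₁ : ℝ} (h0 : 0 ≤ t₀) : IsReaction D t₀ t₁ a (eLpNorm (Function.uncurry a) ∞
      ((volume.restrict (Ioi (0 : ℝ))).prod ((volume : Measure (E n)).restrict D))).toReal := by
  have hac : (volume.restrict (Ioo t₀ t₁)).prod ((volume : Measure (E n)).restrict D) ≪
      (volume.restrict (Ioi (0 : ℝ))).prod ((volume : Measure (E n)).restrict D) :=
    (Measure.restrict_mono (Ioo_subset_Ioi_self.trans (Ioi_subset_Ioi h0))
      le_rfl).absolutelyContinuous.prod Measure.AbsolutelyContinuous.rfl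
  have hm := ha.1.mono_ac hac
  refine ⟨hm, ENNReal.toReal_nonneg, ?_⟩
  filter_upwards [hm.prodMk_left, Measure.ae_ae_of_ae_prod (hac.ae_le (ae_abs_le_of_memLp_top ha))]
    with t h1 h2
  exact ⟨h1, h2⟩

theorem ae_isDiffusion
    (hν : AEStronglyMeasurable (Function.uncurry ν) (P.prod (volume.restrict D)))
    (hb : ∀ᵐ ω ∂P, 0 < νmin ω ∧
      ∀ᵐ x ∂(volume.restrict D), νmin ω ≤ ν ω x ∧ ν ω x ≤ νmax ω) :
    ∀ᵐ ω ∂P, IsDiffusion D (ν ω) (νmin ω) (νmax ω) := by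
  filter_upwards [hν.prodMk_left, hb] with ω h1 h2
  exact ⟨h1, h2.1, h2.2⟩

/-- Pathwise solutions that depend measurably on `ω`. -/
theorem exists_measurable_solution (hT : 0 < T)
    (hν : AEStronglyMeasurable (Function.uncurry ν) (P.prod (volume.restrict D)))
    (hd : ∀ᵐ ω ∂P, IsDiffusion D (ν ω) (νmin ω) (νmax ω)) (hmin : AEMeasurable νmin P)
    (hmax : AEMeasurable νmax P) (ha : IsReaction D t₀ (t₀ + T) a C) (y₀ : L2 D)
    (f : L2Time (L2 D) t₀ (t₀ + T)) :
    ∃ u : Ω → L2Time (H10 D) t₀ (t₀ + T), AEStronglyMeasurable u P ∧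
      AEStronglyMeasurable
        (fun ω => (toL2 D).adjoint.compLp f - evolutionOp (ν ω) ha (u ω)) P ∧
      ∀ᵐ ω ∂P, IsIntegratedSolution (toL2 D) (evolutionOp (ν ω) ha) y₀ f (u ω) := by
  have hm : ∀ v, AEStronglyMeasurable (fun ω => evolutionOp (ν ω) ha v) P :=
    aestronglyMeasurable_evolutionOp hν (hd.mono fun _ h => h.memLp) ha
  obtain ⟨u, hu, hu'⟩ := exists_random_evolution (P := P) (by linarith : t₀ < t₀ + T) (toL2 D)
    (B := fun ω t => diffusionOp D (ν ω) + reactionOp D (a t)) hm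
    (b := fun ω => |νmax ω| + C) (α := fun ω => min (νmin ω) 1)
    (hmax.abs.add_const C) (hmin.min aemeasurable_const) (add_nonneg ha.nonneg zero_le_one) (by
      filter_upwards [hd] with ω hω
      exact ⟨norm_evolutionOp_le hω ha, lt_min hω.pos one_pos, coeFn_evolutionOp (ν ω) ha,
        le_inner_diffusion_add_reaction_ae hω ha⟩) y₀ ((toL2 D).adjoint.compLp f)
  exact ⟨u, hu, aestronglyMeasurable_const.sub (aestronglyMeasurable_apply hm hu), hu'⟩

theorem IsSwap.congr {X : Type*} [NormedAddCommGroup X] [InnerProductSpace ℝ X] {t₀ t₁ : ℝ}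
    {v : L2Time (Lp X 2 P) t₀ t₁} {u u' : Ω → L2Time X t₀ t₁} (h : IsSwap v u)
    (huu : ∀ᵐ ω ∂P, u ω = u' ω) : IsSwap v u' := by
  obtain ⟨z, hz, hv, hu⟩ := h
  refine ⟨z, hz, hv, ?_⟩
  filter_upwards [hu, huu] with ω h1 h2
  rwa [← h2]

theorem toDualP_eq_comp : toDualP D P =
    ((rieszL D).compLpL 2 P).comp ((toHP D P).adjoint.comp (toHP D P)) := by
  refine ContinuousLinearMap.ext fun v => ?_
  rw [ContinuousLinearMap.comp_apply, ContinuousLinearMap.comp_apply, toHP, compLpL_adjoint_comp]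
  ext1
  filter_upwards [(toDual D).coeFn_compLpL v, (rieszL D).coeFn_compLpL
    (((toL2 D).adjoint.comp (toL2 D)).compLpL 2 P v),
    ((toL2 D).adjoint.comp (toL2 D)).coeFn_compLpL v] with ω h1 h2 h3
  rw [h2, h3]
  exact h1.trans (toDual_eq D _)

/-- The factor of the pathwise bound in `W` has finite expectation. -/
theorem integrable_bound {νmin νmax : Ω → ℝ} (hmax : ∀ p : ℝ≥0, 1 ≤ p → MemLp νmax p P)
    (hmin : ∀ p : ℝ≥0, 1 ≤ p → MemLp (fun ω => 1 / νmin ω) p P) (K C : ℝ) :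
    Integrable (fun ω => K * ((1 + ‖1 / νmin ω‖) * (1 + 2 * (|νmax ω| + C) ^ 2)) + 2) P := by
  have hmin2 := hmin 2 one_le_two
  have hmax4 := hmax 4 (by norm_num)
  rw [ENNReal.coe_ofNat] at hmin2 hmax4
  have h1 : MemLp (fun ω => 1 + ‖1 / νmin ω‖) 2 P := (memLp_const (1 : ℝ)).add hmin2.norm
  have h2 : MemLp (fun ω => |νmax ω| + C) 4 P := hmax4.norm.add (memLp_const C)
  have h3 : MemLp (fun ω => (|νmax ω| + C) ^ 2) 2 P := by
    rw [memLp_two_iff_integrable_sq (f := fun ω => (|νmax ω| + C) ^ 2) (h2.1.pow 2)]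
    have h4 : Integrable (fun ω => ‖|νmax ω| + C‖ ^ 4) P :=
      MemLp.integrable_norm_pow (p := 4) (by rwa [Nat.cast_ofNat]) four_ne_zero
    refine h4.congr (Eventually.of_forall fun ω => ?_)
    change ‖|νmax ω| + C‖ ^ 4 = ((|νmax ω| + C) ^ 2) ^ 2
    rw [Real.norm_eq_abs, (show Even 4 by decide).pow_abs]
    ring
  have h5 : MemLp (fun ω => 2 * (|νmax ω| + C) ^ 2) 2 P := h3.const_mul 2
  have h6 : MemLp (fun ω => 1 + 2 * (|νmax ω| + C) ^ 2) 2 P := (memLp_const (1 : ℝ)).add h5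
  have h7 : Integrable (fun ω => (1 + ‖1 / νmin ω‖) * (1 + 2 * (|νmax ω| + C) ^ 2)) P :=
    MemLp.integrable_mul h1 h6
  exact (h7.const_mul K).add (integrable_const 2)

end RandomCoefficients

/-! ### Random solutions -/

section Solution

variable {n : ℕ} {D : Set (E n)} [IsFiniteMeasure ((volume : Measure (E n)).restrict D)]
  {Ω : Type*} [MeasurableSpace Ω] {P : Measure Ω} [IsProbabilityMeasure P]
  {a : ℝ → E n → ℝ} {C t₀ T : ℝ} {ν : Ω → E n → ℝ} {νmin νmax : Ω → ℝ} {y₀ : L2 D}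
  {f : L2Time (L2 D) t₀ (t₀ + T)}

/-- Pathwise uniqueness: every random solution is the counterpart of the given pathwise solutions
`u`. -/
theorem IsRandomSolution.isSwap (hD : IsOpen D) (hT : 0 < T)
    (hd : ∀ᵐ ω ∂P, IsDiffusion D (ν ω) (νmin ω) (νmax ω))
    (ha : IsReaction D t₀ (t₀ + T) a C) {u : Ω → L2Time (H10 D) t₀ (t₀ + T)}
    (hu : ∀ᵐ ω ∂P, IsIntegratedSolution (toL2 D) (evolutionOp (ν ω) ha) y₀ f (u ω))
    {y : WP D P t₀ (t₀ + T)} (hy : IsRandomSolution ν a t₀ T y₀ f y) : IsSwap y.val u := by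
  obtain ⟨Y, hyY, hY⟩ := hy
  refine IsSwap.congr (u := fun ω => (Y ω).val) hyY ?_
  filter_upwards [hd, hu, hY] with ω h1 h2 h3
  exact ((isWeakSolution_iff hD hT h1.memLp ha).1 h3).1.eq (by linarith)
    (injective_adjoint_toL2 hD) h2 (lt_min h1.pos one_pos) (add_nonneg ha.nonneg zero_le_one)
    (le_inner_evolutionOp h1 ha)

/-- The random solution assembled from measurable pathwise solutions. -/
theorem exists_isRandomSolution (hD : IsOpen D) (hT : 0 < T)
    (hd : ∀ᵐ ω ∂P, IsDiffusion D (ν ω) (νmin ω) (νmax ω))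
    (ha : IsReaction D t₀ (t₀ + T) a C) {u w : Ω → L2Time (H10 D) t₀ (t₀ + T)}
    (hu2 : MemLp u 2 P) (hw2 : MemLp w 2 P)
    (hw : ∀ ω, w ω = (toL2 D).adjoint.compLp f - evolutionOp (ν ω) ha (u ω))
    (hu : ∀ᵐ ω ∂P, IsIntegratedSolution (toL2 D) (evolutionOp (ν ω) ha) y₀ f (u ω)) :
    ∃ y : WP D P t₀ (t₀ + T), IsRandomSolution ν a t₀ T y₀ f y ∧
      ‖y.val‖ ^ 2 = ∫ ω, ‖u ω‖ ^ 2 ∂P ∧ ‖y.dt‖ ^ 2 = ∫ ω, ‖w ω‖ ^ 2 ∂P ∧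
      ∃ Y : C(Icc t₀ (t₀ + T), HP D P), IsContRep Y (fun t => toHP D P (y.val t)) ∧
        ∀ ht : t₀ ∈ Icc t₀ (t₀ + T), Y ⟨t₀, ht⟩ = Lp.const 2 P y₀ := by
  have h : t₀ < t₀ + T := by linarith
  have hj := injective_adjoint_toL2 hD
  obtain ⟨v, hv, hvn⟩ := exists_isSwap hu2
  obtain ⟨q, hq, hqn⟩ := exists_isSwap hw2
  have hS : ∀ᵐ t ∂(volume.restrict (Ioo t₀ (t₀ + T))), (toHP D P).adjoint (toHP D P (v t)) =
      Lp.const 2 P ((toL2 D).adjoint y₀) + ∫ r in t₀..t, q r := by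
    refine IsSwap.integrated_eq h (toL2 D) hv hq ?_
    filter_upwards [hu] with ω hω
    rw [hw]
    exact hω
  have hdt : IsTimeDeriv (toDualP D P) t₀ (t₀ + T) v (((rieszL D).compLpL 2 P).compLp q) := by
    rw [toDualP_eq_comp]
    exact isTimeDeriv_of_eq_primitive h.le ((toHP D P).adjoint.comp (toHP D P)) _ hS
  let y : WP D P t₀ (t₀ + T) := TimeSobolev.mk v _ hdt
  have hval : y.val = v := TimeSobolev.val_mk v _ hdt
  have hydt : y.dt = ((rieszL D).compLpL 2 P).compLp q := TimeSobolev.dt_mk v _ hdt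
  have hpath : ∀ᵐ ω ∂P, IsTimeDeriv (toDual D) t₀ (t₀ + T) (u ω) ((rieszL D).compLp (w ω)) := by
    filter_upwards [hu] with ω hω
    rw [hw]
    exact hω.isTimeDeriv h.le
  -- `0` on the null set where the path is not a solution
  classical
  let Y : Ω → W D t₀ (t₀ + T) := fun ω =>
    if hω : IsTimeDeriv (toDual D) t₀ (t₀ + T) (u ω) ((rieszL D).compLp (w ω)) then
      TimeSobolev.mk _ _ hω else 0
  have hYu : ∀ᵐ ω ∂P, (Y ω).val = u ω ∧ (Y ω).dt = (rieszL D).compLp (w ω) := by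
    filter_upwards [hpath] with ω hω
    simp only [Y, dif_pos hω]
    exact ⟨TimeSobolev.val_mk _ _ hω, TimeSobolev.dt_mk _ _ hω⟩
  have hYm : AEStronglyMeasurable Y P := by
    refine aestronglyMeasurable_timeSobolev (hu2.1.congr (hYu.mono fun ω hω => hω.1.symm))
      (AEStronglyMeasurable.congr ?_ (hYu.mono fun ω hω => hω.2.symm))
    exact ((rieszL D).compLpL 2 _).continuous.comp_aestronglyMeasurable hw2.1
  have hYp : MemLp Y 2 P := by
    refine (hu2.norm.add hw2.norm).mono hYm ?_
    filter_upwards [hYu] with ω hω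
    have e : ‖Y ω‖ ^ 2 = ‖u ω‖ ^ 2 + ‖w ω‖ ^ 2 := by
      rw [TimeSobolev.norm_sq, hω.1, hω.2, norm_rieszL_compLp]
    have h0 : 0 ≤ ‖u ω‖ + ‖w ω‖ := by positivity
    change ‖Y ω‖ ≤ ‖‖u ω‖ + ‖w ω‖‖
    rw [Real.norm_of_nonneg h0]
    refine (abs_le_of_sq_le_sq' ?_ h0).2
    rw [e]
    nlinarith [mul_nonneg (norm_nonneg (u ω)) (norm_nonneg (w ω))]
  refine ⟨y, ⟨hYp.toLp Y, ?_, ?_⟩, by rw [hval, hvn], ?_, ?_⟩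
  · have : IsSwap y.val fun ω => (hYp.toLp Y ω).val := by
      rw [hval]
      refine hv.congr ?_
      filter_upwards [hYu, hYp.coeFn_toLp] with ω h1 h2
      rw [h2, h1.1]
    exact this
  · filter_upwards [hYu, hYp.coeFn_toLp, hu, hd] with ω h1 h2 h3 h4
    rw [h2, isWeakSolution_iff hD hT h4.memLp ha, h1.1, h1.2, hw]
    exact ⟨h3, rfl⟩
  · have e : ‖((rieszL D).compLpL 2 P).compLp q‖ = ‖q‖ := by
      have k : ∀ᵐ t ∂(volume.restrict (Ioo t₀ (t₀ + T))),
          ‖((rieszL D).compLpL 2 P).compLp q t‖ = ‖q t‖ := by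
        filter_upwards [((rieszL D).compLpL 2 P).coeFn_compLp q] with t ht
        rw [ht]
        exact norm_rieszL_compLp (q t)
      exact le_antisymm (Lp.norm_le_norm_of_ae_le (k.mono fun _ ht => ht.le))
        (Lp.norm_le_norm_of_ae_le (k.mono fun _ ht => ht.ge))
    rw [hydt, e, hqn]
  · rw [hval]
    obtain ⟨Z, hZ⟩ := exists_isContRep h (toHP D P) v q hS
    refine ⟨Z, hZ, fun ht => ?_⟩
    have h0 := (hZ.norm_sq_eq h hS ⟨t₀, ht⟩).1
    rw [intervalIntegral.integral_same, add_zero, ← compLpL_const, toHP, adjoint_compLpL] at h0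
    exact injective_compLpL hj h0

/-- A bound at almost every time bounds the continuous representative. -/
theorem IsContRep.norm_le {X : Type*} [NormedAddCommGroup X] [NormedSpace ℝ X] {t₀ t₁ : ℝ}
    (h : t₀ < t₁) {Y : C(Icc t₀ t₁, X)} {v : ℝ → X} (hY : IsContRep Y v) {B : ℝ} (hB0 : 0 ≤ B)
    (hB : ∀ᵐ t ∂(volume.restrict (Ioo t₀ t₁)), ‖v t‖ ≤ B) : ‖Y‖ ≤ B := by
  rw [ContinuousMap.norm_le _ hB0]
  have hcl : IsClosed {t : Icc t₀ t₁ | ‖Y t‖ ≤ B} :=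
    isClosed_le Y.continuous.norm continuous_const
  have hsub := (dense_Icc_of_ae h (hY.and hB)).closure_eq ▸
    closure_minimal (fun (t : Icc t₀ t₁) ht => by
      change ‖Y t‖ ≤ B
      rw [← ht.2.1 t.2]
      exact ht.2.2) hcl
  exact fun t => hsub (mem_univ t)

theorem integral_inv_pos {g : Ω → ℝ} (hg : AEMeasurable g P) (h1 : ∀ ω, 1 ≤ g ω) :
    Integrable (fun ω => (g ω)⁻¹) P ∧ 0 < ∫ ω, (g ω)⁻¹ ∂P := by
  have h0 : ∀ ω, 0 < (g ω)⁻¹ := fun ω => inv_pos.2 (one_pos.trans_le (h1 ω))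
  have hi : Integrable (fun ω => (g ω)⁻¹) P :=
    Integrable.of_bound hg.inv.aestronglyMeasurable 1 (Eventually.of_forall fun ω => by
      rw [Real.norm_of_nonneg (h0 ω).le]
      exact inv_le_one_of_one_le₀ (h1 ω))
  refine ⟨hi, (integral_pos_iff_support_of_nonneg (fun ω => (h0 ω).le) hi).2 ?_⟩
  have : Function.support (fun ω => (g ω)⁻¹) = univ := eq_univ_of_forall fun ω => (h0 ω).ne'
  rw [this, measure_univ]
  exact one_pos

/-- Integrating `A ≤ g(ω) s(ω) + B` after division by `g`, so that only `1 / g` has to be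
integrable. -/
theorem le_inv_integral_inv_mul {g s : Ω → ℝ} (hg : AEMeasurable g P) (h1 : ∀ ω, 1 ≤ g ω)
    (hs : Integrable s P) {A B : ℝ} (h : ∀ᵐ ω ∂P, A ≤ g ω * s ω + B) :
    A ≤ (∫ ω, (g ω)⁻¹ ∂P)⁻¹ * (∫ ω, s ω ∂P) + B := by
  obtain ⟨hi, hpos⟩ := integral_inv_pos hg h1
  have h2 : (A - B) * ∫ ω, (g ω)⁻¹ ∂P ≤ ∫ ω, s ω ∂P := by
    rw [← integral_const_mul]
    refine integral_mono_ae (hi.const_mul _) hs ?_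
    filter_upwards [h] with ω hω
    have h3 := one_pos.trans_le (h1 ω)
    change (A - B) * (g ω)⁻¹ ≤ s ω
    rw [← div_eq_mul_inv, div_le_iff₀ h3]
    linarith
  rw [mul_comm, ← le_div_iff₀' hpos, div_eq_inv_mul] at h2
  linarith

end Solution

end RandomParabolic

end

theorem mainTheorem5 {n : ℕ} (D : Set (E n)) (hD : IsOpen D) (hDb : Bornology.IsBounded D)
    {Ω : Type*} [MeasurableSpace Ω] (P : Measure Ω) [IsProbabilityMeasure P]
    (νmin νmax : Ω → ℝ)
    (hmax : ∀ p : ℝ≥0, 1 ≤ p → MemLp νmax p P)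
    (hmin : ∀ p : ℝ≥0, 1 ≤ p → MemLp (fun ω => 1 / νmin ω) p P)
    (a : ℝ → E n → ℝ)
    (ha : MemLp (Function.uncurry a) ∞
      ((volume.restrict (Ioi (0 : ℝ))).prod ((volume : Measure (E n)).restrict D)))
    (T : ℝ) (hT : 0 < T) :
    ∃ c₃ c₄ : ℝ, 0 < c₃ ∧ 0 < c₄ ∧
      ∀ ν : Ω → E n → ℝ,
        AEStronglyMeasurable (Function.uncurry ν) (P.prod (volume.restrict D)) →
        (∀ᵐ ω ∂P, 0 < νmin ω ∧
          ∀ᵐ x ∂(volume.restrict D), νmin ω ≤ ν ω x ∧ ν ω x ≤ νmax ω) →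
      ∀ (t₀ : ℝ), 0 < t₀ → ∀ (y₀ : L2 D) (f : L2Time (L2 D) t₀ (t₀ + T)),
        ∃ y : WP D P t₀ (t₀ + T),
          IsRandomSolution ν a t₀ T y₀ f y ∧
          (∀ y' : WP D P t₀ (t₀ + T), IsRandomSolution ν a t₀ T y₀ f y' → y' = y) ∧
          (∃ Y : C(Icc t₀ (t₀ + T), HP D P),
            IsContRep Y (fun t => toHP D P (y.val t)) ∧
            (∀ ht : t₀ ∈ Icc t₀ (t₀ + T), Y ⟨t₀, ht⟩ = Lp.const 2 P y₀) ∧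
            ‖Y‖ ^ 2 + ‖y‖ ^ 2 ≤ c₃ * (‖y₀‖ ^ 2 + ‖f‖ ^ 2)) ∧
          ‖y₀‖ ^ 2 ≤ c₄ * ‖y.val‖ ^ 2 + ‖f‖ ^ 2 := by
  have hfin : IsFiniteMeasure ((volume : Measure (E n)).restrict D) :=
    isFiniteMeasure_restrict.2 hDb.measure_lt_top.ne
  set C : ℝ := (eLpNorm (Function.uncurry a) ∞
    ((volume.restrict (Ioi (0 : ℝ))).prod ((volume : Measure (E n)).restrict D))).toReal
  have hC0 : 0 ≤ C := ENNReal.toReal_nonneg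
  set K : ℝ := Real.exp ((2 * C + 3) * T)
  have hK : 0 < K := Real.exp_pos _
  -- `K` bounds the `H`-norm and `β` the `W`-norm of the paths, so `c₃ = K + 𝔼[β]`
  let β : Ω → ℝ := fun ω =>
    K * ((1 + ‖1 / νmin ω‖) * (1 + 2 * (|νmax ω| + C) ^ 2)) + 2
  have hβ : Integrable β P := integrable_bound hmax hmin K C
  have hβ0 : ∀ ω, 0 ≤ β ω := fun ω => by positivity
  have hmax1 := (hmax 1 le_rfl).1.aemeasurable
  have hmin1 : AEMeasurable νmin P := by
    -- `νmin` is the inverse of `1 / νmin`, also where it vanishes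
    have := (hmin 1 le_rfl).1.aemeasurable.inv
    refine this.congr (Eventually.of_forall fun ω => ?_)
    simp
  -- the factor in the pathwise bound of the initial value, so `c₄ = 1 / 𝔼[1 / g]`
  let g : Ω → ℝ := fun ω => 1 / T + 1 + 2 * (|νmax ω| + C)
  have hg : AEMeasurable g P := ((hmax1.abs.add_const C).const_mul 2).const_add _
  have hg1 : ∀ ω, 1 ≤ g ω := fun ω => by
    have h1 : 0 < 1 / T := one_div_pos.2 hT
    have h2 := abs_nonneg (νmax ω)
    change 1 ≤ 1 / T + 1 + 2 * (|νmax ω| + C)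
    linarith
  refine ⟨K + ∫ ω, β ω ∂P, (∫ ω, (g ω)⁻¹ ∂P)⁻¹, add_pos_of_pos_of_nonneg hK (integral_nonneg hβ0),
    inv_pos.2 (integral_inv_pos hg hg1).2, fun ν hν hνb t₀ ht₀ y₀ f => ?_⟩
  have h : t₀ < t₀ + T := by linarith
  have har : IsReaction D t₀ (t₀ + T) a C := isReaction_of_memLp ha ht₀.le
  have hd := ae_isDiffusion hν hνb
  obtain ⟨u, hum, hwm, hu⟩ := exists_measurable_solution hT hν hd hmin1 hmax1 har y₀ f
  let w : Ω → L2Time (H10 D) t₀ (t₀ + T) := fun ω =>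
    (toL2 D).adjoint.compLp f - evolutionOp (ν ω) har (u ω)
  set R := ‖y₀‖ ^ 2 + ‖f‖ ^ 2 with hR
  have hR0 : 0 ≤ R := by positivity
  have hb : ∀ᵐ ω ∂P, (∀ᵐ t ∂(volume.restrict (Ioo t₀ (t₀ + T))),
      ‖toL2 D (u ω t)‖ ^ 2 ≤ K * R) ∧ ‖u ω‖ ^ 2 + ‖w ω‖ ^ 2 ≤ β ω * R := by
    filter_upwards [hd, hu] with ω h1 h2
    exact h2.bounds hD hT h1 har
  have hu2 : MemLp u 2 P := by
    rw [memLp_two_iff_integrable_sq_norm hum]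
    refine (hβ.mul_const R).mono' (hum.norm.pow 2) ?_
    filter_upwards [hb] with ω hω
    rw [Real.norm_of_nonneg (sq_nonneg _)]
    linarith [hω.2, sq_nonneg ‖w ω‖]
  have hw2 : MemLp w 2 P := by
    rw [memLp_two_iff_integrable_sq_norm hwm]
    refine (hβ.mul_const R).mono' (hwm.norm.pow 2) ?_
    filter_upwards [hb] with ω hω
    rw [Real.norm_of_nonneg (sq_nonneg _)]
    linarith [hω.2, sq_nonneg ‖u ω‖]
  obtain ⟨y, hy, hyv, hyd, Y, hY, hY0⟩ :=
    exists_isRandomSolution hD hT hd har hu2 hw2 (fun _ => rfl) hu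
  have hsw := hy.isSwap hD hT hd har hu
  have iu := (memLp_two_iff_integrable_sq_norm hum).1 hu2
  have iw := (memLp_two_iff_integrable_sq_norm hwm).1 hw2
  refine ⟨y, hy, fun y' hy' => TimeSobolev.ext_val ((hy'.isSwap hD hT hd har hu).eq hsw),
    ⟨Y, hY, hY0, ?_⟩, ?_⟩
  · have hYn : ‖Y‖ ≤ √(K * R) := by
      refine hY.norm_le h (Real.sqrt_nonneg _) ?_
      refine hsw.norm_le (toL2 D) (Real.sqrt_nonneg _) ?_
      filter_upwards [hb] with ω hω
      exact hω.1.mono fun t ht => Real.le_sqrt_of_sq_le ht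
    have h1 : ‖Y‖ ^ 2 ≤ K * R := by
      refine (pow_le_pow_left₀ (norm_nonneg _) hYn 2).trans_eq ?_
      exact Real.sq_sqrt (by positivity)
    have h2 : ‖y‖ ^ 2 ≤ (∫ ω, β ω ∂P) * R := by
      rw [TimeSobolev.norm_sq, hyv, hyd, ← integral_add iu iw, ← integral_mul_const]
      exact integral_mono_ae (iu.add iw) (hβ.mul_const R) (hb.mono fun ω hω => hω.2)
    linarith
  · rw [hyv]
    refine le_inv_integral_inv_mul hg hg1 iu ?_
    filter_upwards [hd, hu] with ω h1 h2
    exact h2.sq_norm_data_le hD hT h1 har
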